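/- Let $1\le s\le\infty$ and let $N$ be a positive integer. The quantum reflection group $H^{s+}_N$ is the compact quantum group whose Hopf $*$-algebra $\mathcal A(H^{s+}_N)$ is the dense $*$-subalgebra generated by the $u_{ij}$ of the universal unital C$^*$-algebra generated by normal elements $u_{ij}$ ($1\le i,j\le N$) such that the matrices $u=(u_{ij})$ and $u^t=(u_{ji})$ are unitary, each $p_{ij}=u_{ij}u_{ij}^*$ is a self-adjoint idempotent and, if $s<\infty$, $u_{ij}^s=p_{ij}$; the coproduct is $\Delta(u_{ij})=\sum_k u_{ik}\otimes u_{kj}$. Equivalently, $\mathcal A(H^{s+}_N)$ is the universal unital $*$-algebra generated by elements $u_{ij}$ subject to these relations and to the relations $p_{ij}u_{ij}=u_{ij}$ and $p_{ij}p_{ik}=0=p_{ji}p_{ki}$ ($j\ne k$), which hold automatically in C$^*$-algebras. For $N\ge 2$ regard $H^{s+}_{N-1}$ as a quantum subgroup of $H^{s+}_N$ through the surjective Hopf $*$-algebra morphism $\mathcal A(H^{s+}_N)\to\mathcal A(H^{s+}_{N-1})$ that sends $u_{ij}$ to $\delta_{ij}$ if $N\in\{i,j\}$ and to $u_{ij}$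 otherwise, and regard the symmetric group $S_N$ as a quantum subgroup of $H^{s+}_N$ through the surjective Hopf $*$-algebra morphism $\mathcal A(H^{s+}_N)\to C(S_N)$ that sends $u_{ij}$ to the indicator function of $\{\sigma : \sigma(j)=i\}$. **Theorem.** For every $N\ge 6$ and every $1\le s\le\infty$, the quantum reflection group $H^{s+}_N$ is topologically generated by its quantum subgroups $H^{s+}_{N-1}$ and $S_N$. That is, for all finite-dimensional $\mathcal A(H^{s+}_N)$-comodules $V$ and $W$, $$\hom_{H^{s+}_N}(V,W)=\hom_{H^{s+}_{N-1}}(V,W)\cap\hom_{S_N}(V,W),$$ where $\hom_G(V,W)$ is the space of linear maps $V\to W$ that are morphisms of $\mathcal A(G)$-comodules, and $V$, $W$ are comodules over $\mathcal A(H^{s+}_{N-1})$ and $C(S_N)$ by restriction along the two surjections above. -/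

import Mathlib

open scoped TensorProduct
open Matrix

noncomputable section

/-! ### Compact quantum groups through their Hopf `*`-algebras -/

/-- A matrix `u` over a coalgebra is multiplicative when `Δ(u i j) = ∑ k, u i k ⊗ u k j`. -/
def IsMultiplicativeMatrix {A : Type*} [Ring A] [HopfAlgebra ℂ A] {n : ℕ}
    (u : Matrix (Fin n) (Fin n) A) : Prop :=
  ∀ i j, Coalgebra.comul (R := ℂ) (u i j) = ∑ k, u i k ⊗ₜ[ℂ] u k j

/-- The Hopf `*`-algebras `𝒜(G)` of compact quantum groups `G`: Hopf algebras over `ℂ` with a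
conjugate linear involution (the instances `StarRing` and `StarModule`) for which `Δ` is a
`*`-homomorphism, generated by the matrix coefficients of the finite-dimensional unitary
corepresentations. -/
class IsCQGAlgebra (A : Type*) [Ring A] [StarRing A] [HopfAlgebra ℂ A] [StarModule ℂ A] :
    Prop where
  comul_star : ∀ a : A,
    Coalgebra.comul (R := ℂ) (star a) = star (Coalgebra.comul (R := ℂ) a : A ⊗[ℂ] A)
  generated : Algebra.adjoin ℂ {a : A | ∃ (n : ℕ) (u : Matrix (Fin n) (Fin n) A),
    u ∈ unitary (Matrix (Fin n) (Fin n) A) ∧ IsMultiplicativeMatrix u ∧ ∃ i j, a = u i j} = ⊤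

/-- A closed quantum subgroup `H < G`, where `A = 𝒜(G)`: a compact quantum group `H` with a
surjective morphism of Hopf `*`-algebras `π : 𝒜(G) → 𝒜(H)`. -/
structure QuantumSubgroup (A : Type*) [Ring A] [StarRing A] [HopfAlgebra ℂ A]
    [StarModule ℂ A] where
  carrier : Type
  [ring : Ring carrier]
  [starRing : StarRing carrier]
  [hopfAlgebra : HopfAlgebra ℂ carrier]
  [starModule : StarModule ℂ carrier]
  [isCQGAlgebra : IsCQGAlgebra carrier]
  π : A →ₐc[ℂ] carrier
  map_star : ∀ a : A, π (star a) = star (π a)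
  surjective : Function.Surjective π

attribute [instance] QuantumSubgroup.ring QuantumSubgroup.starRing QuantumSubgroup.hopfAlgebra
  QuantumSubgroup.starModule QuantumSubgroup.isCQGAlgebra

/-- A (right) comodule structure on `V` over the Hopf algebra `A`; when `V` is
finite-dimensional and `A = 𝒜(G)`, this is a representation of `G` on `V`. -/
structure ComoduleStr (A : Type*) [Ring A] [HopfAlgebra ℂ A]
    (V : Type*) [AddCommGroup V] [Module ℂ V] where
  coact : V →ₗ[ℂ] V ⊗[ℂ] A
  coassoc : (TensorProduct.assoc ℂ V A A).toLinearMap ∘ₗ coact.rTensor A ∘ₗ coact =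
    (Coalgebra.comul (R := ℂ) (A := A)).lTensor V ∘ₗ coact
  counit : (TensorProduct.rid ℂ V).toLinearMap ∘ₗ
    (Coalgebra.counit (R := ℂ) (A := A)).lTensor V ∘ₗ coact = LinearMap.id

namespace ComoduleStr

variable {A B : Type*} [Ring A] [HopfAlgebra ℂ A] [Ring B] [HopfAlgebra ℂ B]
  {V W : Type*} [AddCommGroup V] [Module ℂ V] [AddCommGroup W] [Module ℂ W]

/-- The space `hom_G(V, W)` of morphisms of comodules. -/
def hom (ρ : ComoduleStr A V) (σ : ComoduleStr A W) : Submodule ℂ (V →ₗ[ℂ] W) where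
  carrier := {T | σ.coact ∘ₗ T = T.rTensor A ∘ₗ ρ.coact}
  zero_mem' := by simp
  add_mem' := by
    intro S T hS hT
    simp only [Set.mem_ofPred_eq] at *
    rw [LinearMap.comp_add, hS, hT, LinearMap.rTensor_add, LinearMap.add_comp]
  smul_mem' := by
    intro c T hT
    simp only [Set.mem_ofPred_eq] at *
    rw [LinearMap.comp_smul, hT, LinearMap.rTensor_smul, LinearMap.smul_comp]

/-- Restriction of a comodule along a morphism of Hopf algebras, `(id ⊗ π) ∘ α`. -/
def restrict (ρ : ComoduleStr A V) (π : A →ₐc[ℂ] B) : ComoduleStr B V where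
  coact := (π : A →ₗ[ℂ] B).lTensor V ∘ₗ ρ.coact
  coassoc := by
    have h1 : (Coalgebra.comul (R := ℂ) (A := B)) ∘ₗ (π : A →ₗ[ℂ] B) =
        TensorProduct.map (π : A →ₗ[ℂ] B) (π : A →ₗ[ℂ] B) ∘ₗ Coalgebra.comul :=
      (CoalgHomClass.map_comp_comul π).symm
    have h2 : (TensorProduct.assoc ℂ V B B).toLinearMap ∘ₗ
        ((π : A →ₗ[ℂ] B).lTensor V).rTensor B ∘ₗ (π : A →ₗ[ℂ] B).lTensor (V ⊗[ℂ] A) =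
        (TensorProduct.map (π : A →ₗ[ℂ] B) (π : A →ₗ[ℂ] B)).lTensor V ∘ₗ
          (TensorProduct.assoc ℂ V A A).toLinearMap := by
      ext
      simp
    have h3 : ρ.coact.rTensor B ∘ₗ (π : A →ₗ[ℂ] B).lTensor V =
        (π : A →ₗ[ℂ] B).lTensor (V ⊗[ℂ] A) ∘ₗ ρ.coact.rTensor A := by
      rw [LinearMap.rTensor_comp_lTensor, LinearMap.lTensor_comp_rTensor]
    calc _ = (TensorProduct.assoc ℂ V B B).toLinearMap ∘ₗ
          ((π : A →ₗ[ℂ] B).lTensor V).rTensor B ∘ₗ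
          (ρ.coact.rTensor B ∘ₗ (π : A →ₗ[ℂ] B).lTensor V) ∘ₗ ρ.coact := by
            rw [LinearMap.rTensor_comp]; rfl
      _ = ((TensorProduct.assoc ℂ V B B).toLinearMap ∘ₗ
          ((π : A →ₗ[ℂ] B).lTensor V).rTensor B ∘ₗ (π : A →ₗ[ℂ] B).lTensor (V ⊗[ℂ] A)) ∘ₗ
          ρ.coact.rTensor A ∘ₗ ρ.coact := by rw [h3]; rfl
      _ = (TensorProduct.map (π : A →ₗ[ℂ] B) (π : A →ₗ[ℂ] B)).lTensor V ∘ₗ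
          ((TensorProduct.assoc ℂ V A A).toLinearMap ∘ₗ ρ.coact.rTensor A ∘ₗ ρ.coact) := by
            rw [h2]; rfl
      _ = (TensorProduct.map (π : A →ₗ[ℂ] B) (π : A →ₗ[ℂ] B) ∘ₗ Coalgebra.comul).lTensor V ∘ₗ
          ρ.coact := by rw [ρ.coassoc, LinearMap.lTensor_comp]; rfl
      _ = _ := by rw [← h1, LinearMap.lTensor_comp]; rfl
  counit := by
    have h1 : (Coalgebra.counit (R := ℂ) (A := B)) ∘ₗ (π : A →ₗ[ℂ] B) = Coalgebra.counit :=
      CoalgHomClass.counit_comp π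
    rw [← LinearMap.comp_assoc ρ.coact, ← LinearMap.lTensor_comp, h1, ρ.counit]

/-- The natural inclusion of `hom_G(V, W)` in `hom_H(V, W)` for `H < G`. -/
theorem hom_le_hom_restrict (ρ : ComoduleStr A V) (σ : ComoduleStr A W) (π : A →ₐc[ℂ] B) :
    ρ.hom σ ≤ (ρ.restrict π).hom (σ.restrict π) := by
  intro T hT
  change σ.coact ∘ₗ T = T.rTensor A ∘ₗ ρ.coact at hT
  change ((π : A →ₗ[ℂ] B).lTensor W ∘ₗ σ.coact) ∘ₗ T =
    T.rTensor B ∘ₗ ((π : A →ₗ[ℂ] B).lTensor V ∘ₗ ρ.coact)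
  rw [LinearMap.comp_assoc, hT, ← LinearMap.comp_assoc, ← LinearMap.comp_assoc,
    LinearMap.lTensor_comp_rTensor, LinearMap.rTensor_comp_lTensor]

end ComoduleStr

/-- A family of quantum subgroups `G i < G`, with `A = 𝒜(G)`, topologically generates `G`: for all
(finite-dimensional) representations `V`, `W` of `G`, the natural inclusion of `hom_G(V, W)` in
the intersection of the `hom_{G i}(V, W)` is an equality. -/
def TopologicallyGenerates {A : Type*} [Ring A] [StarRing A] [HopfAlgebra ℂ A] [StarModule ℂ A]
    {ι : Type*} (G : ι → QuantumSubgroup A) : Prop :=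
  ∀ (V W : Type) [AddCommGroup V] [Module ℂ V] [FiniteDimensional ℂ V]
    [AddCommGroup W] [Module ℂ W] [FiniteDimensional ℂ W]
    (ρ : ComoduleStr A V) (σ : ComoduleStr A W),
    ρ.hom σ = ⨅ i, (ρ.restrict (G i).π).hom (σ.restrict (G i).π)

/-! ### The relations of the quantum reflection groups -/

/-- The relations between the generators `u i j` of `𝒜(H_N^{s+})`, in a `*`-algebra. For
`s = ∞` the relation `pow_eq` is void. -/
structure IsReflectionMatrix {B : Type*} [Ring B] [StarRing B] {N : ℕ} (s : ℕ∞)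
    (u : Matrix (Fin N) (Fin N) B) : Prop where
  mem_unitary : u ∈ unitary (Matrix (Fin N) (Fin N) B)
  transpose_mem_unitary : uᵀ ∈ unitary (Matrix (Fin N) (Fin N) B)
  normal : ∀ i j, IsStarNormal (u i j)
  proj : ∀ i j, IsStarProjection (u i j * star (u i j))
  pow_eq : ∀ m : ℕ, 1 ≤ m → s = m → ∀ i j, u i j ^ m = u i j * star (u i j)

/-- The relations of `IsReflectionMatrix` together with their standard consequences in
C*-algebras (see `IsReflectionMatrix.isQuantumReflection`): the `u i j` are partial isometries,
and the projections `u i j * star (u i j)` in a row, or in a column, are pairwise orthogonal. In a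
purely algebraic presentation these have to be listed. -/
structure IsQuantumReflection {B : Type*} [Ring B] [StarRing B] {N : ℕ} (s : ℕ∞)
    (u : Matrix (Fin N) (Fin N) B) : Prop extends IsReflectionMatrix s u where
  partial_isometry : ∀ i j, u i j * star (u i j) * u i j = u i j
  row_orthogonal : ∀ i j k, j ≠ k → (u i j * star (u i j)) * (u i k * star (u i k)) = 0
  col_orthogonal : ∀ i j k, j ≠ k → (u j i * star (u j i)) * (u k i * star (u k i)) = 0

section CStar

variable {B : Type*} [CStarAlgebra B]

theorem orthogonal_of_sum_eq_one {n : ℕ} {p : Fin n → B} (hp : ∀ k, IsStarProjection (p k))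
    (hsum : ∑ k, p k = 1) {j k : Fin n} (hjk : j ≠ k) : p j * p k = 0 := by
  let _ := CStarAlgebra.spectralOrder B
  let _ := CStarAlgebra.spectralOrderedRing B
  have hj := hp j
  have h1 : ∑ l, star (p l * p j) * (p l * p j) = p j := by
    have : ∀ l, star (p l * p j) * (p l * p j) = p j * p l * p j := by
      intro l
      rw [star_mul, (hp l).isSelfAdjoint.star_eq, hj.isSelfAdjoint.star_eq, mul_assoc,
        ← mul_assoc (p l), (hp l).isIdempotentElem.eq, ← mul_assoc]
    simp_rw [this, ← Finset.sum_mul, ← Finset.mul_sum, hsum, mul_one, hj.isIdempotentElem.eq]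
  have h2 : star (p j * p j) * (p j * p j) = p j := by
    rw [hj.isIdempotentElem.eq, hj.isSelfAdjoint.star_eq, hj.isIdempotentElem.eq]
  rw [← Finset.add_sum_erase _ _ (Finset.mem_univ j), h2] at h1
  have h3 := add_eq_left.mp h1
  rw [Finset.sum_eq_zero_iff_of_nonneg (fun l _ => star_mul_self_nonneg _)] at h3
  have h4 := CStarRing.star_mul_self_eq_zero_iff (p k * p j) |>.mp
    (h3 k (Finset.mem_erase.mpr ⟨hjk.symm, Finset.mem_univ _⟩))
  have h5 := congrArg star h4
  rwa [star_mul, (hp k).isSelfAdjoint.star_eq, hj.isSelfAdjoint.star_eq, star_zero] at h5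

theorem IsReflectionMatrix.isQuantumReflection {N : ℕ} {s : ℕ∞} {u : Matrix (Fin N) (Fin N) B}
    (h : IsReflectionMatrix s u) : IsQuantumReflection s u where
  toIsReflectionMatrix := h
  partial_isometry i j := by
    have hp := (h.proj i j).isIdempotentElem.eq
    set x := u i j
    have h0 : (x * star x * x - x) * star (x * star x * x - x) = 0 := by
      have : (x * star x * x - x) * star (x * star x * x - x) =
          (x * star x) * (x * star x) * (x * star x) - (x * star x) * (x * star x)
          - (x * star x) * (x * star x) + x * star x := by
        simp only [star_sub, star_mul, star_star]; noncomm_ring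
      rw [this, hp, hp]; simp
    exact sub_eq_zero.mp ((CStarRing.mul_star_self_eq_zero_iff _).mp h0)
  row_orthogonal i j k hjk := by
    refine orthogonal_of_sum_eq_one (p := fun k => u i k * star (u i k)) (fun k => h.proj i k)
      ?_ hjk
    have h1 : u * star u = 1 := Unitary.mul_star_self_of_mem h.mem_unitary
    simpa [Matrix.mul_apply, Matrix.star_apply] using congrFun (congrFun h1 i) i
  col_orthogonal i j k hjk := by
    refine orthogonal_of_sum_eq_one (p := fun k => u k i * star (u k i)) (fun k => h.proj k i)
      ?_ hjk
    have h1 : uᵀ * star uᵀ = 1 := Unitary.mul_star_self_of_mem h.transpose_mem_unitary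
    simpa [Matrix.mul_apply, Matrix.star_apply] using congrFun (congrFun h1 i) i

end CStar

namespace IsQuantumReflection

variable {B : Type*} [Ring B] [StarRing B] {N : ℕ} {s : ℕ∞}

/-- The unitarity of `u` and `uᵀ`, entry by entry. -/
theorem of_entries {u : Matrix (Fin N) (Fin N) B}
    (h1 : ∀ i j, ∑ k, star (u k i) * u k j = if i = j then 1 else 0)
    (h2 : ∀ i j, ∑ k, u i k * star (u j k) = if i = j then 1 else 0)
    (h3 : ∀ i j, ∑ k, star (u i k) * u j k = if i = j then 1 else 0)
    (h4 : ∀ i j, ∑ k, u k i * star (u k j) = if i = j then 1 else 0)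
    (hn : ∀ i j, star (u i j) * u i j = u i j * star (u i j))
    (hpow : ∀ m : ℕ, 1 ≤ m → s = m → ∀ i j, u i j ^ m = u i j * star (u i j))
    (hpi : ∀ i j, u i j * star (u i j) * u i j = u i j)
    (hr : ∀ i j k, j ≠ k → (u i j * star (u i j)) * (u i k * star (u i k)) = 0)
    (hc : ∀ i j k, j ≠ k → (u j i * star (u j i)) * (u k i * star (u k i)) = 0) :
    IsQuantumReflection s u := by
  refine ⟨⟨?_, ?_, fun i j => ⟨hn i j⟩, fun i j => ⟨?_, IsSelfAdjoint.mul_star_self _⟩, hpow⟩,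
    hpi, hr, hc⟩
  · rw [Unitary.mem_iff]
    constructor <;> ext i j <;> simp [Matrix.mul_apply, Matrix.star_apply, Matrix.one_apply, h1, h2]
  · rw [Unitary.mem_iff]
    constructor <;> ext i j <;> simp [Matrix.mul_apply, Matrix.star_apply, Matrix.one_apply, h3, h4]
  · rw [IsIdempotentElem, ← mul_assoc, hpi]

variable {u : Matrix (Fin N) (Fin N) B}

theorem sum1 (h : IsQuantumReflection s u) (i j : Fin N) : ∑ k, star (u k i) * u k j = if i = j then 1 else 0 := by
  have h1 : star u * u = 1 := (Unitary.mem_iff.mp h.mem_unitary).1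
  simpa [Matrix.mul_apply, Matrix.star_apply, Matrix.one_apply] using congrFun (congrFun h1 i) j

theorem sum2 (h : IsQuantumReflection s u) (i j : Fin N) : ∑ k, u i k * star (u j k) = if i = j then 1 else 0 := by
  have h1 : u * star u = 1 := (Unitary.mem_iff.mp h.mem_unitary).2
  simpa [Matrix.mul_apply, Matrix.star_apply, Matrix.one_apply] using congrFun (congrFun h1 i) j

theorem sum3 (h : IsQuantumReflection s u) (i j : Fin N) : ∑ k, star (u i k) * u j k = if i = j then 1 else 0 := by
  have h1 : star uᵀ * uᵀ = 1 := (Unitary.mem_iff.mp h.transpose_mem_unitary).1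
  simpa [Matrix.mul_apply, Matrix.star_apply, Matrix.one_apply] using congrFun (congrFun h1 i) j

theorem sum4 (h : IsQuantumReflection s u) (i j : Fin N) : ∑ k, u k i * star (u k j) = if i = j then 1 else 0 := by
  have h1 : uᵀ * star uᵀ = 1 := (Unitary.mem_iff.mp h.transpose_mem_unitary).2
  simpa [Matrix.mul_apply, Matrix.star_apply, Matrix.one_apply] using congrFun (congrFun h1 i) j

end IsQuantumReflection

theorem sum_mul_sum_diag {D ι : Type*} [Ring D] [Fintype ι] [DecidableEq ι] (f g : ι → D)
    (h : ∀ k l, k ≠ l → f k * g l = 0) : (∑ k, f k) * (∑ l, g l) = ∑ k, f k * g k := by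
  rw [Finset.sum_mul_sum]
  refine Finset.sum_congr rfl fun k _ => ?_
  exact Finset.sum_eq_single k (fun l _ hl => h k l hl.symm) (by simp)

namespace IsQuantumReflection

variable {B : Type*} [Ring B] [StarRing B] {N : ℕ} {s : ℕ∞}

section
variable {u : Matrix (Fin N) (Fin N) B}

theorem comm (h : IsQuantumReflection s u) (i j : Fin N) : star (u i j) * u i j = u i j * star (u i j) :=
  (h.normal i j).star_comm_self.eq

theorem proj_mul (h : IsQuantumReflection s u) (i j : Fin N) : u i j * star (u i j) * u i j = u i j := h.partial_isometry i j

theorem mul_proj (h : IsQuantumReflection s u) (i j : Fin N) : u i j * (u i j * star (u i j)) = u i j := by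
  rw [← h.comm, ← mul_assoc, h.partial_isometry]

theorem star_mul_proj (h : IsQuantumReflection s u) (i j : Fin N) : star (u i j) * (u i j * star (u i j)) = star (u i j) := by
  have := congrArg star (h.proj_mul i j)
  simpa [mul_assoc] using this

theorem proj_mul_star (h : IsQuantumReflection s u) (i j : Fin N) : u i j * star (u i j) * star (u i j) = star (u i j) := by
  have := congrArg star (h.mul_proj i j)
  simpa [mul_assoc] using this

theorem row_mul (h : IsQuantumReflection s u) (i : Fin N) {k l : Fin N} (hkl : k ≠ l) : u i k * u i l = 0 := by
  rw [← h.mul_proj i k, ← h.proj_mul i l]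
  calc _ = u i k * ((u i k * star (u i k)) * (u i l * star (u i l))) * u i l := by noncomm_ring
    _ = 0 := by rw [h.row_orthogonal i k l hkl]; simp

theorem row_star_mul (h : IsQuantumReflection s u) (i : Fin N) {k l : Fin N} (hkl : k ≠ l) : star (u i k) * u i l = 0 := by
  rw [← h.star_mul_proj i k, ← h.proj_mul i l]
  calc _ = star (u i k) * ((u i k * star (u i k)) * (u i l * star (u i l))) * u i l := by
        noncomm_ring
    _ = 0 := by rw [h.row_orthogonal i k l hkl]; simp

theorem col_mul_star (h : IsQuantumReflection s u) (j : Fin N) {k l : Fin N} (hkl : k ≠ l) : u k j * star (u l j) = 0 := by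
  rw [← h.mul_proj k j, ← h.proj_mul_star l j]
  calc _ = u k j * ((u k j * star (u k j)) * (u l j * star (u l j))) * star (u l j) := by
        noncomm_ring
    _ = 0 := by rw [h.col_orthogonal j k l hkl]; simp

end

/-- The product of two commuting copies; this is what makes `Δ` well defined. -/
theorem mul {v w : Matrix (Fin N) (Fin N) B} (hv : IsQuantumReflection s v)
    (hw : IsQuantumReflection s w) (hc : ∀ i j k l, v i j * w k l = w k l * v i j)
    (hcs : ∀ i j k l, v i j * star (w k l) = star (w k l) * v i j) :
    IsQuantumReflection s (v * w) := by
  have hcs' : ∀ i j k l, star (v i j) * w k l = w k l * star (v i j) := by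
    intro i j k l
    have := congrArg star (hcs i j k l)
    simpa using this.symm
  have hcss : ∀ i j k l, star (v i j) * star (w k l) = star (w k l) * star (v i j) := by
    intro i j k l
    have := congrArg star (hc i j k l)
    simpa using this.symm
  obtain ⟨p, hp⟩ : ∃ p : Fin N → Fin N → B, ∀ i j, p i j = v i j * star (v i j) := ⟨_, fun _ _ => rfl⟩
  obtain ⟨q, hq⟩ : ∃ q : Fin N → Fin N → B, ∀ i j, q i j = w i j * star (w i j) := ⟨_, fun _ _ => rfl⟩
  have hp' : ∀ i j, p i j = star (v i j) * v i j := fun i j => by rw [hp, hv.comm]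
  have hq' : ∀ i j, q i j = star (w i j) * w i j := fun i j => by rw [hq, hw.comm]
  have hpp : ∀ i j, p i j * p i j = p i j := fun i j => by
    rw [hp, (hv.proj i j).isIdempotentElem.eq]
  have hqq : ∀ i j, q i j * q i j = q i j := fun i j => by
    rw [hq, (hw.proj i j).isIdempotentElem.eq]
  have hpr : ∀ i j k, j ≠ k → p i j * p i k = 0 := fun i j k h => by
    rw [hp, hp, hv.row_orthogonal i j k h]
  have hpc : ∀ i j k, j ≠ k → p j i * p k i = 0 := fun i j k h => by
    rw [hp, hp, hv.col_orthogonal i j k h]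
  have hqr : ∀ i j k, j ≠ k → q i j * q i k = 0 := fun i j k h => by
    rw [hq, hq, hw.row_orthogonal i j k h]
  have hqc : ∀ i j k, j ≠ k → q j i * q k i = 0 := fun i j k h => by
    rw [hq, hq, hw.col_orthogonal i j k h]
  have hpv : ∀ i j, p i j * v i j = v i j := fun i j => by rw [hp, hv.proj_mul]
  have hqw : ∀ i j, q i j * w i j = w i j := fun i j => by rw [hq, hw.proj_mul]
  have swap : ∀ a b c d : B, b * c = c * b → a * b * (c * d) = a * c * (b * d) := by
    intro a b c d h
    rw [mul_assoc, ← mul_assoc b, h, mul_assoc, ← mul_assoc]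
  have hqv : ∀ i j k l, q k l * v i j = v i j * q k l := by
    intro i j k l
    rw [hq, mul_assoc, ← hcs, ← mul_assoc, ← hc, mul_assoc]
  have hqp : ∀ i j k l, q k l * p i j = p i j * q k l := by
    intro i j k l
    have h1 : q k l * star (v i j) = star (v i j) * q k l := by
      rw [hq, mul_assoc, ← hcss, ← mul_assoc, ← hcs', mul_assoc]
    rw [hp, ← mul_assoc, hqv, mul_assoc, h1, mul_assoc]
  have hm : ∀ i j, (v * w) i j = ∑ k, v i k * w k j := fun i j => Matrix.mul_apply
  have hms : ∀ i j, star ((v * w) i j) = ∑ k, star (v i k) * star (w k j) := by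
    intro i j
    rw [hm, star_sum]
    exact Finset.sum_congr rfl fun k _ => by rw [star_mul, hcss]
  have hP : ∀ i j, (v * w) i j * star ((v * w) i j) = ∑ k, p i k * q k j := by
    intro i j
    rw [hms, hm, sum_mul_sum_diag]
    · exact Finset.sum_congr rfl fun k _ => by rw [swap _ _ _ _ (hcs' _ _ _ _).symm, hp, hq]
    · intro k l hkl
      rw [swap _ _ _ _ (hcs' _ _ _ _).symm, hw.col_mul_star j hkl, mul_zero]
  have hP' : ∀ i j, star ((v * w) i j) * (v * w) i j = ∑ k, p i k * q k j := by
    intro i j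
    rw [hms, hm, sum_mul_sum_diag]
    · exact Finset.sum_congr rfl fun k _ => by rw [swap _ _ _ _ (hcs _ _ _ _).symm, hp', hq']
    · intro k l hkl
      rw [swap _ _ _ _ (hcs _ _ _ _).symm, hv.row_star_mul i hkl, zero_mul]
  refine ⟨⟨mul_mem hv.mem_unitary hw.mem_unitary, ?_, fun i j => ⟨?_⟩,
    fun i j => ⟨?_, IsSelfAdjoint.mul_star_self _⟩, ?_⟩, ?_, ?_, ?_⟩
  · have : (v * w)ᵀ = wᵀ * vᵀ := by
      ext i j
      simp [Matrix.mul_apply, hc]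
    rw [this]
    exact mul_mem hw.transpose_mem_unitary hv.transpose_mem_unitary
  · rw [Commute, SemiconjBy, hP, hP']
  · rw [IsIdempotentElem, hP, sum_mul_sum_diag]
    · exact Finset.sum_congr rfl fun k _ => by rw [swap _ _ _ _ (hqp _ _ _ _), hpp, hqq]
    · intro k l hkl
      rw [swap _ _ _ _ (hqp _ _ _ _), hpr i k l hkl, zero_mul]
  · intro m hm1 hs i j
    have hpow : ∀ n : ℕ, ((v * w) i j) ^ (n + 1) = ∑ k, v i k ^ (n + 1) * w k j ^ (n + 1) := by
      intro n
      induction n with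
      | zero => simpa using hm i j
      | succ n ih =>
        have hcp : ∀ k l, w k j ^ (n + 1) * v i l = v i l * w k j ^ (n + 1) := fun k l =>
          (Commute.pow_right (show Commute (v i l) (w k j) from hc i l k j) (n + 1)).eq.symm
        rw [pow_succ, ih, hm, sum_mul_sum_diag]
        · exact Finset.sum_congr rfl fun k _ => by
            rw [swap _ _ _ _ (hcp _ _), ← pow_succ, ← pow_succ]
        · intro k l hkl
          rw [swap _ _ _ _ (hcp _ _), pow_succ (v i k), mul_assoc (v i k ^ n),
            hv.row_mul i hkl, mul_zero, zero_mul]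
    obtain ⟨n, rfl⟩ : ∃ n, m = n + 1 := ⟨m - 1, by omega⟩
    rw [hP, hpow]
    exact Finset.sum_congr rfl fun k _ => by
      rw [hv.pow_eq _ hm1 hs, hw.pow_eq _ hm1 hs, hp, hq]
  · intro i j
    rw [hP, hm, sum_mul_sum_diag]
    · exact Finset.sum_congr rfl fun k _ => by rw [swap _ _ _ _ (hqv _ _ _ _), hpv, hqw]
    · intro k l hkl
      rw [swap _ _ _ _ (hqv _ _ _ _), ← hpv i l, ← mul_assoc (p i k), hpr i k l hkl, zero_mul,
        zero_mul]
  · intro i j k hjk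
    rw [hP, hP, sum_mul_sum_diag]
    · exact Finset.sum_eq_zero fun a _ => by
        rw [swap _ _ _ _ (hqp _ _ _ _), hqr a j k hjk, mul_zero]
    · intro a b hab
      rw [swap _ _ _ _ (hqp _ _ _ _), hpr i a b hab, zero_mul]
  · intro i j k hjk
    rw [hP, hP, sum_mul_sum_diag]
    · exact Finset.sum_eq_zero fun a _ => by
        rw [swap _ _ _ _ (hqp _ _ _ _), hpc a j k hjk, zero_mul]
    · intro a b hab
      rw [swap _ _ _ _ (hqp _ _ _ _), hqc i a b hab, mul_zero]

/-- The image of a matrix of generators under a `*`-homomorphism. -/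
theorem map {C : Type*} [Ring C] [StarRing C] {u : Matrix (Fin N) (Fin N) B}
    (h : IsQuantumReflection s u) (f : B →+* C) (hf : ∀ b, f (star b) = star (f b)) :
    IsQuantumReflection s (u.map f) := by
  have hδ : ∀ (b : B) (i j : Fin N) (c : C), b = (if i = j then 1 else 0) →
      f b = c → c = if i = j then 1 else 0 := by
    rintro b i j c rfl rfl
    split_ifs <;> simp
  refine of_entries ?_ ?_ ?_ ?_ ?_ ?_ ?_ ?_ ?_
  · exact fun i j => hδ _ i j _ (h.sum1 i j) (by simp [hf])
  · exact fun i j => hδ _ i j _ (h.sum2 i j) (by simp [hf])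
  · exact fun i j => hδ _ i j _ (h.sum3 i j) (by simp [hf])
  · exact fun i j => hδ _ i j _ (h.sum4 i j) (by simp [hf])
  · intro i j
    simp only [Matrix.map_apply, ← hf, ← map_mul, h.comm]
  · intro m hm hs i j
    simp only [Matrix.map_apply, ← hf, ← map_mul, ← map_pow, h.pow_eq m hm hs]
  · intro i j
    simp only [Matrix.map_apply, ← hf, ← map_mul, h.partial_isometry]
  · intro i j k hjk
    simp only [Matrix.map_apply, ← hf, ← map_mul, h.row_orthogonal i j k hjk, map_zero]
  · intro i j k hjk
    simp only [Matrix.map_apply, ← hf, ← map_mul, h.col_orthogonal i j k hjk, map_zero]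

/-- The matrix of the antipodes of the generators. -/
theorem op_star {u : Matrix (Fin N) (Fin N) B} (h : IsQuantumReflection s u) :
    IsQuantumReflection s
      (fun i j => MulOpposite.op (star (u j i)) : Matrix (Fin N) (Fin N) Bᵐᵒᵖ) := by
  have hδ : ∀ (b : B) (i j : Fin N) (c : Bᵐᵒᵖ), b = (if j = i then 1 else 0) →
      MulOpposite.op b = c → c = if i = j then 1 else 0 := by
    rintro b i j c rfl rfl
    simp only [eq_comm (a := j)]
    split_ifs <;> simp
  refine of_entries ?_ ?_ ?_ ?_ ?_ ?_ ?_ ?_ ?_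
  · exact fun i j => hδ _ i j _ (h.sum3 j i) (by simp [← MulOpposite.op_star])
  · exact fun i j => hδ _ i j _ (h.sum4 j i) (by simp [← MulOpposite.op_star])
  · exact fun i j => hδ _ i j _ (h.sum1 j i) (by simp [← MulOpposite.op_star])
  · exact fun i j => hδ _ i j _ (h.sum2 j i) (by simp [← MulOpposite.op_star])
  · intro i j
    simp only [← MulOpposite.op_star, ← MulOpposite.op_mul, star_star, h.comm]
  · intro m hm hs i j
    simp only [← MulOpposite.op_star, ← MulOpposite.op_mul, ← MulOpposite.op_pow, star_star,
      ← star_pow, h.pow_eq m hm hs]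
    simp
  · intro i j
    simp only [← MulOpposite.op_star, ← MulOpposite.op_mul, star_star, h.star_mul_proj]
  · intro i j k hjk
    simp only [← MulOpposite.op_star, ← MulOpposite.op_mul, star_star,
      h.col_orthogonal i k j hjk.symm, MulOpposite.op_zero]
  · intro i j k hjk
    simp only [← MulOpposite.op_star, ← MulOpposite.op_mul, star_star,
      h.row_orthogonal i k j hjk.symm, MulOpposite.op_zero]

theorem one : IsQuantumReflection s (1 : Matrix (Fin N) (Fin N) B) := by
  refine ⟨⟨one_mem _, by rw [transpose_one]; exact one_mem _, fun i j => ⟨?_⟩, fun i j => ⟨?_, ?_⟩,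
    ?_⟩, ?_, ?_, ?_⟩
  · by_cases hij : i = j <;> simp [Matrix.one_apply, hij]
  · by_cases hij : i = j <;> simp [IsIdempotentElem, Matrix.one_apply, hij]
  · exact IsSelfAdjoint.mul_star_self _
  · intro m hm _ i j
    have hm0 : m ≠ 0 := by omega
    by_cases hij : i = j <;> simp [Matrix.one_apply, hij, hm0]
  · intro i j
    by_cases hij : i = j <;> simp [Matrix.one_apply, hij]
  · intro i j k hjk
    by_cases hij : i = j
    · subst hij; simp [hjk]
    · simp [Matrix.one_apply, hij]
  · intro i j k hjk
    by_cases hij : j = i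
    · subst hij; simp [hjk.symm]
    · simp [Matrix.one_apply, hij]

end IsQuantumReflection

/-! ### The free `*`-algebra -/

/-- The free `*`-algebra `ℂ⟨x, x* | x ∈ X⟩`: the generator `(x, false)` stands for `x` and
`(x, true)` for `x*`. -/
def FreeStarAlgebra (X : Type) : Type := FreeAlgebra ℂ (X × Bool)

namespace FreeStarAlgebra

variable {X : Type}

instance : Ring (FreeStarAlgebra X) := inferInstanceAs (Ring (FreeAlgebra ℂ (X × Bool)))

instance : Algebra ℂ (FreeStarAlgebra X) :=
  inferInstanceAs (Algebra ℂ (FreeAlgebra ℂ (X × Bool)))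

/-- The free generators. -/
def gen (x : X) (b : Bool) : FreeStarAlgebra X := FreeAlgebra.ι ℂ (x, b)

theorem induction {P : FreeStarAlgebra X → Prop} (hC : ∀ c : ℂ, P (algebraMap ℂ _ c))
    (hg : ∀ x b, P (gen x b)) (ha : ∀ a b, P a → P b → P (a + b))
    (hm : ∀ a b, P a → P b → P (a * b)) (a : FreeStarAlgebra X) : P a :=
  FreeAlgebra.induction ℂ (X × Bool) (motive := P) hC (fun x => hg x.1 x.2)
    (fun a b => hm a b) (fun a b => ha a b) a

/-- The algebra homomorphism determined by the images of the `x` and the `x*`. -/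
def liftAlg {B : Type*} [Ring B] [Algebra ℂ B] (f : X → Bool → B) : FreeStarAlgebra X →ₐ[ℂ] B :=
  FreeAlgebra.lift ℂ (fun x : X × Bool => f x.1 x.2)

@[simp]
theorem liftAlg_gen {B : Type*} [Ring B] [Algebra ℂ B] (f : X → Bool → B) (x : X) (b : Bool) :
    liftAlg f (gen x b) = f x b :=
  FreeAlgebra.lift_ι_apply (R := ℂ) (fun x : X × Bool => f x.1 x.2) (x, b)

/-- The opposite algebra, with the complex conjugate scalar multiplication. -/
@[reducible]
def conjMop (X : Type) : Algebra ℂ (FreeStarAlgebra X)ᵐᵒᵖ :=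
  ((algebraMap ℂ (FreeStarAlgebra X)ᵐᵒᵖ).comp (starRingEnd ℂ)).toAlgebra'
    (fun c x => Algebra.commutes (starRingEnd ℂ c) x)

/-- The involution, as a ring homomorphism to the opposite ring. -/
def starHom (X : Type) : FreeStarAlgebra X →+* (FreeStarAlgebra X)ᵐᵒᵖ :=
  letI := conjMop X
  (liftAlg (B := (FreeStarAlgebra X)ᵐᵒᵖ)
    (fun (x : X) (b : Bool) => MulOpposite.op (gen x !b))).toRingHom

theorem starHom_gen (x : X) (b : Bool) :
    starHom X (gen x b) = MulOpposite.op (gen x !b) :=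
  letI := conjMop X
  liftAlg_gen (B := (FreeStarAlgebra X)ᵐᵒᵖ) _ x b

theorem starHom_algebraMap (c : ℂ) :
    starHom X (algebraMap ℂ _ c) = MulOpposite.op (algebraMap ℂ _ (starRingEnd ℂ c)) :=
  letI := conjMop X
  (liftAlg (B := (FreeStarAlgebra X)ᵐᵒᵖ)
    (fun (x : X) (b : Bool) => MulOpposite.op (gen x !b))).commutes c

instance : StarRing (FreeStarAlgebra X) where
  star a := (starHom X a).unop
  star_involutive a := by
    change (starHom X (starHom X a).unop).unop = a
    induction a using induction with
    | hC c => rw [starHom_algebraMap, MulOpposite.unop_op, starHom_algebraMap]; simp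
    | hg x b => rw [starHom_gen, MulOpposite.unop_op, starHom_gen]; simp
    | ha a b h1 h2 => rw [map_add, MulOpposite.unop_add, map_add, MulOpposite.unop_add, h1, h2]
    | hm a b h1 h2 => rw [map_mul, MulOpposite.unop_mul, map_mul, MulOpposite.unop_mul, h1, h2]
  star_mul a b := by rw [map_mul, MulOpposite.unop_mul]
  star_add a b := by rw [map_add, MulOpposite.unop_add]

@[simp]
theorem star_gen (x : X) (b : Bool) : star (gen x b) = gen x !b :=
  congrArg MulOpposite.unop (starHom_gen x b)

theorem star_algebraMap (c : ℂ) :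
    star (algebraMap ℂ (FreeStarAlgebra X) c) = algebraMap ℂ _ (star c) :=
  congrArg MulOpposite.unop (starHom_algebraMap c)

instance : StarModule ℂ (FreeStarAlgebra X) where
  star_smul c a := by
    rw [Algebra.smul_def, star_mul, star_algebraMap, ← Algebra.commutes, Algebra.smul_def]

/-- The universal property, into a `*`-algebra. -/
def lift {B : Type*} [Ring B] [StarRing B] [Algebra ℂ B] (f : X → B) : FreeStarAlgebra X →ₐ[ℂ] B :=
  liftAlg (fun x b => if b then star (f x) else f x)

theorem lift_star {B : Type*} [Ring B] [StarRing B] [Algebra ℂ B] [StarModule ℂ B] (f : X → B)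
    (a : FreeStarAlgebra X) : lift f (star a) = star (lift f a) := by
  induction a using induction with
  | hC c => rw [star_algebraMap, AlgHom.commutes, AlgHom.commutes, algebraMap_star_comm]
  | hg x b => cases b <;> simp [lift]
  | ha a b h1 h2 => simp only [star_add, map_add, h1, h2]
  | hm a b h1 h2 => simp only [star_mul, map_mul, h1, h2]

end FreeStarAlgebra

/-! ### The Hopf `*`-algebra `𝒜(H_N^{s+})` -/

/-- The matrix of generators of the free `*`-algebra on `N ^ 2` generators. -/
def freeMatrix (N : ℕ) : Matrix (Fin N) (Fin N) (FreeStarAlgebra (Fin N × Fin N)) :=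
  fun i j => FreeStarAlgebra.gen (i, j) false

open FreeStarAlgebra in
/-- The defining relations of `𝒜(H_N^{s+})`: those of `IsQuantumReflection`, written out for the
matrix of free generators. -/
inductive ReflRel (N : ℕ) (s : ℕ∞) :
    FreeStarAlgebra (Fin N × Fin N) → FreeStarAlgebra (Fin N × Fin N) → Prop
  | star_mul_self (i j) : ReflRel N s ((star (freeMatrix N) * freeMatrix N) i j)
      ((1 : Matrix (Fin N) (Fin N) (FreeStarAlgebra (Fin N × Fin N))) i j)
  | mul_star_self (i j) : ReflRel N s ((freeMatrix N * star (freeMatrix N)) i j)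
      ((1 : Matrix (Fin N) (Fin N) (FreeStarAlgebra (Fin N × Fin N))) i j)
  | transpose_star_mul_self (i j) : ReflRel N s ((star (freeMatrix N)ᵀ * (freeMatrix N)ᵀ) i j)
      ((1 : Matrix (Fin N) (Fin N) (FreeStarAlgebra (Fin N × Fin N))) i j)
  | transpose_mul_star_self (i j) : ReflRel N s (((freeMatrix N)ᵀ * star (freeMatrix N)ᵀ) i j)
      ((1 : Matrix (Fin N) (Fin N) (FreeStarAlgebra (Fin N × Fin N))) i j)
  | normal (i j) : ReflRel N s (star (freeMatrix N i j) * freeMatrix N i j)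
      (freeMatrix N i j * star (freeMatrix N i j))
  | proj (i j) : ReflRel N s
      ((freeMatrix N i j * star (freeMatrix N i j)) * (freeMatrix N i j * star (freeMatrix N i j)))
      (freeMatrix N i j * star (freeMatrix N i j))
  | pow_eq (m : ℕ) (hm : 1 ≤ m) (hs : s = m) (i j) : ReflRel N s (freeMatrix N i j ^ m)
      (freeMatrix N i j * star (freeMatrix N i j))
  | partial_isometry (i j) : ReflRel N s
      (freeMatrix N i j * star (freeMatrix N i j) * freeMatrix N i j) (freeMatrix N i j)
  | row_orthogonal (i j k) (h : j ≠ k) : ReflRel N s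
      ((freeMatrix N i j * star (freeMatrix N i j)) *
        (freeMatrix N i k * star (freeMatrix N i k))) 0
  | col_orthogonal (i j k) (h : j ≠ k) : ReflRel N s
      ((freeMatrix N j i * star (freeMatrix N j i)) *
        (freeMatrix N k i * star (freeMatrix N k i))) 0
  | star {a b} (h : ReflRel N s a b) : ReflRel N s (star a) (star b)

/-- The `*`-algebra `𝒜(H_N^{s+})`, presented by the generators `u i j` and the relations
`IsQuantumReflection`. -/
def ReflAlg (N : ℕ) (s : ℕ∞) : Type := RingQuot (ReflRel N s)

namespace ReflAlg

variable {N : ℕ} {s : ℕ∞}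

instance : Ring (ReflAlg N s) := inferInstanceAs (Ring (RingQuot (ReflRel N s)))

instance : Algebra ℂ (ReflAlg N s) := inferInstanceAs (Algebra ℂ (RingQuot (ReflRel N s)))

instance : StarRing (ReflAlg N s) :=
  RingQuot.starRing (ReflRel N s) (fun _ _ h => ReflRel.star h)

/-- The quotient map from the free `*`-algebra. -/
def mk (N : ℕ) (s : ℕ∞) : FreeStarAlgebra (Fin N × Fin N) →ₐ[ℂ] ReflAlg N s :=
  RingQuot.mkAlgHom ℂ (ReflRel N s)

theorem mk_surjective : Function.Surjective (mk N s) :=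
  RingQuot.mkAlgHom_surjective ℂ (ReflRel N s)

theorem mk_rel {a b} (h : ReflRel N s a b) : mk N s a = mk N s b :=
  RingQuot.mkAlgHom_rel ℂ h

theorem mk_star (a : FreeStarAlgebra (Fin N × Fin N)) : mk N s (star a) = star (mk N s a) := by
  simp only [mk, RingQuot.mkAlgHom_def, RingQuot.mkRingHom_def]
  rfl

instance : StarModule ℂ (ReflAlg N s) where
  star_smul c a := by
    obtain ⟨a, rfl⟩ := mk_surjective a
    rw [← map_smul, ← mk_star, star_smul, map_smul, mk_star]

/-- The fundamental corepresentation. -/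
def u (N : ℕ) (s : ℕ∞) : Matrix (Fin N) (Fin N) (ReflAlg N s) :=
  fun i j => mk N s (freeMatrix N i j)

theorem isQuantumReflection_u (N : ℕ) (s : ℕ∞) : IsQuantumReflection s (u N s) := by
  have hu : u N s = (mk N s).mapMatrix (freeMatrix N) := rfl
  have hus : star (u N s) = (mk N s).mapMatrix (star (freeMatrix N)) := by
    ext i j; exact (mk_star _).symm
  have hut : (u N s)ᵀ = (mk N s).mapMatrix (freeMatrix N)ᵀ := rfl
  have huts : star (u N s)ᵀ = (mk N s).mapMatrix (star (freeMatrix N)ᵀ) := by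
    ext i j; exact (mk_star _).symm
  have h1 : ∀ M : Matrix (Fin N) (Fin N) (FreeStarAlgebra (Fin N × Fin N)),
      (∀ i j, ReflRel N s (M i j) ((1 : Matrix (Fin N) (Fin N) _) i j)) →
      (mk N s).mapMatrix M = 1 := by
    intro M hM
    rw [← map_one (mk N s).mapMatrix]
    ext i j
    exact mk_rel (hM i j)
  have hs : ∀ i j, star (u N s i j) = mk N s (star (freeMatrix N i j)) :=
    fun i j => (mk_star _).symm
  have hp : ∀ i j, u N s i j = mk N s (freeMatrix N i j) := fun i j => rfl
  refine ⟨⟨?_, ?_, ?_, ?_, ?_⟩, ?_, ?_, ?_⟩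
  · rw [Unitary.mem_iff, hus, hu, ← map_mul, ← map_mul]
    exact ⟨h1 _ ReflRel.star_mul_self, h1 _ ReflRel.mul_star_self⟩
  · rw [Unitary.mem_iff, huts, hut, ← map_mul, ← map_mul]
    exact ⟨h1 _ ReflRel.transpose_star_mul_self, h1 _ ReflRel.transpose_mul_star_self⟩
  · intro i j
    refine ⟨?_⟩
    rw [Commute, SemiconjBy, hs, hp, ← map_mul, ← map_mul]
    exact mk_rel (ReflRel.normal i j)
  · intro i j
    refine ⟨?_, ?_⟩
    · rw [IsIdempotentElem, hs, hp, ← map_mul, ← map_mul]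
      exact mk_rel (ReflRel.proj i j)
    · exact IsSelfAdjoint.mul_star_self _
  · intro m hm h i j
    rw [hs, hp, ← map_mul, ← map_pow]
    exact mk_rel (ReflRel.pow_eq m hm h i j)
  · intro i j
    rw [hs, hp, ← map_mul, ← map_mul]
    exact mk_rel (ReflRel.partial_isometry i j)
  · intro i j k h
    rw [hs, hs, hp, hp, ← map_mul, ← map_mul, ← map_mul, ← map_zero (mk N s)]
    exact mk_rel (ReflRel.row_orthogonal i j k h)
  · intro i j k h
    rw [hs, hs, hp, hp, ← map_mul, ← map_mul, ← map_mul, ← map_zero (mk N s)]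
    exact mk_rel (ReflRel.col_orthogonal i j k h)

theorem induction {P : ReflAlg N s → Prop} (hC : ∀ c : ℂ, P (algebraMap ℂ _ c))
    (hu : ∀ i j, P (u N s i j)) (hs : ∀ i j, P (star (u N s i j)))
    (ha : ∀ a b, P a → P b → P (a + b)) (hm : ∀ a b, P a → P b → P (a * b))
    (a : ReflAlg N s) : P a := by
  obtain ⟨a, rfl⟩ := mk_surjective a
  induction a using FreeStarAlgebra.induction with
  | hC c => rw [AlgHom.commutes]; exact hC c
  | hg x b =>
    cases b
    · exact hu x.1 x.2
    · have := hs x.1 x.2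
      rw [u, ← mk_star, freeMatrix, FreeStarAlgebra.star_gen] at this
      exact this
  | ha a b h1 h2 => rw [map_add]; exact ha _ _ h1 h2
  | hm a b h1 h2 => rw [map_mul]; exact hm _ _ h1 h2

theorem algHom_ext {B : Type*} [Ring B] [Algebra ℂ B] {f g : ReflAlg N s →ₐ[ℂ] B}
    (h1 : ∀ i j, f (u N s i j) = g (u N s i j))
    (h2 : ∀ i j, f (star (u N s i j)) = g (star (u N s i j))) : f = g := by
  ext a
  induction a using ReflAlg.induction with
  | hC c => rw [AlgHom.commutes, AlgHom.commutes]
  | hu i j => exact h1 i j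
  | hs i j => exact h2 i j
  | ha a b ha hb => rw [map_add, map_add, ha, hb]
  | hm a b ha hb => rw [map_mul, map_mul, ha, hb]

section lift

variable {B : Type*} [Ring B] [StarRing B] [Algebra ℂ B] [StarModule ℂ B]

/-- The universal property of `𝒜(H_N^{s+})`. -/
def lift (v : Matrix (Fin N) (Fin N) B) (hv : IsQuantumReflection s v) :
    ReflAlg N s →⋆ₐ[ℂ] B :=
  let f : FreeStarAlgebra (Fin N × Fin N) →ₐ[ℂ] B := FreeStarAlgebra.lift fun x => v x.1 x.2
  have hfs : ∀ a, f (star a) = star (f a) := FreeStarAlgebra.lift_star _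
  have hf : ∀ i j, f (freeMatrix N i j) = v i j := by
    intro i j; simp [f, freeMatrix, FreeStarAlgebra.lift]
  have hr : ∀ ⦃a b⦄, ReflRel N s a b → f a = f b := by
    have hu : f.mapMatrix (freeMatrix N) = v := by ext i j; exact hf i j
    have hus : f.mapMatrix (star (freeMatrix N)) = star v := by
      ext i j; exact (hfs _).trans (congrArg star (hf j i))
    have hut : f.mapMatrix (freeMatrix N)ᵀ = vᵀ := by ext i j; exact hf j i
    have huts : f.mapMatrix (star (freeMatrix N)ᵀ) = star vᵀ := by
      ext i j; exact (hfs _).trans (congrArg star (hf i j))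
    have h1 : ∀ M : Matrix (Fin N) (Fin N) (FreeStarAlgebra (Fin N × Fin N)),
        f.mapMatrix M = 1 → ∀ i j, f (M i j) = f ((1 : Matrix (Fin N) (Fin N) _) i j) := by
      intro M hM i j
      have h2 : f.mapMatrix M = f.mapMatrix 1 := by rw [hM, map_one]
      exact congrFun (congrFun h2 i) j
    intro a b h
    induction h with
    | star_mul_self i j =>
      exact h1 _ (by rw [map_mul, hus, hu]; exact (Unitary.mem_iff.mp hv.mem_unitary).1) i j
    | mul_star_self i j =>
      exact h1 _ (by rw [map_mul, hus, hu]; exact (Unitary.mem_iff.mp hv.mem_unitary).2) i j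
    | transpose_star_mul_self i j =>
      exact h1 _ (by
        rw [map_mul, huts, hut]; exact (Unitary.mem_iff.mp hv.transpose_mem_unitary).1) i j
    | transpose_mul_star_self i j =>
      exact h1 _ (by
        rw [map_mul, huts, hut]; exact (Unitary.mem_iff.mp hv.transpose_mem_unitary).2) i j
    | normal i j => simpa [hfs, hf] using (hv.normal i j).star_comm_self.eq
    | proj i j => simpa [hfs, hf] using (hv.proj i j).isIdempotentElem.eq
    | pow_eq m hm hs i j => simpa [hfs, hf] using hv.pow_eq m hm hs i j
    | partial_isometry i j => simpa [hfs, hf] using hv.partial_isometry i j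
    | row_orthogonal i j k h => simpa [hfs, hf] using hv.row_orthogonal i j k h
    | col_orthogonal i j k h => simpa [hfs, hf] using hv.col_orthogonal i j k h
    | star h ih => rw [hfs, hfs, ih]
  { RingQuot.liftAlgHom ℂ ⟨f, hr⟩ with
    map_star' := by
      intro a
      obtain ⟨a, rfl⟩ := mk_surjective a
      rw [← mk_star]
      change RingQuot.liftAlgHom ℂ ⟨f, hr⟩ (RingQuot.mkAlgHom ℂ (ReflRel N s) (star a)) =
        star (RingQuot.liftAlgHom ℂ ⟨f, hr⟩ (RingQuot.mkAlgHom ℂ (ReflRel N s) a))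
      rw [RingQuot.liftAlgHom_mkAlgHom_apply, RingQuot.liftAlgHom_mkAlgHom_apply, hfs] }

@[simp]
theorem lift_u (v : Matrix (Fin N) (Fin N) B) (hv : IsQuantumReflection s v) (i j : Fin N) :
    lift v hv (u N s i j) = v i j := by
  refine (RingQuot.liftAlgHom_mkAlgHom_apply ℂ _ _ _).trans ?_
  simp [freeMatrix, FreeStarAlgebra.lift]

end lift

/-! #### The Hopf algebra structure -/

/-- The comultiplication, `Δ(u i j) = ∑ k, u i k ⊗ u k j`. -/
def comulHom (N : ℕ) (s : ℕ∞) : ReflAlg N s →⋆ₐ[ℂ] ReflAlg N s ⊗[ℂ] ReflAlg N s :=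
  lift ((u N s).map (Algebra.TensorProduct.includeLeft : _ →ₐ[ℂ] ReflAlg N s ⊗[ℂ] ReflAlg N s) *
      (u N s).map (Algebra.TensorProduct.includeRight : _ →ₐ[ℂ] ReflAlg N s ⊗[ℂ] ReflAlg N s))
    (((isQuantumReflection_u N s).map (RingHomClass.toRingHom
        (Algebra.TensorProduct.includeLeft : _ →ₐ[ℂ] ReflAlg N s ⊗[ℂ] ReflAlg N s))
        (fun b => by simp)).mul
      ((isQuantumReflection_u N s).map (RingHomClass.toRingHom
        (Algebra.TensorProduct.includeRight : _ →ₐ[ℂ] ReflAlg N s ⊗[ℂ] ReflAlg N s))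
        (fun b => by simp))
      (fun i j k l => by simp) (fun i j k l => by simp))

theorem comulHom_u (i j : Fin N) :
    comulHom N s (u N s i j) = ∑ k, u N s i k ⊗ₜ[ℂ] u N s k j := by
  refine (lift_u _ _ i j).trans ?_
  simp [Matrix.mul_apply]

theorem comulHom_star_u (i j : Fin N) :
    comulHom N s (star (u N s i j)) = ∑ k, star (u N s i k) ⊗ₜ[ℂ] star (u N s k j) := by
  rw [map_star, comulHom_u, star_sum]
  simp

/-- The counit, `ε(u i j) = δ i j`. -/
def counitHom (N : ℕ) (s : ℕ∞) : ReflAlg N s →⋆ₐ[ℂ] ℂ :=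
  lift (1 : Matrix (Fin N) (Fin N) ℂ) IsQuantumReflection.one

theorem counitHom_u (i j : Fin N) : counitHom N s (u N s i j) = if i = j then 1 else 0 := by
  simp [counitHom, Matrix.one_apply]

theorem counitHom_star_u (i j : Fin N) :
    counitHom N s (star (u N s i j)) = if i = j then 1 else 0 := by
  rw [map_star, counitHom_u]
  split_ifs <;> simp

/-- The antipode, `S(u i j) = (u j i)*`, as a homomorphism to the opposite algebra. -/
def antipodeHom (N : ℕ) (s : ℕ∞) : ReflAlg N s →⋆ₐ[ℂ] (ReflAlg N s)ᵐᵒᵖ :=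
  lift _ (isQuantumReflection_u N s).op_star

theorem antipodeHom_u (i j : Fin N) :
    antipodeHom N s (u N s i j) = MulOpposite.op (star (u N s j i)) :=
  lift_u _ _ i j

theorem antipodeHom_star_u (i j : Fin N) :
    antipodeHom N s (star (u N s i j)) = MulOpposite.op (u N s j i) := by
  rw [map_star, antipodeHom_u, ← MulOpposite.op_star, star_star]

instance : Bialgebra ℂ (ReflAlg N s) :=
  Bialgebra.ofAlgHom (comulHom N s).toAlgHom (counitHom N s).toAlgHom
    (by
      apply algHom_ext
      · intro i j
        simp [comulHom_u, TensorProduct.sum_tmul, TensorProduct.tmul_sum]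
        exact Finset.sum_comm
      · intro i j
        simp [comulHom_star_u, TensorProduct.sum_tmul, TensorProduct.tmul_sum]
        exact Finset.sum_comm)
    (by
      apply algHom_ext
      · intro i j
        simp [comulHom_u, counitHom_u, TensorProduct.ite_tmul]
      · intro i j
        simp [comulHom_star_u, counitHom_star_u, TensorProduct.ite_tmul])
    (by
      apply algHom_ext
      · intro i j
        simp [comulHom_u, counitHom_u, TensorProduct.tmul_ite]
      · intro i j
        simp [comulHom_star_u, counitHom_star_u, TensorProduct.tmul_ite])

theorem comul_eq (a : ReflAlg N s) : Coalgebra.comul (R := ℂ) a = comulHom N s a := rfl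

theorem counit_eq (a : ReflAlg N s) : Coalgebra.counit (R := ℂ) a = counitHom N s a := rfl

/-- The antipode, as a linear map. -/
def antipodeLin (N : ℕ) (s : ℕ∞) : ReflAlg N s →ₗ[ℂ] ReflAlg N s :=
  (MulOpposite.opLinearEquiv ℂ).symm.toLinearMap ∘ₗ (antipodeHom N s).toAlgHom.toLinearMap

theorem antipodeLin_apply (a : ReflAlg N s) : antipodeLin N s a = (antipodeHom N s a).unop := rfl

theorem antipodeLin_mul (a b : ReflAlg N s) :
    antipodeLin N s (a * b) = antipodeLin N s b * antipodeLin N s a := by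
  simp [antipodeLin_apply]

theorem mul_rTensor (t t' : ReflAlg N s ⊗[ℂ] ReflAlg N s) (c : ℂ)
    (h : LinearMap.mul' ℂ _ ((antipodeLin N s).rTensor _ t) = algebraMap ℂ _ c) :
    LinearMap.mul' ℂ _ ((antipodeLin N s).rTensor _ (t * t')) =
      algebraMap ℂ _ c * LinearMap.mul' ℂ _ ((antipodeLin N s).rTensor _ t') := by
  induction t' with
  | zero => simp
  | add x y hx hy => simp only [mul_add, map_add, hx, hy]
  | tmul a b =>
    have key : LinearMap.mul' ℂ _ ((antipodeLin N s).rTensor _ (t * a ⊗ₜ[ℂ] b)) =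
        antipodeLin N s a * LinearMap.mul' ℂ _ ((antipodeLin N s).rTensor _ t) * b := by
      clear h
      induction t with
      | zero => simp
      | add x y hx hy => simp only [add_mul, mul_add, map_add, hx, hy]
      | tmul x y => simp [antipodeLin_mul, mul_assoc]
    rw [key, h, ← Algebra.commutes]
    simp [mul_assoc]

theorem mul_lTensor (t t' : ReflAlg N s ⊗[ℂ] ReflAlg N s) (c : ℂ)
    (h : LinearMap.mul' ℂ _ ((antipodeLin N s).lTensor _ t') = algebraMap ℂ _ c) :
    LinearMap.mul' ℂ _ ((antipodeLin N s).lTensor _ (t * t')) =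
      LinearMap.mul' ℂ _ ((antipodeLin N s).lTensor _ t) * algebraMap ℂ _ c := by
  induction t with
  | zero => simp
  | add x y hx hy => simp only [add_mul, map_add, hx, hy]
  | tmul a b =>
    have key : LinearMap.mul' ℂ _ ((antipodeLin N s).lTensor _ (a ⊗ₜ[ℂ] b * t')) =
        a * LinearMap.mul' ℂ _ ((antipodeLin N s).lTensor _ t') * antipodeLin N s b := by
      clear h
      induction t' with
      | zero => simp
      | add x y hx hy => simp only [add_mul, mul_add, map_add, hx, hy]
      | tmul x y => simp [antipodeLin_mul, mul_assoc]
    rw [key, h, mul_assoc, Algebra.commutes]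
    simp [mul_assoc]

instance : HopfAlgebra ℂ (ReflAlg N s) where
  antipode := antipodeLin N s
  mul_antipode_rTensor_comul := by
    ext a
    simp only [LinearMap.comp_apply, Algebra.linearMap_apply, comul_eq, counit_eq]
    induction a using ReflAlg.induction with
    | hC c =>
      rw [AlgHomClass.commutes (comulHom N s), AlgHomClass.commutes (counitHom N s),
        Algebra.TensorProduct.algebraMap_apply]
      simp [antipodeLin_apply, AlgHomClass.commutes (antipodeHom N s)]
    | hu i j =>
      rw [comulHom_u, counitHom_u]
      simp only [map_sum, LinearMap.rTensor_tmul, LinearMap.mul'_apply, antipodeLin_apply,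
        antipodeHom_u, MulOpposite.unop_op, (isQuantumReflection_u N s).sum1]
      split_ifs <;> simp
    | hs i j =>
      rw [comulHom_star_u, counitHom_star_u]
      simp only [map_sum, LinearMap.rTensor_tmul, LinearMap.mul'_apply, antipodeLin_apply,
        antipodeHom_star_u, MulOpposite.unop_op, (isQuantumReflection_u N s).sum4]
      split_ifs <;> simp
    | ha a b ha hb => simp only [map_add, ha, hb]
    | hm a b ha hb => rw [map_mul, mul_rTensor _ _ _ ha, hb, map_mul, map_mul]
  mul_antipode_lTensor_comul := by
    ext a
    simp only [LinearMap.comp_apply, Algebra.linearMap_apply, comul_eq, counit_eq]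
    induction a using ReflAlg.induction with
    | hC c =>
      rw [AlgHomClass.commutes (comulHom N s), AlgHomClass.commutes (counitHom N s),
        Algebra.TensorProduct.algebraMap_apply]
      simp [antipodeLin_apply]
    | hu i j =>
      rw [comulHom_u, counitHom_u]
      simp only [map_sum, LinearMap.lTensor_tmul, LinearMap.mul'_apply, antipodeLin_apply,
        antipodeHom_u, MulOpposite.unop_op, (isQuantumReflection_u N s).sum2]
      split_ifs <;> simp
    | hs i j =>
      rw [comulHom_star_u, counitHom_star_u]
      simp only [map_sum, LinearMap.lTensor_tmul, LinearMap.mul'_apply, antipodeLin_apply,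
        antipodeHom_star_u, MulOpposite.unop_op, (isQuantumReflection_u N s).sum3]
      split_ifs <;> simp
    | ha a b ha hb => simp only [map_add, ha, hb]
    | hm a b ha hb => rw [map_mul, mul_lTensor _ _ _ hb, ha, map_mul, map_mul]

theorem isMultiplicativeMatrix_u : IsMultiplicativeMatrix (u N s) := fun i j => comulHom_u i j

instance : IsCQGAlgebra (ReflAlg N s) where
  comul_star a := map_star (comulHom N s) a
  generated := by
    have hq := isQuantumReflection_u N s
    rw [eq_top_iff]
    intro a _
    induction a using ReflAlg.induction with
    | hC c => exact Subalgebra.algebraMap_mem _ c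
    | hu i j =>
      exact Algebra.subset_adjoin ⟨N, u N s, hq.mem_unitary, isMultiplicativeMatrix_u, i, j, rfl⟩
    | hs i j =>
      refine Algebra.subset_adjoin ⟨N, (star (u N s))ᵀ, ?_, fun i j => comulHom_star_u i j, i, j,
        rfl⟩
      have h2 : (star (u N s))ᵀ = star (u N s)ᵀ := rfl
      rw [h2]
      exact Unitary.star_mem hq.transpose_mem_unitary
    | ha a b ha hb => exact add_mem (ha trivial) (hb trivial)
    | hm a b ha hb => exact mul_mem (ha trivial) (hb trivial)

end ReflAlg

/-! ### Functions on a finite group, and the symmetric group -/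

/-- The algebra `C(G)` of functions on a finite group. -/
def FunAlg (G : Type) : Type := G → ℂ

namespace FunAlg

variable {G : Type}

instance : CommRing (FunAlg G) := inferInstanceAs (CommRing (G → ℂ))
instance : Algebra ℂ (FunAlg G) := inferInstanceAs (Algebra ℂ (G → ℂ))
instance : StarRing (FunAlg G) := inferInstanceAs (StarRing (G → ℂ))
instance : StarModule ℂ (FunAlg G) := inferInstanceAs (StarModule ℂ (G → ℂ))

/-- A function on `G`, as an element of `C(G)`. -/
def mk (f : G → ℂ) : FunAlg G := f

/-- Evaluation at a point. -/
def eval (x : G) : FunAlg G →ₐ[ℂ] ℂ := Pi.evalAlgHom ℂ (fun _ : G => ℂ) x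

@[simp] theorem eval_mk (f : G → ℂ) (x : G) : eval x (mk f) = f x := rfl

@[simp] theorem eval_star (f : FunAlg G) (x : G) : eval x (star f) = star (eval x f) := rfl

@[ext]
theorem ext {f g : FunAlg G} (h : ∀ x, eval x f = eval x g) : f = g := funext h

/-- The antipode, `S(f)(x) = f x⁻¹`. -/
def antipodeLin [Group G] : FunAlg G →ₗ[ℂ] FunAlg G where
  toFun f := mk fun x => eval x⁻¹ f
  map_add' _ _ := rfl
  map_smul' _ _ := rfl

theorem eval_antipodeLin [Group G] (f : FunAlg G) (x : G) :
    eval x (antipodeLin f) = eval x⁻¹ f := rfl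

variable [DecidableEq G]

/-- The indicator function of a point. -/
def delta (g : G) : FunAlg G := mk fun x => if x = g then 1 else 0

theorem eval_delta (g x : G) : eval x (delta g) = if x = g then 1 else 0 := rfl

variable [Fintype G]

theorem eq_sum_delta (f : FunAlg G) : f = ∑ g, eval g f • delta g := by
  ext x
  simp [eval_delta]

theorem linearMap_ext {M : Type*} [AddCommGroup M] [Module ℂ M] {f g : FunAlg G →ₗ[ℂ] M}
    (h : ∀ x, f (delta x) = g (delta x)) : f = g := by
  ext a
  rw [eq_sum_delta a]
  simp [h]

/-- `C(G) ⊗ C(G)` is the algebra of functions on `G × G`. -/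
theorem tensor_ext {t t' : FunAlg G ⊗[ℂ] FunAlg G}
    (h : ∀ x y, Algebra.TensorProduct.lift (eval x) (eval y) (fun _ _ => Commute.all _ _) t =
      Algebra.TensorProduct.lift (eval x) (eval y) (fun _ _ => Commute.all _ _) t') : t = t' := by
  have key : ∀ t : FunAlg G ⊗[ℂ] FunAlg G, t = ∑ x, ∑ y,
      (Algebra.TensorProduct.lift (eval x) (eval y) (fun _ _ => Commute.all _ _) t) •
        (delta x ⊗ₜ[ℂ] delta y) := by
    intro t
    induction t with
    | zero => simp
    | add a b ha hb =>
      simp only [map_add, add_smul, Finset.sum_add_distrib]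
      rw [← ha, ← hb]
    | tmul f g =>
      conv_lhs => rw [eq_sum_delta f, eq_sum_delta g]
      simp only [TensorProduct.sum_tmul, TensorProduct.tmul_sum]
      simp only [Algebra.TensorProduct.lift_tmul, TensorProduct.smul_tmul_smul]
      rw [Finset.sum_comm]
  rw [key t, key t']
  simp only [h]


variable [Group G]

/-- `Δ(f)(x, y) = f (x * y)`, that is, `Δ(f) = ∑ x y, f (x * y) • (δ x ⊗ δ y)`. -/
def comulLin : FunAlg G →ₗ[ℂ] FunAlg G ⊗[ℂ] FunAlg G where
  toFun f := ∑ x, ∑ y, eval (x * y) f • (delta x ⊗ₜ[ℂ] delta y)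
  map_add' f g := by simp [add_smul, Finset.sum_add_distrib]
  map_smul' c f := by simp [mul_smul, Finset.smul_sum]

theorem lift_comulLin (f : FunAlg G) (x y : G) :
    Algebra.TensorProduct.lift (eval x) (eval y) (fun _ _ => Commute.all _ _) (comulLin f) =
      eval (x * y) f := by
  simp [comulLin, eval_delta]

theorem comulLin_delta (g : G) :
    comulLin (delta g) = ∑ x, delta x ⊗ₜ[ℂ] delta (x⁻¹ * g) := by
  apply tensor_ext
  intro x y
  rw [lift_comulLin]
  simp only [map_sum, Algebra.TensorProduct.lift_tmul, eval_delta, eq_inv_mul_iff_mul_eq]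
  rw [Finset.sum_eq_single x (fun z _ hz => by simp [hz.symm]) (by simp)]
  simp

instance : Coalgebra ℂ (FunAlg G) where
  comul := comulLin
  counit := (eval 1).toLinearMap
  coassoc := by
    apply linearMap_ext
    intro g
    simp only [LinearMap.comp_apply, comulLin_delta, map_sum, LinearMap.rTensor_tmul,
      LinearMap.lTensor_tmul, TensorProduct.sum_tmul, TensorProduct.tmul_sum,
      LinearEquiv.coe_coe, TensorProduct.assoc_tmul]
    rw [Finset.sum_comm]
    refine Finset.sum_congr rfl fun x _ => ?_
    refine Fintype.sum_equiv (Equiv.mulLeft x⁻¹) _ _ fun y => ?_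
    simp [mul_assoc]
  rTensor_counit_comp_comul := by
    apply linearMap_ext
    intro g
    simp [comulLin_delta, eval_delta, TensorProduct.ite_tmul, eq_comm (a := (1 : G))]
  lTensor_counit_comp_comul := by
    apply linearMap_ext
    intro g
    simp [comulLin_delta, eval_delta, TensorProduct.tmul_ite,
      eq_inv_mul_iff_mul_eq]

theorem comul_eq (f : FunAlg G) : Coalgebra.comul (R := ℂ) f = comulLin f := rfl

theorem counit_eq (f : FunAlg G) : Coalgebra.counit (R := ℂ) f = eval 1 f := rfl

instance : Bialgebra ℂ (FunAlg G) :=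
  Bialgebra.mk' ℂ (FunAlg G) rfl rfl
    (by
      apply tensor_ext
      intro x y
      rw [comul_eq, lift_comulLin, map_one, map_one])
    (by
      intro a b
      apply tensor_ext
      intro x y
      rw [comul_eq, comul_eq, comul_eq, map_mul (Algebra.TensorProduct.lift _ _ _),
        lift_comulLin, lift_comulLin, lift_comulLin, map_mul])

instance : HopfAlgebra ℂ (FunAlg G) where
  antipode := antipodeLin
  mul_antipode_rTensor_comul := by
    apply linearMap_ext
    intro g
    ext x
    simp only [LinearMap.comp_apply, comul_eq, counit_eq, comulLin_delta, map_sum,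
      LinearMap.rTensor_tmul, LinearMap.mul'_apply, map_mul, eval_antipodeLin, eval_delta]
    rw [Finset.sum_eq_single x⁻¹ (fun y _ hy => by simp [hy.symm]) (by simp)]
    by_cases hg : g = 1 <;> simp [hg, Algebra.linearMap_apply, eq_comm]
  mul_antipode_lTensor_comul := by
    apply linearMap_ext
    intro g
    ext x
    simp only [LinearMap.comp_apply, comul_eq, counit_eq, comulLin_delta, map_sum,
      LinearMap.lTensor_tmul, LinearMap.mul'_apply, map_mul, eval_antipodeLin, eval_delta]
    rw [Finset.sum_eq_single x (fun y _ hy => by simp [hy.symm]) (by simp)]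
    by_cases hg : g = 1 <;> simp [hg, Algebra.linearMap_apply, eq_comm]

theorem comul_star (f : FunAlg G) :
    Coalgebra.comul (R := ℂ) (star f) = star (Coalgebra.comul (R := ℂ) f : FunAlg G ⊗[ℂ] FunAlg G) := by
  have hd : ∀ x : G, star (delta x) = delta x := by
    intro x
    ext y
    rw [eval_star, eval_delta]
    split_ifs <;> simp
  simp [comul_eq, comulLin, hd]

end FunAlg

/-- A surjective image of a compact quantum group algebra is one. -/
theorem IsCQGAlgebra.of_surjective {A B : Type*} [Ring A] [StarRing A] [HopfAlgebra ℂ A]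
    [StarModule ℂ A] [IsCQGAlgebra A] [Ring B] [StarRing B] [HopfAlgebra ℂ B] [StarModule ℂ B]
    (hB : ∀ b : B, Coalgebra.comul (R := ℂ) (star b) = star (Coalgebra.comul (R := ℂ) b : B ⊗[ℂ] B))
    (π : A →ₐc[ℂ] B) (hπ : ∀ a, π (star a) = star (π a)) (hs : Function.Surjective π) :
    IsCQGAlgebra B where
  comul_star := hB
  generated := by
    rw [eq_top_iff]
    intro b _
    obtain ⟨a, rfl⟩ := hs b
    have ha : a ∈ Algebra.adjoin ℂ _ := (IsCQGAlgebra.generated (A := A)) ▸ Algebra.mem_top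
    induction ha using Algebra.adjoin_induction with
    | mem x hx =>
      obtain ⟨n, u, hu, hm, i, j, rfl⟩ := hx
      refine Algebra.subset_adjoin ⟨n, u.map π, ?_, ?_, i, j, rfl⟩
      · have h1 : star (u.map π) = (RingHomClass.toRingHom π).mapMatrix (star u) := by
          ext i j
          exact (hπ _).symm
        have h2 : u.map π = (RingHomClass.toRingHom π).mapMatrix u := rfl
        rw [Unitary.mem_iff] at hu ⊢
        rw [h1, h2, ← map_mul, ← map_mul, hu.1, hu.2, map_one]
        exact ⟨rfl, rfl⟩
      · intro i j
        have h3 := CoalgHomClass.map_comp_comul_apply π (u i j)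
        rw [hm i j, map_sum] at h3
        exact h3.symm
    | algebraMap c =>
      have : π (algebraMap ℂ A c) = algebraMap ℂ B c := AlgHomClass.commutes π c
      rw [this]
      exact Subalgebra.algebraMap_mem _ c
    | add x y _ _ hx hy => rw [map_add]; exact add_mem (hx trivial) (hy trivial)
    | mul x y _ _ hx hy => rw [map_mul]; exact mul_mem (hx trivial) (hy trivial)

namespace ReflAlg

/-- A `*`-homomorphism out of `𝒜(H_N^{s+})` which maps the fundamental corepresentation to a
multiplicative matrix is a morphism of Hopf algebras. -/
def liftHopf {N : ℕ} {s : ℕ∞} {B : Type*} [Ring B] [StarRing B] [HopfAlgebra ℂ B] [StarModule ℂ B]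
    (hB : ∀ b : B, Coalgebra.comul (R := ℂ) (star b) = star (Coalgebra.comul (R := ℂ) b : B ⊗[ℂ] B))
    (v : Matrix (Fin N) (Fin N) B) (hv : IsQuantumReflection s v) (hm : IsMultiplicativeMatrix v)
    (hε : ∀ i j, Coalgebra.counit (R := ℂ) (v i j) = if i = j then 1 else 0)
    (hεs : ∀ i j, Coalgebra.counit (R := ℂ) (star (v i j)) = if i = j then 1 else 0) :
    ReflAlg N s →ₐc[ℂ] B :=
  BialgHom.ofAlgHom (lift v hv).toAlgHom
    (by
      apply algHom_ext
      · intro i j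
        change Coalgebra.counit (R := ℂ) (lift v hv (u N s i j)) = counitHom N s (u N s i j)
        rw [lift_u, hε, counitHom_u]
      · intro i j
        change Coalgebra.counit (R := ℂ) (lift v hv (star (u N s i j))) =
          counitHom N s (star (u N s i j))
        rw [map_star, lift_u, hεs, counitHom_star_u])
    (by
      apply algHom_ext
      · intro i j
        change TensorProduct.map _ _ (comulHom N s (u N s i j)) =
          Coalgebra.comul (R := ℂ) (lift v hv (u N s i j))
        rw [comulHom_u, lift_u, hm, map_sum]
        refine Finset.sum_congr rfl fun k _ => ?_
        rw [TensorProduct.map_tmul]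
        exact congrArg₂ _ (lift_u v hv i k) (lift_u v hv k j)
      · intro i j
        change TensorProduct.map _ _ (comulHom N s (star (u N s i j))) =
          Coalgebra.comul (R := ℂ) (lift v hv (star (u N s i j)))
        rw [comulHom_star_u, map_star, lift_u, hB, hm, map_sum, star_sum]
        refine Finset.sum_congr rfl fun k _ => ?_
        rw [TensorProduct.map_tmul, TensorProduct.star_tmul]
        refine congrArg₂ _ ?_ ?_
        · exact (map_star (lift v hv) _).trans (congrArg star (lift_u v hv i k))
        · exact (map_star (lift v hv) _).trans (congrArg star (lift_u v hv k j)))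

end ReflAlg

/-! ### The quantum subgroup `S_N` of `H_N^{s+}` -/

/-- The coordinate functions of `S_N`: `σ ↦ 1` if `σ j = i` and `σ ↦ 0` otherwise. -/
def permMatrix (N : ℕ) : Matrix (Fin N) (Fin N) (FunAlg (Equiv.Perm (Fin N))) :=
  fun i j => FunAlg.mk fun σ => if σ j = i then 1 else 0

theorem eval_permMatrix {N : ℕ} (i j : Fin N) (σ : Equiv.Perm (Fin N)) :
    FunAlg.eval σ (permMatrix N i j) = if σ j = i then 1 else 0 := rfl

theorem isQuantumReflection_permMatrix (N : ℕ) (s : ℕ∞) :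
    IsQuantumReflection s (permMatrix N) := by
  have hs : ∀ i j, star (permMatrix N i j) = permMatrix N i j := by
    intro i j
    ext σ
    rw [FunAlg.eval_star, eval_permMatrix]
    split_ifs <;> simp
  have hi : ∀ i j, permMatrix N i j * permMatrix N i j = permMatrix N i j := by
    intro i j
    ext σ
    simp [eval_permMatrix]
  have hδ : ∀ i j : Fin N, ∀ σ : Equiv.Perm (Fin N),
      FunAlg.eval σ (if i = j then 1 else 0) = if i = j then 1 else 0 := by
    intro i j σ
    split_ifs <;> simp
  refine IsQuantumReflection.of_entries ?_ ?_ ?_ ?_ ?_ ?_ ?_ ?_ ?_ <;> simp only [hs, hi]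
  · intro i j
    ext σ
    simp [eval_permMatrix, hδ, eq_comm]
  · intro i j
    ext σ
    rw [hδ, map_sum, ← Equiv.sum_comp σ⁻¹]
    simp [eval_permMatrix, eq_comm]
  · intro i j
    ext σ
    rw [hδ, map_sum, ← Equiv.sum_comp σ⁻¹]
    simp [eval_permMatrix, eq_comm]
  · intro i j
    ext σ
    simp [eval_permMatrix, hδ, eq_comm]
  · simp
  · intro m hm _ i j
    have hm0 : m ≠ 0 := by omega
    ext σ
    rw [map_pow, eval_permMatrix]
    split_ifs <;> simp [hm0]
  · simp
  · intro i j k hjk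
    ext σ
    simp only [map_mul, eval_permMatrix, map_zero]
    split_ifs with h1 h2
    · exact absurd (σ.injective (h1.trans h2.symm)) hjk
    all_goals simp
  · intro i j k hjk
    ext σ
    simp only [map_mul, eval_permMatrix, map_zero]
    split_ifs with h1 h2
    · exact absurd (h1.symm.trans h2) hjk
    all_goals simp

theorem isMultiplicativeMatrix_permMatrix (N : ℕ) : IsMultiplicativeMatrix (permMatrix N) := by
  intro i j
  apply FunAlg.tensor_ext
  intro x y
  rw [FunAlg.comul_eq, FunAlg.lift_comulLin]
  simp only [eval_permMatrix, Equiv.Perm.mul_apply, map_sum, Algebra.TensorProduct.lift_tmul,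
    mul_ite, mul_one, mul_zero, Finset.sum_ite_eq, Finset.mem_univ, if_true]
  exact if_congr Iff.rfl rfl rfl

/-- `𝒜(H_N^{s+}) → C(S_N)`. -/
def symHom (N : ℕ) (s : ℕ∞) : ReflAlg N s →ₐc[ℂ] FunAlg (Equiv.Perm (Fin N)) :=
  ReflAlg.liftHopf FunAlg.comul_star (permMatrix N) (isQuantumReflection_permMatrix N s)
    (isMultiplicativeMatrix_permMatrix N)
    (fun i j => by simp [FunAlg.counit_eq, eval_permMatrix, eq_comm])
    (fun i j => by
      rw [FunAlg.counit_eq, FunAlg.eval_star, eval_permMatrix]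
      simp only [Equiv.Perm.one_apply, eq_comm (a := j)]
      split_ifs <;> simp)

theorem symHom_u {N : ℕ} {s : ℕ∞} (i j : Fin N) :
    symHom N s (ReflAlg.u N s i j) = permMatrix N i j :=
  ReflAlg.lift_u _ _ i j

theorem symHom_star {N : ℕ} {s : ℕ∞} (a : ReflAlg N s) :
    symHom N s (star a) = star (symHom N s a) :=
  map_star (ReflAlg.lift (permMatrix N) (isQuantumReflection_permMatrix N s)) a

theorem symHom_surjective (N : ℕ) (s : ℕ∞) : Function.Surjective (symHom N s) := by
  intro f
  refine ⟨∑ σ : Equiv.Perm (Fin N), FunAlg.eval σ f •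
    (List.ofFn fun j => ReflAlg.u N s (σ j) j).prod, ?_⟩
  have h : ∀ σ : Equiv.Perm (Fin N),
      symHom N s (List.ofFn fun j => ReflAlg.u N s (σ j) j).prod = FunAlg.delta σ := by
    intro σ
    rw [map_list_prod, List.map_ofFn, List.prod_ofFn]
    ext τ
    simp only [map_prod, Function.comp, symHom_u, eval_permMatrix, FunAlg.eval_delta]
    rw [Finset.prod_ite_zero]
    simp [Equiv.ext_iff]
  rw [map_sum]
  conv_rhs => rw [FunAlg.eq_sum_delta f]
  refine Finset.sum_congr rfl fun σ _ => ?_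
  rw [map_smul, h]

instance (N : ℕ) : IsCQGAlgebra (FunAlg (Equiv.Perm (Fin N))) :=
  IsCQGAlgebra.of_surjective FunAlg.comul_star (symHom N ⊤) symHom_star (symHom_surjective N ⊤)

/-- The quantum subgroup `S_N < H_N^{s+}` of permutation matrices. -/
def symmetricSubgroup (N : ℕ) (s : ℕ∞) : QuantumSubgroup (ReflAlg N s) where
  carrier := FunAlg (Equiv.Perm (Fin N))
  π := symHom N s
  map_star := symHom_star
  surjective := symHom_surjective N s

/-! ### The quantum subgroup `H_{N-1}^{s+}` of `H_N^{s+}` -/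

/-- Extend an `(N - 1) × (N - 1)` matrix by `1` in the last diagonal entry, and by `0` in the
other entries of the last row and the last column. -/
def cornerMatrix {B : Type*} [Ring B] (N : ℕ) (v : Matrix (Fin (N - 1)) (Fin (N - 1)) B) :
    Matrix (Fin N) (Fin N) B :=
  fun i j => if h : i.val < N - 1 ∧ j.val < N - 1 then v ⟨i, h.1⟩ ⟨j, h.2⟩
    else if i = j then 1 else 0

section corner

variable {B : Type*} [Ring B] {n : ℕ} (v : Matrix (Fin n) (Fin n) B)

theorem cornerMatrix_castSucc_castSucc (i j : Fin n) :
    cornerMatrix (n + 1) v i.castSucc j.castSucc = v i j := by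
  simp [cornerMatrix]

theorem cornerMatrix_castSucc_last (i : Fin n) :
    cornerMatrix (n + 1) v i.castSucc (Fin.last n) = 0 := by
  simp [cornerMatrix, (Fin.castSucc_lt_last i).ne]

theorem cornerMatrix_last_castSucc (i : Fin n) :
    cornerMatrix (n + 1) v (Fin.last n) i.castSucc = 0 := by
  simp [cornerMatrix, (Fin.castSucc_lt_last i).ne']

theorem cornerMatrix_last_last :
    cornerMatrix (n + 1) v (Fin.last n) (Fin.last n) = 1 := by
  simp [cornerMatrix]

end corner

theorem IsQuantumReflection.corner {B : Type*} [Ring B] [StarRing B] {N : ℕ} {s : ℕ∞}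
    {v : Matrix (Fin (N - 1)) (Fin (N - 1)) B} (h : IsQuantumReflection s v) :
    IsQuantumReflection s (cornerMatrix N v) := by
  cases N with
  | zero =>
    refine of_entries ?_ ?_ ?_ ?_ ?_ ?_ ?_ ?_ ?_
    all_goals first | exact fun i => i.elim0 | exact fun _ _ _ i => i.elim0
  | succ n =>
    change Matrix (Fin n) (Fin n) B at v
    have e1 := cornerMatrix_castSucc_castSucc v
    have e2 := cornerMatrix_castSucc_last v
    have e3 := cornerMatrix_last_castSucc v
    have e4 := cornerMatrix_last_last v
    have d1 : ∀ i : Fin n, i.castSucc ≠ Fin.last n := fun i => (Fin.castSucc_lt_last i).ne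
    have d2 : ∀ i : Fin n, Fin.last n ≠ i.castSucc := fun i => (Fin.castSucc_lt_last i).ne'
    have s1 : ∀ i j : Fin n, ∑ k, star (v k i) * v k j = if i = j then 1 else 0 := h.sum1
    have s2 : ∀ i j : Fin n, ∑ k, v i k * star (v j k) = if i = j then 1 else 0 := h.sum2
    have s3 : ∀ i j : Fin n, ∑ k, star (v i k) * v j k = if i = j then 1 else 0 := h.sum3
    have s4 : ∀ i j : Fin n, ∑ k, v k i * star (v k j) = if i = j then 1 else 0 := h.sum4
    refine of_entries ?_ ?_ ?_ ?_ ?_ ?_ ?_ ?_ ?_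
    · intro i j
      induction i using Fin.lastCases <;> induction j using Fin.lastCases <;>
        simp [Fin.sum_univ_castSucc, e1, e2, e3, e4, d1, d2, s1]
    · intro i j
      induction i using Fin.lastCases <;> induction j using Fin.lastCases <;>
        simp [Fin.sum_univ_castSucc, e1, e2, e3, e4, d1, d2, s2]
    · intro i j
      induction i using Fin.lastCases <;> induction j using Fin.lastCases <;>
        simp [Fin.sum_univ_castSucc, e1, e2, e3, e4, d1, d2, s3]
    · intro i j
      induction i using Fin.lastCases <;> induction j using Fin.lastCases <;>
        simp [Fin.sum_univ_castSucc, e1, e2, e3, e4, d1, d2, s4]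
    · intro i j
      induction i using Fin.lastCases <;> induction j using Fin.lastCases <;>
        simp [e1, e2, e3, e4, h.comm]
    · intro m hm hs i j
      have hm0 : m ≠ 0 := by omega
      induction i using Fin.lastCases <;> induction j using Fin.lastCases <;>
        simp [e1, e2, e3, e4, h.pow_eq m hm hs, hm0]
    · intro i j
      induction i using Fin.lastCases <;> induction j using Fin.lastCases <;>
        simp [e1, e2, e3, e4, h.proj_mul]
    · intro i j k hjk
      induction i using Fin.lastCases <;> induction j using Fin.lastCases <;>
        induction k using Fin.lastCases <;> simp [e1, e2, e3, e4] at hjk ⊢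
      exact h.row_orthogonal _ _ _ hjk
    · intro i j k hjk
      induction i using Fin.lastCases <;> induction j using Fin.lastCases <;>
        induction k using Fin.lastCases <;> simp [e1, e2, e3, e4] at hjk ⊢
      exact h.col_orthogonal _ _ _ hjk

theorem IsMultiplicativeMatrix.corner {B : Type*} [Ring B] [HopfAlgebra ℂ B] {N : ℕ}
    {v : Matrix (Fin (N - 1)) (Fin (N - 1)) B} (h : IsMultiplicativeMatrix v) :
    IsMultiplicativeMatrix (cornerMatrix N v) := by
  cases N with
  | zero => exact fun i => i.elim0
  | succ n =>
    change Matrix (Fin n) (Fin n) B at v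
    have e1 := cornerMatrix_castSucc_castSucc v
    have e2 := cornerMatrix_castSucc_last v
    have e3 := cornerMatrix_last_castSucc v
    have e4 := cornerMatrix_last_last v
    have h' : ∀ i j, Coalgebra.comul (R := ℂ) (v i j) = ∑ k, v i k ⊗ₜ[ℂ] v k j := h
    intro i j
    induction i using Fin.lastCases <;> induction j using Fin.lastCases <;>
      simp [Fin.sum_univ_castSucc, e1, e2, e3, e4, h', Algebra.TensorProduct.one_def]

theorem cornerMatrix_counit {B : Type*} [Ring B] [HopfAlgebra ℂ B] {N : ℕ}
    {v : Matrix (Fin (N - 1)) (Fin (N - 1)) B}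
    (h : ∀ i j, Coalgebra.counit (R := ℂ) (v i j) = if i = j then 1 else 0) (i j : Fin N) :
    Coalgebra.counit (R := ℂ) (cornerMatrix N v i j) = if i = j then 1 else 0 := by
  unfold cornerMatrix
  split_ifs with h1 h2 h3
  · rw [h]; simp [h2]
  · rw [h]; simp [Fin.val_inj, h2]
  · simp
  · simp

/-- `𝒜(H_N^{s+}) → 𝒜(H_{N-1}^{s+})`, sending `u i j` to `δ i j` when `i` or `j` is the last index,
and to `u i j` otherwise. -/
def cornerHom (N : ℕ) (s : ℕ∞) : ReflAlg N s →ₐc[ℂ] ReflAlg (N - 1) s :=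
  ReflAlg.liftHopf IsCQGAlgebra.comul_star (cornerMatrix N (ReflAlg.u (N - 1) s))
    (ReflAlg.isQuantumReflection_u (N - 1) s).corner
    ReflAlg.isMultiplicativeMatrix_u.corner
    (cornerMatrix_counit ReflAlg.counitHom_u)
    (fun i j => by
      rw [ReflAlg.counit_eq, map_star, ← ReflAlg.counit_eq,
        cornerMatrix_counit ReflAlg.counitHom_u]
      split_ifs <;> simp)

theorem cornerHom_u {N : ℕ} {s : ℕ∞} (i j : Fin N) :
    cornerHom N s (ReflAlg.u N s i j) = cornerMatrix N (ReflAlg.u (N - 1) s) i j :=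
  ReflAlg.lift_u _ _ i j

theorem cornerHom_star {N : ℕ} {s : ℕ∞} (a : ReflAlg N s) :
    cornerHom N s (star a) = star (cornerHom N s a) :=
  map_star (ReflAlg.lift (cornerMatrix N (ReflAlg.u (N - 1) s))
    (ReflAlg.isQuantumReflection_u (N - 1) s).corner) a

theorem cornerHom_surjective (N : ℕ) (s : ℕ∞) : Function.Surjective (cornerHom N s) := by
  have hg : ∀ i j : Fin (N - 1), ∃ i' j' : Fin N,
      cornerHom N s (ReflAlg.u N s i' j') = ReflAlg.u (N - 1) s i j := by
    intro i j
    have hi := i.isLt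
    have hj := j.isLt
    refine ⟨⟨i, by omega⟩, ⟨j, by omega⟩, ?_⟩
    rw [cornerHom_u]
    simp [cornerMatrix]
  intro a
  induction a using ReflAlg.induction with
  | hC c => exact ⟨algebraMap ℂ _ c, AlgHomClass.commutes (cornerHom N s) c⟩
  | hu i j =>
    obtain ⟨i', j', h⟩ := hg i j
    exact ⟨_, h⟩
  | hs i j =>
    obtain ⟨i', j', h⟩ := hg i j
    exact ⟨star _, by rw [cornerHom_star, h]⟩
  | ha a b ha hb =>
    obtain ⟨a, rfl⟩ := ha
    obtain ⟨b, rfl⟩ := hb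
    exact ⟨a + b, map_add _ _ _⟩
  | hm a b ha hb =>
    obtain ⟨a, rfl⟩ := ha
    obtain ⟨b, rfl⟩ := hb
    exact ⟨a * b, map_mul _ _ _⟩

/-- The quantum subgroup `H_{N-1}^{s+} < H_N^{s+}`. -/
def cornerSubgroup (N : ℕ) (s : ℕ∞) : QuantumSubgroup (ReflAlg N s) where
  carrier := ReflAlg (N - 1) s
  π := cornerHom N s
  map_star := cornerHom_star
  surjective := cornerHom_surjective N s

end

/-!
The proof recovers the morphisms from the Haar functionals. Every morphism of comodules is visible
in a matrix `z = t * T * r⁻¹`, where `r` and `t` are the matrices of the comodules and `T` is a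
scalar matrix: `T` intertwines `r` and `t` if and only if `z = T`, and, by invariance of the Haar
functional, if and only if the Haar functional maps `z` to `T`
(`ReflAlg.intertwines_of_haar_conjMatrix`). If `T` is a morphism for `H_{N-1}^{s+}` and for `S_N`,
then the functionals of these subgroups, and all convolution products of them, map `z` to `T`. So
it suffices to approximate the Haar functional of `H_N^{s+}` by such products. The mean `φ` of the
Haar functional of `H_{N-1}^{s+}` and of the evaluation at a transposition which moves the last
letter acts on a tensor power of the fundamental representation as the mean of a projection and a
unitary. By the mean ergodic theorem, the averages of the convolution powers of `φ` converge to the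
projection onto the vectors fixed by both (`tendsto_average_pow`), and it remains to see that these
are the vectors fixed by `H_N^{s+}`.

The vectors fixed by `H_N^{s+}` are the combinations of noncrossing partitions in which every block
has weight zero in `ℤ/s`, where `u` has weight `1` and its adjoint has weight `-1`. They are fixed
(`IsQuantumReflection.coeffSum_eq`) because the entries of `u` can be raised to powers in `ℤ/s`.
Conversely, the orthogonal projections onto their spans are compatible with merging points and with
removing singletons. For that reason the entries of these projections respect the defining relations
and give a functional on `𝒜(H_N^{s+})`, the Haar functional (`ReflAlg.haar`).

The remaining step is `ReflAlg.IsCornerFixed.exists_mem_ncSpan_of_lastSwap`. A vector fixed by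
`H_{N-1}^{s+}` agrees, on the words without the last letter, with a combination of noncrossing
partitions, and may be assumed to vanish there. By the transposition it vanishes on the words
without the last but one letter. For each choice of the positions of the last letter, it is a
combination of noncrossing partitions on the other positions, colored by `N - 1` letters, and
vanishes when the last but one letter is absent. At least `N - 2 ≥ 4` letters remain, over which
noncrossing partitions are linearly independent (`eq_zero_of_vanish`), so it is zero.

The independence over four letters is proved by a twirl with the Pauli matrices, which maps a
function on words to a function of `2 × 2` matrices: a singleton becomes a trace, and a pair of
adjacent points in a block becomes a product of matrices. On matrix units this is triangular.
-/

noncomputable section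

/-! ### Noncrossing partitions -/

/-- The role of a point in its block of a noncrossing partition: the first, an inner or the last
point of a block with several points, or the only point of its block. The list of the roles of the
points determines a noncrossing partition. -/
inductive Role : Type
  | closer | middle | singleton | opener

namespace Role

/-- The position of a role in the order `closer < middle < singleton < opener`. -/
def rank : Role → ℕ
  | closer => 0
  | middle => 1
  | singleton => 2
  | opener => 3

theorem rank_injective : Function.Injective rank := by
  intro a b h
  cases a <;> cases b <;> first | rfl | simp [rank] at h

instance : LinearOrder Role := LinearOrder.lift' rank rank_injective

theorem lt_iff {a b : Role} : a < b ↔ a.rank < b.rank := Iff.rfl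

theorem le_iff {a b : Role} : a ≤ b ↔ a.rank ≤ b.rank := Iff.rfl

/-- The role of the first of two adjacent points of a block which replace a point with role
`r`. -/
def left : Role → Role
  | closer => middle
  | middle => middle
  | singleton => opener
  | opener => opener

/-- The role of the second of two adjacent points of a block which replace a point with role
`r`. -/
def right : Role → Role
  | closer => closer
  | middle => middle
  | singleton => closer
  | opener => middle

end Role

/-- `partVec c st I` is `1` if the coloring `I` of the points is constant on the blocks of the
noncrossing partition with roles `c`, and `0` otherwise. The stack `st` holds the colors of the
blocks which are open at the start, the innermost one first. Ill-formed lists of roles, and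
colorings of the wrong length, give `0`. -/
def partVec {α : Type} [DecidableEq α] : List Role → List α → List α → ℂ
  | [], [], [] => 1
  | Role.opener :: c, st, x :: I => partVec c (x :: st) I
  | Role.singleton :: c, st, _ :: I => partVec c st I
  | Role.middle :: c, y :: st, x :: I => if x = y then partVec c (y :: st) I else 0
  | Role.closer :: c, y :: st, x :: I => if x = y then partVec c st I else 0
  | _, _, _ => 0

section partVec

variable {α β : Type} [DecidableEq α] [DecidableEq β]

theorem partVec_eq_zero_of_length_ne (c : List Role) (st I : List α) (h : I.length ≠ c.length) :
    partVec c st I = 0 := by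
  induction c generalizing st I with
  | nil => cases I <;> cases st <;> simp_all [partVec]
  | cons r c ih =>
    cases I with
    | nil => cases r <;> cases st <;> simp [partVec]
    | cons x I =>
      have h' : I.length ≠ c.length := by simpa using h
      cases r <;> cases st <;> simp [partVec, ih _ _ h']

theorem partVec_map (g : α → β) (hg : Function.Injective g) (c : List Role) (st I : List α) :
    partVec c (st.map g) (I.map g) = partVec c st I := by
  induction c generalizing st I with
  | nil => cases I <;> cases st <;> simp [partVec]
  | cons r c ih =>
    cases I with
    | nil => cases r <;> cases st <;> simp [partVec]
    | cons x I =>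
      cases r <;> cases st <;> simp [partVec, hg.eq_iff, ← ih]

theorem partVec_singleton (c₁ c₂ : List Role) (st I₁ : List α) (x : α) (I₂ : List α)
    (h : I₁.length = c₁.length) :
    partVec (c₁ ++ Role.singleton :: c₂) st (I₁ ++ x :: I₂) =
      partVec (c₁ ++ c₂) st (I₁ ++ I₂) := by
  induction c₁ generalizing st I₁ with
  | nil =>
    obtain rfl : I₁ = [] := by simpa using h
    cases st <;> simp [partVec]
  | cons r c ih =>
    cases I₁ with
    | nil => simp at h
    | cons y I =>
      have h' : I.length = c.length := by simpa using h
      cases r <;> cases st <;> simp [partVec, ih _ _ h']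

theorem partVec_split (c₁ c₂ : List Role) (r : Role) (st I₁ : List α) (x y : α) (I₂ : List α)
    (h : I₁.length = c₁.length) :
    partVec (c₁ ++ r.left :: r.right :: c₂) st (I₁ ++ x :: y :: I₂) =
      if x = y then partVec (c₁ ++ r :: c₂) st (I₁ ++ x :: I₂) else 0 := by
  induction c₁ generalizing st I₁ with
  | nil =>
    obtain rfl : I₁ = [] := by simpa using h
    by_cases hxy : x = y
    · subst hxy
      cases r <;> cases st <;> simp [partVec, Role.left, Role.right] <;> grind
    · cases r <;> cases st <;> simp [partVec, Role.left, Role.right, hxy, Ne.symm hxy] <;> grind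
  | cons r c ih =>
    cases I₁ with
    | nil => simp at h
    | cons y I =>
      have h' : I.length = c.length := by simpa using h
      cases r <;> cases st <;> simp [partVec, ih _ _ h'] <;> grind

end partVec

/-- `IsNC w c`: the roles `c` describe a noncrossing partition of the points, which carry the
weights `w`, such that the weights in each block sum to zero. Each of these partitions arises by
inserting singletons of weight zero and doubling points. -/
inductive IsNC {Γ : Type} [AddGroup Γ] : List Γ → List Role → Prop
  | nil : IsNC [] []
  | insert {w₁ w₂ : List Γ} {c₁ c₂ : List Role} (hl : c₁.length = w₁.length)
      (h : IsNC (w₁ ++ w₂) (c₁ ++ c₂)) : IsNC (w₁ ++ 0 :: w₂) (c₁ ++ Role.singleton :: c₂)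
  | split {w₁ w₂ : List Γ} {c₁ c₂ : List Role} {a b : Γ} {r : Role}
      (hl : c₁.length = w₁.length) (h : IsNC (w₁ ++ (a + b) :: w₂) (c₁ ++ r :: c₂)) :
      IsNC (w₁ ++ a :: b :: w₂) (c₁ ++ r.left :: r.right :: c₂)

theorem IsNC.length_eq {Γ : Type} [AddGroup Γ] {w : List Γ} {c : List Role} (h : IsNC w c) :
    c.length = w.length := by
  induction h with
  | nil => rfl
  | insert hl h ih => simp at ih ⊢; omega
  | split hl h ih => simp at ih ⊢; omega

/-! ### Linear independence over four colors -/

/-- The Pauli matrices, up to scalar factors. -/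
def pauli : Fin 4 → Matrix (Fin 2) (Fin 2) ℂ :=
  ![!![1, 0; 0, 1], !![1, 0; 0, -1], !![0, 1; 1, 0], !![0, 1; -1, 0]]

theorem pauli_transpose_mul_self (i : Fin 4) : (pauli i)ᵀ * pauli i = 1 := by
  fin_cases i <;> ext a b <;> fin_cases a <;> fin_cases b <;> simp [pauli, Matrix.mul_apply]

/-- The mean over the Pauli matrices, up to normalization, is the projection onto the scalar
matrices. -/
theorem pauli_twirl (X : Matrix (Fin 2) (Fin 2) ℂ) :
    ∑ i, pauli i * X * (pauli i)ᵀ = (2 * X.trace) • 1 := by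
  obtain ⟨a, b, c, d, rfl⟩ : ∃ a b c d, X = !![a, b; c, d] := ⟨_, _, _, _, Matrix.eta_fin_two X⟩
  have ht : ∀ a b c d : ℂ, !![a, b; c, d]ᵀ = !![a, c; b, d] := by
    intro a b c d
    ext i j
    fin_cases i <;> fin_cases j <;> rfl
  ext i j
  fin_cases i <;> fin_cases j <;>
    simp [pauli, Fin.sum_univ_four, ht, Matrix.trace] <;> ring

/-- The matrix `∑ f(i₁, …, i_k) (σ X₁ σᵀ) ⋯ (σ X_k σᵀ)`, where the `l`-th factor is conjugated by
the Pauli matrix `σ` of index `i_l`. -/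
def pauliTransform : (List (Fin 4) → ℂ) → List (Matrix (Fin 2) (Fin 2) ℂ) →
    Matrix (Fin 2) (Fin 2) ℂ
  | f, [] => f [] • 1
  | f, X :: Xs => ∑ i, (pauli i * X * (pauli i)ᵀ) * pauliTransform (fun I => f (i :: I)) Xs

theorem pauliTransform_congr {f g : List (Fin 4) → ℂ} {Xs : List (Matrix (Fin 2) (Fin 2) ℂ)}
    (h : ∀ I, I.length = Xs.length → f I = g I) : pauliTransform f Xs = pauliTransform g Xs := by
  induction Xs generalizing f g with
  | nil => simp [pauliTransform, h []]
  | cons X Xs ih =>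
    simp only [pauliTransform]
    exact Finset.sum_congr rfl fun i _ => by rw [ih fun I hI => h (i :: I) (by simp [hI])]

theorem pauliTransform_zero (Xs : List (Matrix (Fin 2) (Fin 2) ℂ)) :
    pauliTransform (fun _ => 0) Xs = 0 := by
  induction Xs with
  | nil => simp [pauliTransform]
  | cons X Xs ih => simp [pauliTransform, ih]

theorem pauliTransform_sum {ι : Type} (s : Finset ι) (a : ι → ℂ) (f : ι → List (Fin 4) → ℂ)
    (Xs : List (Matrix (Fin 2) (Fin 2) ℂ)) :
    pauliTransform (fun I => ∑ j ∈ s, a j * f j I) Xs =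
      ∑ j ∈ s, a j • pauliTransform (f j) Xs := by
  induction Xs generalizing f with
  | nil => simp [pauliTransform, Finset.sum_smul, mul_smul]
  | cons X Xs ih =>
    simp only [pauliTransform, ih, Finset.mul_sum, Finset.smul_sum, mul_smul_comm]
    exact Finset.sum_comm

theorem pauliTransform_insert {f g : List (Fin 4) → ℂ}
    (Xs Ys : List (Matrix (Fin 2) (Fin 2) ℂ)) (X : Matrix (Fin 2) (Fin 2) ℂ)
    (h : ∀ I₁ x I₂, I₁.length = Xs.length → f (I₁ ++ x :: I₂) = g (I₁ ++ I₂)) :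
    pauliTransform f (Xs ++ X :: Ys) = (2 * X.trace) • pauliTransform g (Xs ++ Ys) := by
  induction Xs generalizing f g with
  | nil =>
    have h' : ∀ i, (fun I => f (i :: I)) = g := fun i => funext fun I => h [] i I rfl
    simp only [List.nil_append, pauliTransform, h']
    rw [← Finset.sum_mul, pauli_twirl, smul_mul_assoc, one_mul]
  | cons Z Xs ih =>
    simp only [List.cons_append, pauliTransform, Finset.smul_sum]
    refine Finset.sum_congr rfl fun i _ => ?_
    rw [ih (g := fun I => g (i :: I)) fun I₁ x I₂ hI => h (i :: I₁) x I₂ (by simp [hI]),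
      mul_smul_comm]

/-- For equal colors of two adjacent points, the Pauli matrices between the two factors cancel. -/
theorem pauliTransform_split {f g : List (Fin 4) → ℂ}
    (Xs Ys : List (Matrix (Fin 2) (Fin 2) ℂ)) (X Y : Matrix (Fin 2) (Fin 2) ℂ)
    (h : ∀ I₁ x y I₂, I₁.length = Xs.length →
      f (I₁ ++ x :: y :: I₂) = if x = y then g (I₁ ++ x :: I₂) else 0) :
    pauliTransform f (Xs ++ X :: Y :: Ys) = pauliTransform g (Xs ++ (X * Y) :: Ys) := by
  induction Xs generalizing f g with
  | nil =>
    simp only [List.nil_append, pauliTransform]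
    refine Finset.sum_congr rfl fun i _ => ?_
    have h' : ∀ j, (fun I => f (i :: j :: I)) = if i = j then (fun I => g (i :: I)) else
        fun _ => 0 := by
      intro j
      funext I
      rw [show f (i :: j :: I) = _ from h [] i j I rfl]
      split_ifs <;> rfl
    rw [Finset.sum_eq_single i, h' i, if_pos rfl, ← mul_assoc]
    · congr 1
      calc _ = pauli i * X * ((pauli i)ᵀ * pauli i) * Y * (pauli i)ᵀ := by noncomm_ring
        _ = _ := by rw [pauli_transpose_mul_self]; noncomm_ring
    · intro j _ hj
      rw [h' j, if_neg hj.symm, pauliTransform_zero, mul_zero]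
    · simp
  | cons Z Xs ih =>
    simp only [List.cons_append, pauliTransform]
    refine Finset.sum_congr rfl fun i _ => ?_
    rw [ih (g := fun I => g (i :: I)) fun I₁ x y I₂ hI => h (i :: I₁) x y I₂ (by simp [hI])]

/-- The matrix unit attached to a role. -/
def Role.unit : Role → Matrix (Fin 2) (Fin 2) ℂ
  | closer => !![0, 1; 0, 0]
  | middle => !![1, 0; 0, 0]
  | singleton => !![0, 0; 0, 1]
  | opener => !![0, 0; 1, 0]

theorem Role.unit_left_mul_unit_right (r : Role) : r.left.unit * r.right.unit = r.unit := by
  cases r <;> ext i j <;> fin_cases i <;> fin_cases j <;>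
    simp [Role.left, Role.right, Role.unit]

theorem Role.le_singleton_of_trace_ne_zero {r : Role} (h : r.unit.trace ≠ 0) :
    r ≤ Role.singleton := by
  cases r <;> simp [Role.unit, Role.le_iff, Role.rank] at h ⊢

/-- The product of two matrix units is zero or the matrix unit of a role `y`. In the second case
the two roles precede, lexicographically, those of the points which replace a point with role `y`
or agree with them. -/
theorem Role.unit_mul_unit (p q : Role) : p.unit * q.unit = 0 ∨ ∃ y : Role,
    p.unit * q.unit = y.unit ∧ (p < y.left ∨ p = y.left ∧ q ≤ y.right) := by
  have h0 : ∀ M : Matrix (Fin 2) (Fin 2) ℂ, M 0 0 = 0 → M 0 1 = 0 → M 1 0 = 0 → M 1 1 = 0 →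
      M = 0 := by
    intro M h1 h2 h3 h4
    ext i j
    fin_cases i <;> fin_cases j <;> assumption
  have h1 : ∀ M M' : Matrix (Fin 2) (Fin 2) ℂ, M 0 0 = M' 0 0 → M 0 1 = M' 0 1 →
      M 1 0 = M' 1 0 → M 1 1 = M' 1 1 → M = M' := by
    intro M M' h1 h2 h3 h4
    ext i j
    fin_cases i <;> fin_cases j <;> assumption
  cases p <;> cases q
  all_goals
    first
    | (left; apply h0 <;> simp [Role.unit]; done)
    | (refine Or.inr ⟨Role.closer, ?_, ?_⟩
       · apply h1 <;> simp [Role.unit]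
       · simp [Role.left, Role.right, Role.le_iff, Role.lt_iff, Role.rank])
    | (refine Or.inr ⟨Role.middle, ?_, ?_⟩
       · apply h1 <;> simp [Role.unit]
       · simp [Role.left, Role.right, Role.le_iff, Role.lt_iff, Role.rank])
    | (refine Or.inr ⟨Role.singleton, ?_, ?_⟩
       · apply h1 <;> simp [Role.unit]
       · simp [Role.left, Role.right, Role.le_iff, Role.lt_iff, Role.rank])
    | (refine Or.inr ⟨Role.opener, ?_, ?_⟩
       · apply h1 <;> simp [Role.unit]
       · simp [Role.left, Role.right, Role.le_iff, Role.lt_iff, Role.rank])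

theorem Role.left_right_strictMono {y z : Role} (h : y < z) :
    y.left < z.left ∨ y.left = z.left ∧ y.right < z.right := by
  cases y <;> cases z <;> simp [Role.left, Role.right, Role.lt_iff, Role.rank] at h ⊢

theorem cons_le_cons_iff {α : Type} [LinearOrder α] {a b : α} {l l' : List α} :
    a :: l ≤ b :: l' ↔ a < b ∨ a = b ∧ l ≤ l' := by
  rw [le_iff_lt_or_eq, List.cons_lt_cons_iff, List.cons.injEq, le_iff_lt_or_eq (a := l)]
  tauto

theorem append_cons_le_insert {t₁ c₁ t₂ c₂ : List Role} {y : Role} (hl : t₁.length = c₁.length)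
    (h : t₁ ++ t₂ ≤ c₁ ++ c₂) (hy : y ≤ Role.singleton) :
    t₁ ++ y :: t₂ ≤ c₁ ++ Role.singleton :: c₂ := by
  induction t₁ generalizing c₁ with
  | nil =>
    obtain rfl : c₁ = [] := by simpa using hl.symm
    simp only [List.nil_append, cons_le_cons_iff] at h ⊢
    exact hy.lt_or_eq.imp_right fun h' => ⟨h', h⟩
  | cons a t ih =>
    cases c₁ with
    | nil => simp at hl
    | cons b c =>
      simp only [List.cons_append, cons_le_cons_iff] at h ⊢
      exact h.imp_right fun h' => ⟨h'.1, ih (by simpa using hl) h'.2⟩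

theorem append_cons_le_split {t₁ c₁ t₂ c₂ : List Role} {p q y z : Role}
    (hl : t₁.length = c₁.length) (h : t₁ ++ y :: t₂ ≤ c₁ ++ z :: c₂)
    (hp : p < y.left ∨ p = y.left ∧ q ≤ y.right) :
    t₁ ++ p :: q :: t₂ ≤ c₁ ++ z.left :: z.right :: c₂ := by
  induction t₁ generalizing c₁ with
  | nil =>
    obtain rfl : c₁ = [] := by simpa using hl.symm
    simp only [List.nil_append, cons_le_cons_iff] at h ⊢
    rcases h with h | ⟨rfl, h⟩
    · have := Role.left_right_strictMono h
      grind
    · grind [le_iff_lt_or_eq]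
  | cons a t ih =>
    cases c₁ with
    | nil => simp at hl
    | cons b c =>
      simp only [List.cons_append, cons_le_cons_iff] at h ⊢
      exact h.imp_right fun h' => ⟨h'.1, ih (by simpa using hl) h'.2⟩

theorem pauliTransform_partVec_insert (c₁ c₂ : List Role)
    (Xs Ys : List (Matrix (Fin 2) (Fin 2) ℂ)) (X : Matrix (Fin 2) (Fin 2) ℂ)
    (h : Xs.length = c₁.length) :
    pauliTransform (partVec (c₁ ++ Role.singleton :: c₂) []) (Xs ++ X :: Ys) =
      (2 * X.trace) • pauliTransform (partVec (c₁ ++ c₂) []) (Xs ++ Ys) :=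
  pauliTransform_insert _ _ _ fun _ _ _ hI => partVec_singleton _ _ _ _ _ _ (hI.trans h)

theorem pauliTransform_partVec_split (c₁ c₂ : List Role) (r : Role)
    (Xs Ys : List (Matrix (Fin 2) (Fin 2) ℂ)) (X Y : Matrix (Fin 2) (Fin 2) ℂ)
    (h : Xs.length = c₁.length) :
    pauliTransform (partVec (c₁ ++ r.left :: r.right :: c₂) []) (Xs ++ X :: Y :: Ys) =
      pauliTransform (partVec (c₁ ++ r :: c₂) []) (Xs ++ (X * Y) :: Ys) :=
  pauliTransform_split _ _ _ _ fun _ _ _ _ hI => partVec_split _ _ _ _ _ _ _ _ (hI.trans h)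

theorem exists_append_cons_of_length {α : Type} {t : List α} {k m : ℕ}
    (h : t.length = k + (m + 1)) :
    ∃ t₁ y t₂, t = t₁ ++ y :: t₂ ∧ t₁.length = k ∧ t₂.length = m := by
  have hk : k < t.length := by omega
  refine ⟨t.take k, t[k], t.drop (k + 1), ?_, by simp; omega, by simp; omega⟩
  rw [List.getElem_cons_drop, List.take_append_drop]

theorem IsNC.pauliTransform_self_ne_zero {Γ : Type} [AddGroup Γ] {w : List Γ} {c : List Role}
    (h : IsNC w c) : pauliTransform (partVec c []) (c.map Role.unit) ≠ 0 := by
  induction h with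
  | nil => simp [pauliTransform, partVec]
  | insert hl h ih =>
    rw [List.map_append, List.map_cons, pauliTransform_partVec_insert _ _ _ _ _ (by simp),
      ← List.map_append]
    exact smul_ne_zero (by simp [Role.unit]) ih
  | split hl h ih =>
    rw [List.map_append, List.map_cons, List.map_cons,
      pauliTransform_partVec_split _ _ _ _ _ _ _ (by simp), Role.unit_left_mul_unit_right,
      ← List.map_cons, ← List.map_append]
    exact ih

/-- The evaluations of the vectors of noncrossing partitions at products of matrix units form a
triangular matrix with respect to the lexicographic order of the lists of roles. -/
theorem IsNC.le_of_pauliTransform_ne_zero {Γ : Type} [AddGroup Γ] {w : List Γ} {c : List Role}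
    (h : IsNC w c) (t : List Role) (ht : t.length = c.length)
    (hne : pauliTransform (partVec c []) (t.map Role.unit) ≠ 0) : t ≤ c := by
  induction h generalizing t with
  | nil => simp_all
  | @insert w₁ w₂ c₁ c₂ hl h ih =>
    obtain ⟨t₁, y, t₂, rfl, h1, h2⟩ := exists_append_cons_of_length (k := c₁.length)
      (m := c₂.length) (by rw [ht]; simp)
    rw [List.map_append, List.map_cons, pauliTransform_partVec_insert _ _ _ _ _ (by simpa),
      ← List.map_append] at hne
    refine append_cons_le_insert h1 (ih _ (by simp [h1, h2]) (right_ne_zero_of_smul hne)) ?_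
    exact Role.le_singleton_of_trace_ne_zero (right_ne_zero_of_mul (left_ne_zero_of_smul hne))
  | @split w₁ w₂ c₁ c₂ a b r hl h ih =>
    obtain ⟨t₁, p, t', rfl, h1, h2⟩ := exists_append_cons_of_length (k := c₁.length)
      (m := c₂.length + 1) (by rw [ht]; simp)
    obtain ⟨q, t₂, rfl⟩ : ∃ q t₂, t' = q :: t₂ := by
      cases t' with
      | nil => simp at h2
      | cons q t₂ => exact ⟨q, t₂, rfl⟩
    have h3 : t₂.length = c₂.length := by simpa using h2
    rw [List.map_append, List.map_cons, List.map_cons,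
      pauliTransform_partVec_split _ _ _ _ _ _ _ (by simpa)] at hne
    rcases Role.unit_mul_unit p q with h0 | ⟨y, hy, hpq⟩
    · exfalso
      apply hne
      rw [h0]
      have key : ∀ (f : List (Fin 4) → ℂ) (Xs Ys : List (Matrix (Fin 2) (Fin 2) ℂ)),
          pauliTransform f (Xs ++ 0 :: Ys) = 0 := by
        intro f Xs Ys
        induction Xs generalizing f with
        | nil => simp [pauliTransform]
        | cons X Xs ih => simp [pauliTransform, ih]
      exact key _ _ _
    · rw [hy, ← List.map_cons, ← List.map_append] at hne
      exact append_cons_le_split h1 (ih _ (by simp [h1, h3]) hne) hpq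

/-- The span of the vectors of the noncrossing partitions whose blocks have weight zero, as
functions on the colorings of the points by the elements of `α`. -/
def ncSpan {Γ : Type} [AddGroup Γ] (α : Type) [DecidableEq α] (w : List Γ) :
    Submodule ℂ (List α → ℂ) :=
  Submodule.span ℂ ((fun c => partVec c []) '' {c | IsNC w c})

/-- The vectors of noncrossing partitions are linearly independent over four colors. Hence an
element of `ncSpan` which vanishes on the colorings by four of the colors is zero. -/
theorem eq_zero_of_vanish {Γ : Type} [AddGroup Γ] {α : Type} [DecidableEq α] {w : List Γ}
    {f : List α → ℂ} (hf : f ∈ ncSpan α w) (g : Fin 4 → α) (hg : Function.Injective g)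
    (h : ∀ I : List (Fin 4), f (I.map g) = 0) : f = 0 := by
  obtain ⟨s, hs, a, rfl⟩ := (Submodule.mem_span_image_iff_exists_fun ℂ).mp hf
  suffices ha : ∀ c, a c = 0 by simp [ha]
  by_contra! hne
  obtain ⟨c₀, hc₀⟩ := hne
  have hne : (s.attach.filter fun c => a c ≠ 0).Nonempty := ⟨c₀, by simp [hc₀]⟩
  -- At the matrix units of the largest partition with nonzero coefficient, only that partition
  -- contributes to the transform.
  obtain ⟨m, hm, hmax⟩ := Finset.exists_max_image _ (fun c => c.1) hne
  have hmNC : IsNC w m.1 := hs m.2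
  have h0 : pauliTransform (fun I => ∑ c ∈ s.attach, a c * partVec c.1 [] I) (m.1.map Role.unit)
      = 0 := by
    rw [← pauliTransform_zero (m.1.map Role.unit)]
    refine pauliTransform_congr fun I _ => ?_
    have := h I
    rw [Finset.sum_apply] at this
    rw [← this, Finset.univ_eq_attach]
    refine Finset.sum_congr rfl fun c _ => ?_
    rw [Pi.smul_apply, smul_eq_mul, ← partVec_map g hg, List.map_nil]
  rw [pauliTransform_sum, Finset.sum_eq_single m] at h0
  · exact smul_ne_zero (Finset.mem_filter.mp hm).2 hmNC.pauliTransform_self_ne_zero h0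
  · intro c _ hcm
    by_cases hac : a c = 0
    · simp [hac]
    by_contra hc
    have hcNC : IsNC w c.1 := hs c.2
    have h1 := hcNC.le_of_pauliTransform_ne_zero m.1
      (hmNC.length_eq.trans hcNC.length_eq.symm) (right_ne_zero_of_smul hc)
    have h2 := hmax c (by simp [hac])
    exact hcm (Subtype.ext (le_antisymm h2 h1))
  · simp

/-! ### Merging and removing points -/

/-- The possible relative positions of two marked elements of a list. -/
theorem append_cons_eq_append_cons {α : Type} {v₁ v₂ w₁ w₂ : List α} {z a : α}
    (h : w₁ ++ a :: w₂ = v₁ ++ z :: v₂) :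
    (v₁ = w₁ ∧ z = a ∧ v₂ = w₂) ∨ (∃ m, v₁ = w₁ ++ a :: m ∧ w₂ = m ++ z :: v₂) ∨
      ∃ m, w₁ = v₁ ++ z :: m ∧ v₂ = m ++ a :: w₂ := by
  rcases List.append_eq_append_iff.mp h with ⟨m, h1, h2⟩ | ⟨m, h1, h2⟩
  · cases m with
    | nil => simp_all
    | cons b m => simp_all
  · cases m with
    | nil => simp_all
    | cons b m => simp_all

section

variable {Γ : Type} [AddGroup Γ] {α : Type} [DecidableEq α]

theorem IsNC.insert' {w₁ w₂ : List Γ} {c : List Role} (h : IsNC (w₁ ++ w₂) c) :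
    ∃ c', IsNC (w₁ ++ 0 :: w₂) c' ∧ ∀ (I₁ : List α) (x : α) (I₂ : List α),
      I₁.length = w₁.length → partVec c' [] (I₁ ++ x :: I₂) = partVec c [] (I₁ ++ I₂) := by
  have hl := h.length_eq
  obtain ⟨c₁, c₂, rfl, h1⟩ : ∃ c₁ c₂, c = c₁ ++ c₂ ∧ c₁.length = w₁.length :=
    ⟨c.take w₁.length, c.drop w₁.length, by simp, by simp at hl ⊢; omega⟩
  exact ⟨_, .insert h1 h, fun I₁ x I₂ hI => partVec_singleton _ _ _ _ _ _ (hI.trans h1.symm)⟩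

theorem IsNC.split' {w₁ w₂ : List Γ} {a b : Γ} {c : List Role}
    (h : IsNC (w₁ ++ (a + b) :: w₂) c) :
    ∃ c', IsNC (w₁ ++ a :: b :: w₂) c' ∧ ∀ (I₁ : List α) (x y : α) (I₂ : List α),
      I₁.length = w₁.length → partVec c' [] (I₁ ++ x :: y :: I₂) =
        if x = y then partVec c [] (I₁ ++ x :: I₂) else 0 := by
  have hl := h.length_eq
  obtain ⟨c₁, r, c₂, rfl, h1, h2⟩ := exists_append_cons_of_length (t := c) (k := w₁.length)
    (m := w₂.length) (by rw [hl]; simp)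
  exact ⟨_, .split h1 h, fun I₁ x y I₂ hI => partVec_split _ _ _ _ _ _ _ _ (hI.trans h1.symm)⟩

/-- Merging two adjacent points of a noncrossing partition gives a noncrossing partition. The proof
is by induction on the construction of the partition: the two points contain the point inserted
last, overlap the pair of points doubled last, or are disjoint from them. -/
theorem IsNC.merge {W : List Γ} {c : List Role} (h : IsNC W c) :
    ∀ w₁ a b w₂, W = w₁ ++ a :: b :: w₂ → ∃ c', IsNC (w₁ ++ (a + b) :: w₂) c' ∧
      ∀ (I₁ : List α) (x : α) (I₂ : List α), I₁.length = w₁.length → I₂.length = w₂.length →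
        partVec c' [] (I₁ ++ x :: I₂) = partVec c [] (I₁ ++ x :: x :: I₂) := by
  induction h with
  | nil => intro w₁ a b w₂ hW; simp at hW
  | @insert v₁ v₂ d₁ d₂ hl h ih =>
    intro w₁ a b w₂ hW
    rcases append_cons_eq_append_cons hW.symm with ⟨rfl, rfl, rfl⟩ | ⟨m, rfl, h2⟩ | ⟨m, rfl, rfl⟩
    · refine ⟨_, by rw [zero_add]; exact h, fun I₁ x I₂ h1 h2 => ?_⟩
      rw [partVec_singleton _ _ _ _ _ _ (h1.trans hl.symm)]
    · cases m with
      | nil =>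
        obtain ⟨rfl, rfl⟩ : b = 0 ∧ w₂ = v₂ := by simpa using h2
        refine ⟨_, by rw [add_zero]; simpa using h, fun I₁ x I₂ h1 h2 => ?_⟩
        have := partVec_singleton d₁ d₂ [] (I₁ ++ [x]) x I₂ (by rw [hl]; simp [h1])
        simpa using this.symm
      | cons b' m =>
        obtain ⟨rfl, rfl⟩ : b = b' ∧ w₂ = m ++ 0 :: v₂ := by simpa using h2
        obtain ⟨c', hc', hf⟩ := ih w₁ a b (m ++ v₂) (by simp)
        obtain ⟨c'', hc'', hf'⟩ := IsNC.insert' (α := α) (w₁ := w₁ ++ (a + b) :: m) (w₂ := v₂)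
          (c := c') (by simpa using hc')
        refine ⟨c'', by simpa using hc'', fun I₁ x I₂ h1 h2 => ?_⟩
        obtain ⟨J₁, y, J₂, rfl, h3, h4⟩ := exists_append_cons_of_length (k := m.length)
          (m := v₂.length) (by rw [h2]; simp)
        have e1 := hf' (I₁ ++ x :: J₁) y J₂ (by simp [h1, h3])
        have e2 := hf I₁ x (J₁ ++ J₂) h1 (by simp [h3, h4])
        have e3 := partVec_singleton d₁ d₂ [] (I₁ ++ x :: x :: J₁) y J₂
          (by rw [hl]; simp [h1, h3])
        simp only [List.append_assoc, List.cons_append] at e1 e2 e3 ⊢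
        rw [e1, e2, e3]
    · obtain ⟨c', hc', hf⟩ := ih (v₁ ++ m) a b w₂ (by simp)
      obtain ⟨c'', hc'', hf'⟩ := IsNC.insert' (α := α) (w₁ := v₁) (w₂ := m ++ (a + b) :: w₂)
        (c := c') (by simpa using hc')
      refine ⟨c'', by simpa using hc'', fun I₁ x I₂ h1 h2 => ?_⟩
      obtain ⟨J₁, y, J₂, rfl, h3, h4⟩ := exists_append_cons_of_length (k := v₁.length)
          (m := m.length) (by rw [h1]; simp)
      have e1 := hf' J₁ y (J₂ ++ x :: I₂) h3
      have e2 := hf (J₁ ++ J₂) x I₂ (by simp [h3, h4]) h2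
      have e3 := partVec_singleton d₁ d₂ [] J₁ y (J₂ ++ x :: x :: I₂) (by rw [hl, h3])
      simp only [List.append_assoc, List.cons_append] at e1 e2 e3 ⊢
      rw [e1, e2, e3]
  | @split v₁ v₂ d₁ d₂ p q r hl h ih =>
    intro w₁ a b w₂ hW
    rcases append_cons_eq_append_cons hW.symm with ⟨rfl, rfl, h2⟩ | ⟨m, rfl, h2⟩ | ⟨m, rfl, h2⟩
    · obtain ⟨rfl, rfl⟩ : q = b ∧ v₂ = w₂ := by simpa using h2
      refine ⟨_, h, fun I₁ x I₂ h1 h2 => ?_⟩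
      rw [partVec_split _ _ _ _ _ _ _ _ (h1.trans hl.symm), if_pos rfl]
    · cases m with
      | nil =>
        obtain ⟨rfl, rfl⟩ : b = p ∧ w₂ = q :: v₂ := by simpa using h2
        obtain ⟨c', hc', hf⟩ := ih w₁ a (b + q) v₂ (by simp)
        obtain ⟨c'', hc'', hf'⟩ := IsNC.split' (α := α) (w₁ := w₁) (w₂ := v₂) (a := a + b)
          (b := q) (c := c') (by simpa [add_assoc] using hc')
        refine ⟨c'', hc'', fun I₁ x I₂ h1 h2 => ?_⟩
        obtain ⟨y, J₂, rfl⟩ : ∃ y J₂, I₂ = y :: J₂ := by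
          cases I₂ with
          | nil => simp at h2
          | cons y J => exact ⟨y, J, rfl⟩
        have h4 : J₂.length = v₂.length := by simpa using h2
        have e3 := partVec_split d₁ d₂ r [] (I₁ ++ [x]) x y J₂ (by rw [hl]; simp [h1])
        simp only [List.append_assoc, List.cons_append, List.nil_append] at e3
        rw [hf' I₁ x y J₂ h1, hf I₁ x J₂ h1 h4, e3]
      | cons b' m =>
        obtain ⟨rfl, rfl⟩ : b = b' ∧ w₂ = m ++ p :: q :: v₂ := by simpa using h2
        obtain ⟨c', hc', hf⟩ := ih w₁ a b (m ++ (p + q) :: v₂) (by simp)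
        obtain ⟨c'', hc'', hf'⟩ := IsNC.split' (α := α) (w₁ := w₁ ++ (a + b) :: m) (w₂ := v₂)
          (c := c') (a := p) (b := q) (by simpa using hc')
        refine ⟨c'', by simpa using hc'', fun I₁ x I₂ h1 h2 => ?_⟩
        obtain ⟨J₁, y, J, rfl, h3, h4⟩ := exists_append_cons_of_length (k := m.length)
          (m := v₂.length + 1) (by rw [h2]; simp)
        obtain ⟨z, J₂, rfl⟩ : ∃ z J₂, J = z :: J₂ := by
          cases J with
          | nil => simp at h4
          | cons y J => exact ⟨y, J, rfl⟩
        have h5 : J₂.length = v₂.length := by simpa using h4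
        have e1 := hf' (I₁ ++ x :: J₁) y z J₂ (by simp [h1, h3])
        have e2 := hf I₁ x (J₁ ++ y :: J₂) h1 (by simp [h3, h5])
        have e3 := partVec_split d₁ d₂ r [] (I₁ ++ x :: x :: J₁) y z J₂
          (by rw [hl]; simp [h1, h3])
        simp only [List.append_assoc, List.cons_append] at e1 e2 e3 ⊢
        rw [e1, e2, e3]
    · cases m with
      | nil =>
        obtain ⟨rfl, rfl⟩ : q = a ∧ v₂ = b :: w₂ := by simpa using h2
        obtain ⟨c', hc', hf⟩ := ih v₁ (p + q) b w₂ (by simp)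
        obtain ⟨c'', hc'', hf'⟩ := IsNC.split' (α := α) (w₁ := v₁) (w₂ := w₂) (a := p)
          (b := q + b) (c := c') (by simpa [add_assoc] using hc')
        refine ⟨c'', by simpa using hc'', fun I₁ x I₂ h1 h2 => ?_⟩
        obtain ⟨J₁, y, J, rfl, h3, h4⟩ := exists_append_cons_of_length (k := v₁.length)
          (m := 0) (by rw [h1]; simp)
        obtain rfl : J = [] := by simpa using h4
        have e1 := hf' J₁ y x I₂ h3
        have e2 := hf J₁ y I₂ h3 h2
        have e3 := partVec_split d₁ d₂ r [] J₁ y x (x :: I₂) (by rw [hl, h3])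
        simp only [List.append_assoc, List.cons_append, List.nil_append] at e1 e2 e3 ⊢
        rw [e1, e2, e3]
        split_ifs with hyx
        · rw [hyx]
        · rfl
      | cons q' m =>
        obtain ⟨rfl, rfl⟩ : q = q' ∧ v₂ = m ++ a :: b :: w₂ := by simpa using h2
        obtain ⟨c', hc', hf⟩ := ih (v₁ ++ (p + q) :: m) a b w₂ (by simp)
        obtain ⟨c'', hc'', hf'⟩ := IsNC.split' (α := α) (w₁ := v₁) (w₂ := m ++ (a + b) :: w₂)
          (c := c') (a := p) (b := q) (by simpa using hc')
        refine ⟨c'', by simpa using hc'', fun I₁ x I₂ h1 h2 => ?_⟩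
        obtain ⟨J₁, y, J, rfl, h3, h4⟩ := exists_append_cons_of_length (k := v₁.length)
          (m := m.length + 1) (by rw [h1]; simp)
        obtain ⟨z, J₂, rfl⟩ : ∃ z J₂, J = z :: J₂ := by
          cases J with
          | nil => simp at h4
          | cons y J => exact ⟨y, J, rfl⟩
        have h5 : J₂.length = m.length := by simpa using h4
        have e1 := hf' J₁ y z (J₂ ++ x :: I₂) h3
        have e2 := hf (J₁ ++ y :: J₂) x I₂ (by simp [h3, h5]) h2
        have e3 := partVec_split d₁ d₂ r [] J₁ y z (J₂ ++ x :: x :: I₂) (by rw [hl, h3])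
        simp only [List.append_assoc, List.cons_append] at e1 e2 e3 ⊢
        rw [e1, e2, e3]

/-- Summation over the color of a point of weight zero gives a multiple of a noncrossing partition.
The point may be a singleton, which gives the factor `Fintype.card α`. If it belongs to a larger
block, that block keeps its weight when the point is removed. -/
theorem IsNC.remove [Fintype α] {W : List Γ} {c : List Role} (h : IsNC W c) :
    ∀ w₁ w₂, W = w₁ ++ 0 :: w₂ → ∃ c', ∃ κ : ℂ, IsNC (w₁ ++ w₂) c' ∧
      ∀ I₁ I₂ : List α, I₁.length = w₁.length → I₂.length = w₂.length →
        ∑ x, partVec c [] (I₁ ++ x :: I₂) = κ * partVec c' [] (I₁ ++ I₂) := by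
  induction h with
  | nil => intro w₁ w₂ hW; simp at hW
  | @insert v₁ v₂ d₁ d₂ hl h ih =>
    intro w₁ w₂ hW
    rcases append_cons_eq_append_cons hW.symm with ⟨rfl, -, rfl⟩ | ⟨m, rfl, rfl⟩ | ⟨m, rfl, rfl⟩
    · refine ⟨_, Fintype.card α, h, fun I₁ I₂ h1 h2 => ?_⟩
      simp [partVec_singleton _ _ _ _ _ _ (h1.trans hl.symm)]
    · obtain ⟨c', κ, hc', hf⟩ := ih w₁ (m ++ v₂) (by simp)
      obtain ⟨c'', hc'', hf'⟩ := IsNC.insert' (α := α) (w₁ := w₁ ++ m) (w₂ := v₂)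
        (c := c') (by simpa using hc')
      refine ⟨c'', κ, by simpa using hc'', fun I₁ I₂ h1 h2 => ?_⟩
      obtain ⟨J₁, y, J₂, rfl, h3, h4⟩ := exists_append_cons_of_length (k := m.length)
        (m := v₂.length) (by rw [h2]; simp)
      have e1 := hf' (I₁ ++ J₁) y J₂ (by simp [h1, h3])
      have e2 := hf I₁ (J₁ ++ J₂) h1 (by simp [h3, h4])
      have e3 := fun x => partVec_singleton d₁ d₂ [] (I₁ ++ x :: J₁) y J₂
        (by rw [hl]; simp [h1, h3])
      simp only [List.append_assoc, List.cons_append] at e1 e2 e3 ⊢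
      simp only [e1, ← e2, e3]
    · obtain ⟨c', κ, hc', hf⟩ := ih (v₁ ++ m) w₂ (by simp)
      obtain ⟨c'', hc'', hf'⟩ := IsNC.insert' (α := α) (w₁ := v₁) (w₂ := m ++ w₂)
        (c := c') (by simpa using hc')
      refine ⟨c'', κ, by simpa using hc'', fun I₁ I₂ h1 h2 => ?_⟩
      obtain ⟨J₁, y, J₂, rfl, h3, h4⟩ := exists_append_cons_of_length (k := v₁.length)
          (m := m.length) (by rw [h1]; simp)
      have e1 := hf' J₁ y (J₂ ++ I₂) h3
      have e2 := hf (J₁ ++ J₂) I₂ (by simp [h3, h4]) h2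
      have e3 := fun x => partVec_singleton d₁ d₂ [] J₁ y (J₂ ++ x :: I₂) (by rw [hl, h3])
      simp only [List.append_assoc, List.cons_append] at e1 e2 e3 ⊢
      simp only [e1, ← e2, e3]
  | @split v₁ v₂ d₁ d₂ p q r hl h ih =>
    intro w₁ w₂ hW
    rcases append_cons_eq_append_cons hW.symm with ⟨rfl, rfl, rfl⟩ | ⟨m, rfl, rfl⟩ | ⟨m, rfl, h2⟩
    · refine ⟨_, 1, by rw [zero_add] at h; exact h, fun I₁ I₂ h1 h2 => ?_⟩
      cases I₂ with
      | nil => simp at h2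
      | cons y I₂ => simp [partVec_split _ _ _ _ _ _ _ _ (h1.trans hl.symm)]
    · obtain ⟨c', κ, hc', hf⟩ := ih w₁ (m ++ (p + q) :: v₂) (by simp)
      obtain ⟨c'', hc'', hf'⟩ := IsNC.split' (α := α) (w₁ := w₁ ++ m) (w₂ := v₂)
        (c := c') (a := p) (b := q) (by simpa using hc')
      refine ⟨c'', κ, by simpa using hc'', fun I₁ I₂ h1 h2 => ?_⟩
      obtain ⟨J₁, y, J, rfl, h3, h4⟩ := exists_append_cons_of_length (k := m.length)
        (m := v₂.length + 1) (by rw [h2]; simp)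
      obtain ⟨z, J₂, rfl⟩ : ∃ z J₂, J = z :: J₂ := by
        cases J with
        | nil => simp at h4
        | cons y J => exact ⟨y, J, rfl⟩
      have h5 : J₂.length = v₂.length := by simpa using h4
      have e1 := hf' (I₁ ++ J₁) y z J₂ (by simp [h1, h3])
      have e2 := hf I₁ (J₁ ++ y :: J₂) h1 (by simp [h3, h5])
      have e3 := fun x => partVec_split d₁ d₂ r [] (I₁ ++ x :: J₁) y z J₂
        (by rw [hl]; simp [h1, h3])
      simp only [List.append_assoc, List.cons_append] at e1 e2 e3 ⊢
      simp only [e1, e3]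
      split_ifs
      · exact e2
      · simp
    · cases m with
      | nil =>
        obtain ⟨rfl, rfl⟩ : q = 0 ∧ v₂ = w₂ := by simpa using h2
        refine ⟨_, 1, by rw [add_zero] at h; simpa using h, fun I₁ I₂ h1 h2 => ?_⟩
        obtain ⟨J₁, y, J, rfl, h3, h4⟩ := exists_append_cons_of_length (k := v₁.length)
          (m := 0) (by rw [h1]; simp)
        obtain rfl : J = [] := by simpa using h4
        simp [partVec_split _ _ _ _ _ _ _ _ (h3.trans hl.symm)]
      | cons q' m =>
        obtain ⟨rfl, rfl⟩ : q = q' ∧ v₂ = m ++ 0 :: w₂ := by simpa using h2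
        obtain ⟨c', κ, hc', hf⟩ := ih (v₁ ++ (p + q) :: m) w₂ (by simp)
        obtain ⟨c'', hc'', hf'⟩ := IsNC.split' (α := α) (w₁ := v₁) (w₂ := m ++ w₂)
          (c := c') (a := p) (b := q) (by simpa using hc')
        refine ⟨c'', κ, by simpa using hc'', fun I₁ I₂ h1 h2 => ?_⟩
        obtain ⟨J₁, y, J, rfl, h3, h4⟩ := exists_append_cons_of_length (k := v₁.length)
          (m := m.length + 1) (by rw [h1]; simp)
        obtain ⟨z, J₂, rfl⟩ : ∃ z J₂, J = z :: J₂ := by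
          cases J with
          | nil => simp at h4
          | cons y J => exact ⟨y, J, rfl⟩
        have h5 : J₂.length = m.length := by simpa using h4
        have e1 := hf' J₁ y z (J₂ ++ I₂) h3
        have e2 := hf (J₁ ++ y :: J₂) I₂ (by simp [h3, h5]) h2
        have e3 := fun x => partVec_split d₁ d₂ r [] J₁ y z (J₂ ++ x :: I₂) (by rw [hl, h3])
        simp only [List.append_assoc, List.cons_append] at e1 e2 e3 ⊢
        simp only [e1, e3]
        split_ifs
        · exact e2
        · simp

end

/-! ### Orthogonal projections as matrices -/

/-- The matrix `P` is the orthogonal projection onto the subspace `K`. -/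
structure IsOrthProj {ι : Type} [Fintype ι] (K : Submodule ℂ (ι → ℂ)) (P : Matrix ι ι ℂ) :
    Prop where
  conjTranspose_eq : Pᴴ = P
  mulVec_mem : ∀ f, P *ᵥ f ∈ K
  mulVec_eq : ∀ f ∈ K, P *ᵥ f = f

section IsOrthProj

variable {ι ι' : Type} [Fintype ι] [DecidableEq ι] [Fintype ι'] [DecidableEq ι']

theorem exists_isOrthProj (K : Submodule ℂ (ι → ℂ)) : ∃ P, IsOrthProj K P := by
  let e : EuclideanSpace ℂ ι ≃ₗ[ℂ] (ι → ℂ) := WithLp.linearEquiv 2 ℂ (ι → ℂ)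
  let K' : Submodule ℂ (EuclideanSpace ℂ ι) := K.comap e.toLinearMap
  let p : EuclideanSpace ℂ ι →ₗ[ℂ] EuclideanSpace ℂ ι := K'.starProjection.toLinearMap
  let P : Matrix ι ι ℂ := LinearMap.toMatrix' (e.toLinearMap ∘ₗ p ∘ₗ e.symm.toLinearMap)
  have hP : ∀ f, P *ᵥ f = e (p (e.symm f)) := by
    intro f
    rw [← Matrix.toLin'_apply, Matrix.toLin'_toMatrix']
    rfl
  refine ⟨P, ?_, ?_, ?_⟩
  · have h : ∀ i j, P i j =
        inner ℂ (EuclideanSpace.single i 1) (p (EuclideanSpace.single j 1)) := by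
      intro i j
      rw [EuclideanSpace.inner_single_left, map_one, one_mul]
      exact LinearMap.toMatrix'_apply _ i j
    ext i j
    rw [Matrix.conjTranspose_apply, h, h]
    change star (inner ℂ _ (K'.starProjection _)) = inner ℂ _ (K'.starProjection _)
    rw [← Submodule.inner_starProjection_left_eq_right]
    exact inner_conj_symm _ _
  · intro f
    rw [hP]
    exact K'.starProjection_apply_mem _
  · intro f hf
    rw [hP]
    have : p (e.symm f) = e.symm f := by
      apply Submodule.starProjection_eq_self_iff.mpr
      change e (e.symm f) ∈ K
      rwa [e.apply_symm_apply]
    rw [this, e.apply_symm_apply]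

/-- An operator which maps `K` to `K'`, and whose adjoint maps `K'` to `K`, intertwines the
orthogonal projections. Here the operator is the composition with a map of the index sets. -/
theorem IsOrthProj.apply_map {K : Submodule ℂ (ι → ℂ)} {K' : Submodule ℂ (ι' → ℂ)}
    {P : Matrix ι ι ℂ} {P' : Matrix ι' ι' ℂ} (hP : IsOrthProj K P) (hP' : IsOrthProj K' P')
    (e : ι' → ι) (h : ∀ f ∈ K, f ∘ e ∈ K')
    (h' : ∀ g ∈ K', (fun u => ∑ v, if e v = u then g v else 0) ∈ K) (v : ι') (u : ι) :
    P (e v) u = ∑ v', if e v' = u then P' v v' else 0 := by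
  let T : Matrix ι' ι ℂ := Matrix.of fun v u => if e v = u then 1 else 0
  have hT : ∀ f, T *ᵥ f = f ∘ e := by
    intro f
    ext v
    simp [T, Matrix.mulVec, dotProduct]
  have hT' : ∀ g, Tᴴ *ᵥ g = fun u => ∑ v, if e v = u then g v else 0 := by
    intro g
    ext u
    simp only [T, Matrix.mulVec, dotProduct, Matrix.conjTranspose_apply, Matrix.of_apply]
    exact Finset.sum_congr rfl fun v _ => by split_ifs <;> simp
  have h1 : P' * (T * P) = T * P := by
    refine Matrix.ext_of_mulVec_single fun j => ?_
    rw [← Matrix.mulVec_mulVec]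
    apply hP'.mulVec_eq
    rw [← Matrix.mulVec_mulVec, hT]
    exact h _ (hP.mulVec_mem _)
  have h2 : P * (Tᴴ * P') = Tᴴ * P' := by
    refine Matrix.ext_of_mulVec_single fun j => ?_
    rw [← Matrix.mulVec_mulVec]
    apply hP.mulVec_eq
    rw [← Matrix.mulVec_mulVec, hT']
    exact h' _ (hP'.mulVec_mem _)
  have h3 : T * P = P' * T := by
    rw [← h1]
    have := congrArg Matrix.conjTranspose h2
    simpa [hP.conjTranspose_eq, hP'.conjTranspose_eq, Matrix.mul_assoc] using this
  have h4 := congrFun (congrFun h3 v) u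
  simp only [Matrix.mul_apply, T, Matrix.of_apply, ite_mul, one_mul, zero_mul, mul_ite, mul_one,
    mul_zero,
    Finset.sum_ite_eq, Finset.mem_univ, if_true] at h4
  exact h4

end IsOrthProj

/-- The colorings of `k` points by the elements of `α`. -/
abbrev Coloring (α : Type) (k : ℕ) : Type := {I : List α // I.length = k}

instance (α : Type) [Fintype α] (k : ℕ) : Fintype (Coloring α k) :=
  inferInstanceAs (Fintype (List.Vector α k))

/-! ### The projections onto the spans of noncrossing partitions -/

/-- The restriction of a function on colorings to those of `k` points. -/
def restrictLength (α : Type) (k : ℕ) : (List α → ℂ) →ₗ[ℂ] (Coloring α k → ℂ) :=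
  LinearMap.funLeft ℂ ℂ Subtype.val

@[simp]
theorem restrictLength_apply {α : Type} (k : ℕ) (f : List α → ℂ) (v : Coloring α k) :
    restrictLength α k f v = f v.1 := rfl

section ncKernel

variable {Γ : Type} [AddGroup Γ] {α : Type} [DecidableEq α]

theorem partVec_mem_ncSpan {w : List Γ} {c : List Role} (h : IsNC w c) :
    partVec c [] ∈ ncSpan α w :=
  Submodule.subset_span ⟨c, h, rfl⟩

theorem ncSpan_merge {w₁ w₂ : List Γ} {a b : Γ} {f : List α → ℂ}
    (hf : f ∈ ncSpan α (w₁ ++ a :: b :: w₂)) :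
    ∃ g ∈ ncSpan α (w₁ ++ (a + b) :: w₂), ∀ (I₁ : List α) (x : α) (I₂ : List α),
      I₁.length = w₁.length → I₂.length = w₂.length →
        g (I₁ ++ x :: I₂) = f (I₁ ++ x :: x :: I₂) := by
  induction hf using Submodule.span_induction with
  | mem f hf =>
    obtain ⟨c, hc, rfl⟩ := hf
    obtain ⟨c', hc', h⟩ := IsNC.merge (α := α) hc w₁ a b w₂ rfl
    exact ⟨_, partVec_mem_ncSpan hc', h⟩
  | zero => exact ⟨0, zero_mem _, by simp⟩
  | add f f' _ _ h h' =>
    obtain ⟨g, hg, h⟩ := h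
    obtain ⟨g', hg', h'⟩ := h'
    exact ⟨g + g', add_mem hg hg', fun I₁ x I₂ h1 h2 => by simp [h I₁ x I₂ h1 h2, h' I₁ x I₂ h1 h2]⟩
  | smul c f _ h =>
    obtain ⟨g, hg, h⟩ := h
    exact ⟨c • g, Submodule.smul_mem _ _ hg, fun I₁ x I₂ h1 h2 => by simp [h I₁ x I₂ h1 h2]⟩

theorem ncSpan_split {w₁ w₂ : List Γ} {a b : Γ} {f : List α → ℂ}
    (hf : f ∈ ncSpan α (w₁ ++ (a + b) :: w₂)) :
    ∃ g ∈ ncSpan α (w₁ ++ a :: b :: w₂), ∀ (I₁ : List α) (x y : α) (I₂ : List α),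
      I₁.length = w₁.length →
        g (I₁ ++ x :: y :: I₂) = if x = y then f (I₁ ++ x :: I₂) else 0 := by
  induction hf using Submodule.span_induction with
  | mem f hf =>
    obtain ⟨c, hc, rfl⟩ := hf
    obtain ⟨c', hc', h⟩ := IsNC.split' (α := α) hc
    exact ⟨_, partVec_mem_ncSpan hc', h⟩
  | zero => exact ⟨0, zero_mem _, by simp⟩
  | add f f' _ _ h h' =>
    obtain ⟨g, hg, h⟩ := h
    obtain ⟨g', hg', h'⟩ := h'
    refine ⟨g + g', add_mem hg hg', fun I₁ x y I₂ h1 => ?_⟩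
    simp only [Pi.add_apply, h I₁ x y I₂ h1, h' I₁ x y I₂ h1]
    split_ifs <;> simp
  | smul c f _ h =>
    obtain ⟨g, hg, h⟩ := h
    exact ⟨c • g, Submodule.smul_mem _ _ hg, fun I₁ x y I₂ h1 => by simp [h I₁ x y I₂ h1]⟩

theorem ncSpan_insert {w₁ w₂ : List Γ} {f : List α → ℂ} (hf : f ∈ ncSpan α (w₁ ++ w₂)) :
    ∃ g ∈ ncSpan α (w₁ ++ 0 :: w₂), ∀ (I₁ : List α) (x : α) (I₂ : List α),
      I₁.length = w₁.length → g (I₁ ++ x :: I₂) = f (I₁ ++ I₂) := by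
  induction hf using Submodule.span_induction with
  | mem f hf =>
    obtain ⟨c, hc, rfl⟩ := hf
    obtain ⟨c', hc', h⟩ := IsNC.insert' (α := α) hc
    exact ⟨_, partVec_mem_ncSpan hc', h⟩
  | zero => exact ⟨0, zero_mem _, by simp⟩
  | add f f' _ _ h h' =>
    obtain ⟨g, hg, h⟩ := h
    obtain ⟨g', hg', h'⟩ := h'
    exact ⟨g + g', add_mem hg hg', fun I₁ x I₂ h1 => by simp [h I₁ x I₂ h1, h' I₁ x I₂ h1]⟩
  | smul c f _ h =>
    obtain ⟨g, hg, h⟩ := h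
    exact ⟨c • g, Submodule.smul_mem _ _ hg, fun I₁ x I₂ h1 => by simp [h I₁ x I₂ h1]⟩

theorem ncSpan_remove [Fintype α] {w₁ w₂ : List Γ} {f : List α → ℂ}
    (hf : f ∈ ncSpan α (w₁ ++ 0 :: w₂)) :
    ∃ g ∈ ncSpan α (w₁ ++ w₂), ∀ I₁ I₂ : List α,
      I₁.length = w₁.length → I₂.length = w₂.length →
        g (I₁ ++ I₂) = ∑ x, f (I₁ ++ x :: I₂) := by
  induction hf using Submodule.span_induction with
  | mem f hf =>
    obtain ⟨c, hc, rfl⟩ := hf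
    obtain ⟨c', κ, hc', h⟩ := IsNC.remove (α := α) hc w₁ w₂ rfl
    exact ⟨κ • partVec c' [], Submodule.smul_mem _ _ (partVec_mem_ncSpan hc'),
      fun I₁ I₂ h1 h2 => (h I₁ I₂ h1 h2).symm⟩
  | zero => exact ⟨0, zero_mem _, by simp⟩
  | add f f' _ _ h h' =>
    obtain ⟨g, hg, h⟩ := h
    obtain ⟨g', hg', h'⟩ := h'
    exact ⟨g + g', add_mem hg hg', fun I₁ I₂ h1 h2 => by
      simp [h I₁ I₂ h1 h2, h' I₁ I₂ h1 h2, Finset.sum_add_distrib]⟩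
  | smul c f _ h =>
    obtain ⟨g, hg, h⟩ := h
    exact ⟨c • g, Submodule.smul_mem _ _ hg, fun I₁ I₂ h1 h2 => by
      simp [h I₁ I₂ h1 h2, Finset.mul_sum]⟩

variable [Fintype α]

/-- The matrix of the orthogonal projection onto `ncSpan α w`. -/
def ncProj (α : Type) [DecidableEq α] [Fintype α] (w : List Γ) :
    Matrix (Coloring α w.length) (Coloring α w.length) ℂ :=
  (exists_isOrthProj ((ncSpan α w).map (restrictLength α w.length))).choose

theorem isOrthProj_ncProj (w : List Γ) :
    IsOrthProj ((ncSpan α w).map (restrictLength α w.length)) (ncProj α w) :=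
  (exists_isOrthProj _).choose_spec

/-- The entries of `ncProj α w`, as a function of two colorings. Colorings of the wrong length give
`0`. -/
def ncKernel (w : List Γ) (I J : List α) : ℂ :=
  if h : I.length = w.length ∧ J.length = w.length then ncProj α w ⟨I, h.1⟩ ⟨J, h.2⟩ else 0

theorem ncKernel_of_length {w : List Γ} {I J : List α} (hI : I.length = w.length)
    (hJ : J.length = w.length) : ncKernel w I J = ncProj α w ⟨I, hI⟩ ⟨J, hJ⟩ :=
  dif_pos ⟨hI, hJ⟩

theorem ncKernel_star (w : List Γ) (I J : List α) : star (ncKernel w I J) = ncKernel w J I := by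
  unfold ncKernel
  by_cases h : I.length = w.length ∧ J.length = w.length
  · rw [dif_pos h, dif_pos h.symm]
    exact congrFun (congrFun (isOrthProj_ncProj (α := α) w).conjTranspose_eq ⟨J, h.2⟩) ⟨I, h.1⟩
  · rw [dif_neg h, dif_neg fun h' => h h'.symm, star_zero]

theorem exists_ncKernel_eq (w : List Γ) (J : List α) :
    ∃ f ∈ ncSpan α w, ∀ I : List α, I.length = w.length → ncKernel w I J = f I := by
  by_cases hJ : J.length = w.length
  · obtain ⟨f, hf, h⟩ := (isOrthProj_ncProj (α := α) w).mulVec_mem (Pi.single ⟨J, hJ⟩ 1)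
    refine ⟨f, hf, fun I hI => ?_⟩
    rw [ncKernel_of_length hI hJ]
    have := congrFun h ⟨I, hI⟩
    rw [Matrix.mulVec_single_one] at this
    exact this.symm
  · exact ⟨0, zero_mem _, fun I _ => dif_neg fun h => hJ h.2⟩

theorem sum_ncKernel_mul {w : List Γ} {f : List α → ℂ} (hf : f ∈ ncSpan α w) {I : List α}
    (hI : I.length = w.length) :
    ∑ J : Coloring α w.length, ncKernel w I J.1 * f J.1 = f I := by
  have h := congrFun ((isOrthProj_ncProj (α := α) w).mulVec_eq _ ⟨f, hf, rfl⟩) ⟨I, hI⟩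
  refine Eq.trans (Finset.sum_congr rfl fun J _ => ?_) h
  rw [ncKernel_of_length hI J.2]
  rfl

theorem mem_of_sum_ncKernel_mul {w : List Γ} {f : List α → ℂ}
    (h : ∀ I : List α, I.length = w.length →
      ∑ J : Coloring α w.length, ncKernel w I J.1 * f J.1 = f I) :
    ∃ g ∈ ncSpan α w, ∀ I : List α, I.length = w.length → g I = f I := by
  obtain ⟨g, hg, h'⟩ := (isOrthProj_ncProj (α := α) w).mulVec_mem (fun J => f J.1)
  refine ⟨g, hg, fun I hI => ?_⟩
  rw [← h I hI]
  refine (congrFun h' ⟨I, hI⟩).trans (Finset.sum_congr rfl fun J _ => ?_)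
  rw [ncKernel_of_length hI J.2]

theorem ncKernel_nil : ncKernel ([] : List Γ) ([] : List α) [] = 1 := by
  have h := sum_ncKernel_mul (partVec_mem_ncSpan (α := α) (IsNC.nil (Γ := Γ))) (I := []) rfl
  rw [Fintype.sum_eq_single (⟨[], rfl⟩ : Coloring α ([] : List Γ).length)] at h
  · simpa [partVec] using h
  · intro J hJ
    exact absurd (Subtype.ext (List.length_eq_zero_iff.mp J.2)) hJ

theorem sum_vector_insert {k l : ℕ} {J₁ J₂ : List α} (h1 : J₁.length = k) (h2 : J₂.length = l)
    {m : ℕ} (hm : m = k + (l + 1)) (g : List α → ℂ) :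
    ∑ v : Coloring α m, (if v.1.take k ++ v.1.drop (k + 1) = J₁ ++ J₂ then g v.1 else 0) =
      ∑ x, g (J₁ ++ x :: J₂) := by
  subst hm h1 h2
  rw [← Finset.sum_filter]
  refine (Finset.sum_bij (fun x _ => ⟨J₁ ++ x :: J₂, by simp⟩) ?_ ?_ ?_ ?_).symm
  · intro x _
    simp
  · intro x _ y _ h
    simpa using congrArg Subtype.val h
  · intro v hv
    obtain ⟨I₁, x, I₂, hv', h3, h4⟩ := exists_append_cons_of_length v.2
    have h5 := (Finset.mem_filter.mp hv).2
    rw [hv', ← h3] at h5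
    have h6 := List.append_inj (by simpa using h5) h3
    exact ⟨x, Finset.mem_univ _, Subtype.ext (by rw [hv', h6.1, h6.2])⟩
  · intro x _
    rfl

theorem sum_vector_merge {k l : ℕ} {J₁ J₂ : List α} {y y' : α} (h1 : J₁.length = k)
    (h2 : J₂.length = l) {m : ℕ} (hm : m = k + (l + 1)) (g : List α → ℂ) :
    ∑ v : Coloring α m,
      (if v.1.take (k + 1) ++ v.1.drop k = J₁ ++ y :: y' :: J₂ then g v.1 else 0) =
      if y = y' then g (J₁ ++ y :: J₂) else 0 := by
  subst hm h1 h2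
  have key : ∀ v : Coloring α (J₁.length + (J₂.length + 1)),
      v.1.take (J₁.length + 1) ++ v.1.drop J₁.length = J₁ ++ y :: y' :: J₂ ↔
        y = y' ∧ v.1 = J₁ ++ y :: J₂ := by
    intro v
    obtain ⟨I₁, x, I₂, hv', h3, h4⟩ := exists_append_cons_of_length v.2
    rw [hv', ← h3]
    have h5 : List.take (I₁.length + 1) (I₁ ++ x :: I₂) = I₁ ++ [x] := by
      simp [List.take_append]
    rw [h5, List.drop_left]
    constructor
    · intro h
      have h6 := List.append_inj (by simpa using h) h3
      simp only [List.cons.injEq] at h6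
      obtain ⟨rfl, rfl, rfl, rfl⟩ := h6
      exact ⟨rfl, rfl⟩
    · rintro ⟨rfl, h⟩
      have h6 := List.append_inj h h3
      simp only [List.cons.injEq] at h6
      obtain ⟨rfl, rfl, rfl⟩ := h6
      simp
  simp only [key]
  split_ifs with hy
  · rw [Fintype.sum_eq_single (⟨J₁ ++ y :: J₂, by simp⟩ : Coloring α _)]
    · simp [hy]
    · intro v hv
      rw [if_neg]
      rintro ⟨-, h⟩
      exact hv (Subtype.ext h)
  · simp [hy]

/-- Doubling a point maps `ncSpan` to `ncSpan`, and so does its adjoint, merging. Hence the two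
projections are intertwined. -/
theorem ncKernel_merge {w₁ w₂ : List Γ} {a b : Γ} {I₁ I₂ J₁ J₂ : List α} {x y y' : α}
    (hI₁ : I₁.length = w₁.length) (hI₂ : I₂.length = w₂.length)
    (hJ₁ : J₁.length = w₁.length) (hJ₂ : J₂.length = w₂.length) :
    ncKernel (w₁ ++ a :: b :: w₂) (I₁ ++ x :: x :: I₂) (J₁ ++ y :: y' :: J₂) =
      if y = y' then ncKernel (w₁ ++ (a + b) :: w₂) (I₁ ++ x :: I₂) (J₁ ++ y :: J₂) else 0 := by
  let e : Coloring α (w₁ ++ (a + b) :: w₂).length → Coloring α (w₁ ++ a :: b :: w₂).length :=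
    fun v => ⟨v.1.take (w₁.length + 1) ++ v.1.drop w₁.length, by
      have := v.2
      simp at this ⊢
      omega⟩
  have h := (isOrthProj_ncProj (α := α) (w₁ ++ a :: b :: w₂)).apply_map
    (isOrthProj_ncProj (α := α) (w₁ ++ (a + b) :: w₂)) e ?_ ?_
    ⟨I₁ ++ x :: I₂, by simp [hI₁, hI₂]⟩ ⟨J₁ ++ y :: y' :: J₂, by simp [hJ₁, hJ₂]⟩
  · rw [ncKernel_of_length (by simp [hI₁, hI₂]) (by simp [hJ₁, hJ₂]),
      ← sum_vector_merge hJ₁ hJ₂ (m := (w₁ ++ (a + b) :: w₂).length) (by simp)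
        (ncKernel (w₁ ++ (a + b) :: w₂) (I₁ ++ x :: I₂))]
    refine Eq.trans ?_ (h.trans (Finset.sum_congr rfl fun v _ => ?_))
    · congr 1
      refine Subtype.ext ?_
      simp [e, ← hI₁, List.take_append]
    · rw [ncKernel_of_length (by simp [hI₁, hI₂]) v.2]
      exact if_congr Subtype.ext_iff rfl rfl
  · rintro _ ⟨f, hf, rfl⟩
    obtain ⟨g, hg, hfg⟩ := ncSpan_merge hf
    refine ⟨g, hg, ?_⟩
    ext v
    obtain ⟨K₁, z, K₂, hv, h1, h2⟩ := exists_append_cons_of_length (t := v.1)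
      (k := w₁.length) (m := w₂.length) (by rw [v.2]; simp)
    simp only [restrictLength_apply, Function.comp, e, hv]
    rw [hfg K₁ z K₂ h1 h2]
    simp [← h1, List.take_append, List.take_of_length_le]
  · rintro _ ⟨f, hf, rfl⟩
    obtain ⟨g, hg, hfg⟩ := ncSpan_split hf
    refine ⟨g, hg, ?_⟩
    ext u
    obtain ⟨K₁, z, K, hu, h1, h2⟩ := exists_append_cons_of_length (t := u.1)
      (k := w₁.length) (m := w₂.length + 1) (by rw [u.2]; simp)
    obtain ⟨z', K₂, rfl⟩ : ∃ z' K₂, K = z' :: K₂ := by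
      cases K with
      | nil => simp at h2
      | cons y J => exact ⟨y, J, rfl⟩
    rw [restrictLength_apply, hu, hfg K₁ z z' K₂ h1,
      ← sum_vector_merge h1 (by simpa using h2) (m := (w₁ ++ (a + b) :: w₂).length) (by simp)]
    refine Finset.sum_congr rfl fun v _ => if_congr ?_ rfl rfl
    rw [Subtype.ext_iff, hu]

theorem ncKernel_merge' {w₁ w₂ : List Γ} {a b : Γ} {I₁ I₂ J₁ J₂ : List α} {x x' y : α}
    (hI₁ : I₁.length = w₁.length) (hI₂ : I₂.length = w₂.length)
    (hJ₁ : J₁.length = w₁.length) (hJ₂ : J₂.length = w₂.length) :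
    ncKernel (w₁ ++ a :: b :: w₂) (I₁ ++ x :: x' :: I₂) (J₁ ++ y :: y :: J₂) =
      if x = x' then ncKernel (w₁ ++ (a + b) :: w₂) (I₁ ++ x :: I₂) (J₁ ++ y :: J₂) else 0 := by
  rw [← ncKernel_star, ncKernel_merge hJ₁ hJ₂ hI₁ hI₂, apply_ite star, ncKernel_star, star_zero]

/-- Inserting a singleton of weight zero maps `ncSpan` to `ncSpan`, and so does its adjoint, the
summation over the color of a point. Hence the two projections are intertwined. -/
theorem sum_ncKernel_insert {w₁ w₂ : List Γ} {I₁ I₂ J₁ J₂ : List α} {x : α}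
    (hI₁ : I₁.length = w₁.length) (hI₂ : I₂.length = w₂.length)
    (hJ₁ : J₁.length = w₁.length) (hJ₂ : J₂.length = w₂.length) :
    ∑ y, ncKernel (w₁ ++ 0 :: w₂) (I₁ ++ x :: I₂) (J₁ ++ y :: J₂) =
      ncKernel (w₁ ++ w₂) (I₁ ++ I₂) (J₁ ++ J₂) := by
  let e : Coloring α (w₁ ++ 0 :: w₂).length → Coloring α (w₁ ++ w₂).length :=
    fun v => ⟨v.1.take w₁.length ++ v.1.drop (w₁.length + 1), by
      have := v.2
      simp at this ⊢
      omega⟩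
  have h := (isOrthProj_ncProj (α := α) (w₁ ++ w₂)).apply_map
    (isOrthProj_ncProj (α := α) (w₁ ++ 0 :: w₂)) e ?_ ?_
    ⟨I₁ ++ x :: I₂, by simp [hI₁, hI₂]⟩ ⟨J₁ ++ J₂, by simp [hJ₁, hJ₂]⟩
  · rw [ncKernel_of_length (by simp [hI₁, hI₂]) (by simp [hJ₁, hJ₂]),
      ← sum_vector_insert hJ₁ hJ₂ (m := (w₁ ++ 0 :: w₂).length) (by simp)
        (ncKernel (w₁ ++ 0 :: w₂) (I₁ ++ x :: I₂))]
    symm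
    refine Eq.trans ?_ (h.trans (Finset.sum_congr rfl fun v _ => ?_))
    · congr 1
      refine Subtype.ext ?_
      simp [e, ← hI₁]
    · rw [ncKernel_of_length (by simp [hI₁, hI₂]) v.2]
      exact if_congr Subtype.ext_iff rfl rfl
  · rintro _ ⟨f, hf, rfl⟩
    obtain ⟨g, hg, hfg⟩ := ncSpan_insert hf
    refine ⟨g, hg, ?_⟩
    ext v
    obtain ⟨K₁, z, K₂, hv, h1, h2⟩ := exists_append_cons_of_length (t := v.1)
      (k := w₁.length) (m := w₂.length) (by rw [v.2]; simp)
    simp only [restrictLength_apply, Function.comp, e, hv]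
    rw [hfg K₁ z K₂ h1]
    simp [← h1]
  · rintro _ ⟨f, hf, rfl⟩
    obtain ⟨g, hg, hfg⟩ := ncSpan_remove hf
    refine ⟨g, hg, ?_⟩
    ext u
    obtain ⟨K₁, K₂, hu, h1, h2⟩ : ∃ K₁ K₂, u.1 = K₁ ++ K₂ ∧ K₁.length = w₁.length ∧
        K₂.length = w₂.length := by
      have := u.2
      simp at this
      exact ⟨u.1.take w₁.length, u.1.drop w₁.length, by simp, by simp; omega, by simp; omega⟩
    rw [restrictLength_apply, hu, hfg K₁ K₂ h1 h2,
      ← sum_vector_insert h1 h2 (m := (w₁ ++ 0 :: w₂).length) (by simp)]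
    refine Finset.sum_congr rfl fun v _ => if_congr ?_ rfl rfl
    rw [Subtype.ext_iff, hu]

theorem sum_ncKernel_insert' {w₁ w₂ : List Γ} {I₁ I₂ J₁ J₂ : List α} {y : α}
    (hI₁ : I₁.length = w₁.length) (hI₂ : I₂.length = w₂.length)
    (hJ₁ : J₁.length = w₁.length) (hJ₂ : J₂.length = w₂.length) :
    ∑ x, ncKernel (w₁ ++ 0 :: w₂) (I₁ ++ x :: I₂) (J₁ ++ y :: J₂) =
      ncKernel (w₁ ++ w₂) (I₁ ++ I₂) (J₁ ++ J₂) := by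
  rw [← ncKernel_star, ← sum_ncKernel_insert (x := y) hJ₁ hJ₂ hI₁ hI₂, star_sum]
  simp only [ncKernel_star]

end ncKernel

/-! ### The Haar functional -/

section weightedKernel

variable {Γ : Type} [AddGroup Γ] {α : Type} [DecidableEq α] [Fintype α]

/-- `ncKernel` on a list of triples, consisting of two colors and a weight. -/
def weightedKernel (L : List (α × α × Γ)) : ℂ :=
  ncKernel (L.map fun x => x.2.2) (L.map fun x => x.1) (L.map fun x => x.2.1)

theorem weightedKernel_row (L₁ L₂ : List (α × α × Γ)) (i j k : α) (a b : Γ) :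
    weightedKernel (L₁ ++ (i, j, a) :: (i, k, b) :: L₂) =
      if j = k then weightedKernel (L₁ ++ (i, j, a + b) :: L₂) else 0 := by
  simp only [weightedKernel, List.map_append, List.map_cons]
  exact ncKernel_merge (by simp) (by simp) (by simp) (by simp)

theorem weightedKernel_col (L₁ L₂ : List (α × α × Γ)) (i j k : α) (a b : Γ) :
    weightedKernel (L₁ ++ (i, k, a) :: (j, k, b) :: L₂) =
      if i = j then weightedKernel (L₁ ++ (i, k, a + b) :: L₂) else 0 := by
  simp only [weightedKernel, List.map_append, List.map_cons]
  exact ncKernel_merge' (by simp) (by simp) (by simp) (by simp)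

theorem weightedKernel_merge (L₁ L₂ : List (α × α × Γ)) (i j : α) (a b : Γ) :
    weightedKernel (L₁ ++ (i, j, a) :: (i, j, b) :: L₂) =
      weightedKernel (L₁ ++ (i, j, a + b) :: L₂) := by
  rw [weightedKernel_row, if_pos rfl]

theorem sum_weightedKernel_row (L₁ L₂ : List (α × α × Γ)) (i : α) :
    ∑ j, weightedKernel (L₁ ++ (i, j, 0) :: L₂) = weightedKernel (L₁ ++ L₂) := by
  simp only [weightedKernel, List.map_append, List.map_cons]
  exact sum_ncKernel_insert (by simp) (by simp) (by simp) (by simp)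

theorem sum_weightedKernel_col (L₁ L₂ : List (α × α × Γ)) (j : α) :
    ∑ i, weightedKernel (L₁ ++ (i, j, 0) :: L₂) = weightedKernel (L₁ ++ L₂) := by
  simp only [weightedKernel, List.map_append, List.map_cons]
  exact sum_ncKernel_insert' (by simp) (by simp) (by simp) (by simp)

theorem weightedKernel_replicate (L₁ L₂ : List (α × α × Γ)) (i j : α) (a b : Γ) (m : ℕ) :
    weightedKernel (L₁ ++ (i, j, a) :: (List.replicate m (i, j, b) ++ L₂)) =
      weightedKernel (L₁ ++ (i, j, a + m • b) :: L₂) := by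
  induction m generalizing a with
  | zero => simp
  | succ m ih =>
    rw [List.replicate_succ, List.cons_append, weightedKernel_merge, ih, succ_nsmul', add_assoc]

end weightedKernel

namespace FreeStarAlgebra

variable {X : Type}

/-- The product of a list of free generators and their adjoints. -/
def word (L : List (X × Bool)) : FreeStarAlgebra X := (L.map fun x => gen x.1 x.2).prod

theorem word_append (L L' : List (X × Bool)) : word (L ++ L') = word L * word L' := by
  simp [word]

theorem gen_eq_word (x : X) (b : Bool) : gen x b = word [(x, b)] := by simp [word]

theorem one_eq_word : (1 : FreeStarAlgebra X) = word [] := by simp [word]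

theorem word_pow (x : X × Bool) (m : ℕ) : word [x] ^ m = word (List.replicate m x) := by
  simp [word]

theorem mem_span_word (a : FreeStarAlgebra X) :
    a ∈ Submodule.span ℂ (Set.range (word (X := X))) := by
  induction a using FreeStarAlgebra.induction with
  | hC c =>
    rw [Algebra.algebraMap_eq_smul_one, one_eq_word]
    exact Submodule.smul_mem _ _ (Submodule.subset_span ⟨_, rfl⟩)
  | hg x b =>
    rw [gen_eq_word]
    exact Submodule.subset_span ⟨_, rfl⟩
  | ha a b ha hb => exact add_mem ha hb
  | hm a b ha hb =>
    have h := Submodule.mul_mem_mul ha hb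
    rw [Submodule.span_mul_span] at h
    refine Submodule.span_mono ?_ h
    rintro _ ⟨_, ⟨L, rfl⟩, _, ⟨L', rfl⟩, rfl⟩
    exact ⟨L ++ L', word_append L L'⟩

/-- The linear functional with prescribed values on the words. -/
def ofWords (φ : List (X × Bool) → ℂ) : FreeStarAlgebra X →ₗ[ℂ] ℂ :=
  Finsupp.linearCombination ℂ φ ∘ₗ
    LinearMap.applyₗ (Finsupp.single ([] : List (X × Bool)) (1 : ℂ)) ∘ₗ
    (liftAlg (B := Module.End ℂ (List (X × Bool) →₀ ℂ))
      fun x b => Finsupp.lmapDomain ℂ ℂ (List.cons (x, b))).toLinearMap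

theorem ofWords_word (φ : List (X × Bool) → ℂ) (L : List (X × Bool)) :
    ofWords φ (word L) = φ L := by
  have h : liftAlg (B := Module.End ℂ (List (X × Bool) →₀ ℂ))
      (fun x b => Finsupp.lmapDomain ℂ ℂ (List.cons (x, b))) (word L)
        (Finsupp.single ([] : List (X × Bool)) (1 : ℂ)) = Finsupp.single L 1 := by
    induction L with
    | nil => simp [word]
    | cons x L ih =>
      rw [← List.singleton_append, word_append, map_mul, Module.End.mul_apply, ih, ← gen_eq_word,
        liftAlg_gen]
      simp
  simp [ofWords, h]

end FreeStarAlgebra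

namespace ReflAlg

variable {N : ℕ} {s : ℕ∞}

/-- The weight of a generator, `1` for `u i j` and `-1` for its adjoint, in `ℤ/s`; for `s = ∞`
this is `ℤ`, as `ENat.toNat` takes the value `0`. -/
def weight (s : ℕ∞) (b : Bool) : ZMod s.toNat := if b then -1 else 1

theorem weight_false (s : ℕ∞) : weight s false = 1 := rfl

theorem weight_true (s : ℕ∞) : weight s true = -1 := rfl

/-- A generator of the free `*`-algebra, as a triple of two colors and a weight. -/
def triple (s : ℕ∞) (x : (Fin N × Fin N) × Bool) : Fin N × Fin N × ZMod s.toNat :=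
  (x.1.1, x.1.2, weight s x.2)

/-- The pullback of the Haar functional to the free `*`-algebra. -/
def freeHaar (N : ℕ) (s : ℕ∞) : FreeStarAlgebra (Fin N × Fin N) →ₗ[ℂ] ℂ :=
  FreeStarAlgebra.ofWords fun L => weightedKernel (L.map (triple s))

/-- The functional `x ↦ freeHaar (a * x * b)`. -/
def freeHaarBetween (s : ℕ∞) (a b : FreeStarAlgebra (Fin N × Fin N)) :
    FreeStarAlgebra (Fin N × Fin N) →ₗ[ℂ] ℂ :=
  freeHaar N s ∘ₗ LinearMap.mulRight ℂ b ∘ₗ LinearMap.mulLeft ℂ a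

open FreeStarAlgebra in
theorem freeHaarBetween_word (L₁ L₂ L : List ((Fin N × Fin N) × Bool)) :
    freeHaarBetween s (word L₁) (word L₂) (word L) =
      weightedKernel (L₁.map (triple s) ++ (L.map (triple s) ++ L₂.map (triple s))) := by
  simp only [freeHaarBetween, LinearMap.comp_apply, LinearMap.mulLeft_apply,
    LinearMap.mulRight_apply, ← word_append, freeHaar, ofWords_word, List.map_append,
    List.append_assoc]

theorem freeHaarBetween_eq_of_words {x y : FreeStarAlgebra (Fin N × Fin N)}
    (h : ∀ L₁ L₂, freeHaarBetween s (FreeStarAlgebra.word L₁) (FreeStarAlgebra.word L₂) x =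
      freeHaarBetween s (FreeStarAlgebra.word L₁) (FreeStarAlgebra.word L₂) y)
    (a b : FreeStarAlgebra (Fin N × Fin N)) :
    freeHaarBetween s a b x = freeHaarBetween s a b y := by
  have ha := FreeStarAlgebra.mem_span_word a
  have hb := FreeStarAlgebra.mem_span_word b
  simp only [freeHaarBetween, LinearMap.comp_apply, LinearMap.mulLeft_apply,
    LinearMap.mulRight_apply] at h ⊢
  induction ha using Submodule.span_induction with
  | mem a ha =>
    obtain ⟨L₁, rfl⟩ := ha
    induction hb using Submodule.span_induction with
    | mem b hb =>
      obtain ⟨L₂, rfl⟩ := hb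
      exact h L₁ L₂
    | zero => simp
    | add b b' _ _ h1 h2 => simp only [mul_add, map_add, h1, h2]
    | smul c b _ h1 => simp only [mul_smul_comm, map_smul, h1]
  | zero => simp
  | add a a' _ _ h1 h2 => simp only [add_mul, map_add, h1, h2]
  | smul c a _ h1 => simp only [smul_mul_assoc, map_smul, h1]

open FreeStarAlgebra in
/-- The functional `freeHaar` respects the defining relations: each relation says that some
operator of merging, splitting, inserting or removing points is an intertwiner. -/
theorem freeHaarBetween_eq_of_rel {x y : FreeStarAlgebra (Fin N × Fin N)} (h : ReflRel N s x y) :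
    ∀ L₁ L₂, freeHaarBetween s (word L₁) (word L₂) x = freeHaarBetween s (word L₁) (word L₂) y ∧
      freeHaarBetween s (word L₁) (word L₂) (Star.star x) =
        freeHaarBetween s (word L₁) (word L₂) (Star.star y) := by
  have hone : ∀ (i j : Fin N) L₁ L₂, freeHaarBetween s (word L₁) (word L₂)
      ((1 : Matrix (Fin N) (Fin N) (FreeStarAlgebra (Fin N × Fin N))) i j) =
        if i = j then weightedKernel (L₁.map (triple s) ++ L₂.map (triple s)) else 0 := by
    intro i j L₁ L₂
    rw [Matrix.one_apply]
    split_ifs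
    · rw [one_eq_word, freeHaarBetween_word]
      simp
    · simp
  have hstar : ∀ i j : Fin N, Star.star
      ((1 : Matrix (Fin N) (Fin N) (FreeStarAlgebra (Fin N × Fin N))) i j) =
        (1 : Matrix (Fin N) (Fin N) (FreeStarAlgebra (Fin N × Fin N))) j i := by
    intro i j
    simp only [Matrix.one_apply, eq_comm (a := j)]
    split_ifs <;> simp
  have h1 : ∀ i j L₁ L₂, freeHaarBetween s (word L₁) (word L₂)
      (∑ k : Fin N, gen (k, i) true * gen (k, j) false) =
        if i = j then weightedKernel (L₁.map (triple s) ++ L₂.map (triple s)) else 0 := by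
    intro i j L₁ L₂
    simp only [map_sum, gen_eq_word, ← word_append, freeHaarBetween_word, List.map_cons,
      List.map_nil, triple, weight_false, weight_true, List.cons_append,
      List.nil_append, weightedKernel_row]
    by_cases hij : i = j
    · subst hij
      simpa using sum_weightedKernel_col (L₁.map (triple s)) (L₂.map (triple s)) i
    · simp [hij]
  have h2 : ∀ i j L₁ L₂, freeHaarBetween s (word L₁) (word L₂)
      (∑ k : Fin N, gen (i, k) false * gen (j, k) true) =
        if i = j then weightedKernel (L₁.map (triple s) ++ L₂.map (triple s)) else 0 := by
    intro i j L₁ L₂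
    simp only [map_sum, gen_eq_word, ← word_append, freeHaarBetween_word, List.map_cons,
      List.map_nil, triple, weight_false, weight_true, List.cons_append,
      List.nil_append, weightedKernel_col]
    by_cases hij : i = j
    · subst hij
      simpa using sum_weightedKernel_row (L₁.map (triple s)) (L₂.map (triple s)) i
    · simp [hij]
  have h3 : ∀ i j L₁ L₂, freeHaarBetween s (word L₁) (word L₂)
      (∑ k : Fin N, gen (i, k) true * gen (j, k) false) =
        if i = j then weightedKernel (L₁.map (triple s) ++ L₂.map (triple s)) else 0 := by
    intro i j L₁ L₂
    simp only [map_sum, gen_eq_word, ← word_append, freeHaarBetween_word, List.map_cons,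
      List.map_nil, triple, weight_false, weight_true, List.cons_append,
      List.nil_append, weightedKernel_col]
    by_cases hij : i = j
    · subst hij
      simpa using sum_weightedKernel_row (L₁.map (triple s)) (L₂.map (triple s)) i
    · simp [hij]
  have h4 : ∀ i j L₁ L₂, freeHaarBetween s (word L₁) (word L₂)
      (∑ k : Fin N, gen (k, i) false * gen (k, j) true) =
        if i = j then weightedKernel (L₁.map (triple s) ++ L₂.map (triple s)) else 0 := by
    intro i j L₁ L₂
    simp only [map_sum, gen_eq_word, ← word_append, freeHaarBetween_word, List.map_cons,
      List.map_nil, triple, weight_false, weight_true, List.cons_append,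
      List.nil_append, weightedKernel_row]
    by_cases hij : i = j
    · subst hij
      simpa using sum_weightedKernel_col (L₁.map (triple s)) (L₂.map (triple s)) i
    · simp [hij]
  induction h with
  | star_mul_self i j =>
    intro L₁ L₂
    rw [hstar, hone, hone]
    simp only [Matrix.mul_apply, Matrix.star_apply, freeMatrix, star_sum, star_mul,
      star_gen, Bool.not_false, Bool.not_true, h1, and_self]
  | mul_star_self i j =>
    intro L₁ L₂
    rw [hstar, hone, hone]
    simp only [Matrix.mul_apply, Matrix.star_apply, freeMatrix, star_sum, star_mul,
      star_gen, Bool.not_false, Bool.not_true, h2,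
      and_self]
  | transpose_star_mul_self i j =>
    intro L₁ L₂
    rw [hstar, hone, hone]
    simp only [Matrix.mul_apply, Matrix.star_apply, Matrix.transpose_apply, freeMatrix, star_sum,
      star_mul, star_gen, Bool.not_false, Bool.not_true, h3,
      and_self]
  | transpose_mul_star_self i j =>
    intro L₁ L₂
    rw [hstar, hone, hone]
    simp only [Matrix.mul_apply, Matrix.star_apply, Matrix.transpose_apply, freeMatrix, star_sum,
      star_mul, star_gen, Bool.not_false, Bool.not_true, h4,
      and_self]
  | normal i j =>
    intro L₁ L₂
    simp only [freeMatrix, star_mul, star_gen, Bool.not_false,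
      Bool.not_true]
    simp [gen_eq_word, ← word_append, freeHaarBetween_word, triple, weight_false, weight_true,
      weightedKernel_merge]
  | proj i j =>
    intro L₁ L₂
    simp only [freeMatrix, star_mul, star_gen, Bool.not_false,
      Bool.not_true]
    simp [gen_eq_word, ← word_append, freeHaarBetween_word, triple, weight_false, weight_true,
      weightedKernel_merge]
  | pow_eq m hm hs i j =>
    intro L₁ L₂
    obtain ⟨n, rfl⟩ : ∃ n, m = n + 1 := ⟨m - 1, by omega⟩
    have h0 : (1 : ZMod s.toNat) + n • 1 = 0 := by
      have : ((n + 1 : ℕ) : ZMod s.toNat) = 0 := by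
        rw [hs]
        exact ZMod.natCast_self _
      simpa [add_comm] using this
    have h0' : (-1 : ZMod s.toNat) + n • (-1) = 0 := by
      rw [smul_neg, ← neg_add, h0, neg_zero]
    simp only [freeMatrix, star_pow, star_mul, star_gen, Bool.not_false, Bool.not_true]
    simp only [gen_eq_word, word_pow, ← word_append, freeHaarBetween_word, List.map_replicate,
      List.map_cons, List.map_nil, List.cons_append, List.nil_append, triple, weight_false,
      weight_true, weightedKernel_merge, List.replicate_succ, weightedKernel_replicate, h0, h0',
      add_neg_cancel, and_self]
  | partial_isometry i j =>
    intro L₁ L₂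
    simp only [freeMatrix, star_mul, star_gen, Bool.not_false,
      Bool.not_true]
    simp [gen_eq_word, ← word_append, freeHaarBetween_word, triple, weight_false, weight_true,
      weightedKernel_merge]
  | row_orthogonal i j k hjk =>
    intro L₁ L₂
    simp only [freeMatrix, star_mul, star_gen, star_zero, Bool.not_false,
      Bool.not_true]
    simp [gen_eq_word, ← word_append, freeHaarBetween_word, triple, weight_false, weight_true,
      weightedKernel_merge]
    simp [weightedKernel_row, hjk, hjk.symm]
  | col_orthogonal i j k hjk =>
    intro L₁ L₂
    simp only [freeMatrix, star_mul, star_gen, star_zero, Bool.not_false,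
      Bool.not_true]
    simp [gen_eq_word, ← word_append, freeHaarBetween_word, triple, weight_false, weight_true,
      weightedKernel_merge]
    simp [weightedKernel_col, hjk, hjk.symm]
  | star h ih =>
    intro L₁ L₂
    rw [star_star, star_star]
    exact (ih L₁ L₂).symm

theorem freeHaar_eq_of_rel {x y : FreeStarAlgebra (Fin N × Fin N)}
    (h : RingQuot.Rel (ReflRel N s) x y) : freeHaar N s x = freeHaar N s y := by
  have key : ∀ a b, freeHaarBetween s a b x = freeHaarBetween s a b y := by
    induction h with
    | of h => exact freeHaarBetween_eq_of_words fun L₁ L₂ => (freeHaarBetween_eq_of_rel h L₁ L₂).1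
    | add_left h ih => intro a b; rw [map_add, map_add, ih]
    | @mul_left x y z h ih =>
      intro a b
      simpa [freeHaarBetween, mul_assoc] using ih a (z * b)
    | @mul_right z x y h ih =>
      intro a b
      simpa [freeHaarBetween, mul_assoc] using ih (a * z) b
  simpa [freeHaarBetween] using key 1 1

/-- The Haar functional of `H_N^{s+}`. Its values on the coefficients of the tensor powers of the
fundamental representation are the entries of the projections onto the spans of noncrossing
partitions. -/
def haar (N : ℕ) (s : ℕ∞) : ReflAlg N s →ₗ[ℂ] ℂ :=
  let f : ReflAlg N s → ℂ := fun a =>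
    Quot.lift (freeHaar N s) (fun _ _ => freeHaar_eq_of_rel) (RingQuot.toQuot a)
  have hf : ∀ x, f (mk N s x) = freeHaar N s x := by
    intro x
    simp only [mk, RingQuot.mkAlgHom_def, RingQuot.mkRingHom_def]
    rfl
  { toFun := f
    map_add' := by
      intro a b
      obtain ⟨a, rfl⟩ := mk_surjective a
      obtain ⟨b, rfl⟩ := mk_surjective b
      rw [← map_add, hf, hf, hf, map_add]
    map_smul' := by
      intro c a
      obtain ⟨a, rfl⟩ := mk_surjective a
      rw [← map_smul, hf, hf, map_smul, RingHom.id_apply] }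

theorem haar_mk (x : FreeStarAlgebra (Fin N × Fin N)) : haar N s (mk N s x) = freeHaar N s x := by
  change Quot.lift (freeHaar N s) _ (RingQuot.toQuot (mk N s x)) = freeHaar N s x
  simp only [mk, RingQuot.mkAlgHom_def, RingQuot.mkRingHom_def]
  rfl

end ReflAlg

/-! ### Coefficients of tensor products of corepresentations -/

/-- The coefficients of the tensor product of the matrices `x b`, where `b` runs through a list.
The rows and columns are indexed by lists; lists of the wrong length give `0`. -/
def tensorCoeff {β α B : Type} [Ring B] (x : β → Matrix α α B) : List β → List α → List α → B
  | [], [], [] => 1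
  | b :: w, i :: I, j :: J => x b i j * tensorCoeff x w I J
  | _, _, _ => 0

section tensorCoeff

variable {β γ α B C : Type} [Ring B] [Ring C]

theorem tensorCoeff_map_word (x : β → Matrix α α B) (g : γ → β) (w : List γ) (I J : List α) :
    tensorCoeff x (w.map g) I J = tensorCoeff (fun c => x (g c)) w I J := by
  induction w generalizing I J with
  | nil => cases I <;> cases J <;> rfl
  | cons b w ih => cases I <;> cases J <;> simp [tensorCoeff, ih]

theorem map_tensorCoeff {F : Type} [FunLike F B C] [RingHomClass F B C] (π : F)
    (x : β → Matrix α α B) (w : List β) (I J : List α) :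
    π (tensorCoeff x w I J) = tensorCoeff (fun b => (x b).map π) w I J := by
  induction w generalizing I J with
  | nil => cases I <;> cases J <;> simp [tensorCoeff]
  | cons b w ih => cases I <;> cases J <;> simp [tensorCoeff, ih]

theorem sum_coloring_cons {M : Type} [AddCommMonoid M] [Fintype α] (k : ℕ) (f : List α → M) :
    ∑ K : Coloring α (k + 1), f K.1 = ∑ x, ∑ K : Coloring α k, f (x :: K.1) := by
  rw [← Fintype.sum_prod_type']
  let e : α × Coloring α k → Coloring α (k + 1) := fun p => ⟨p.1 :: p.2.1, by simp [p.2.2]⟩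
  have he : Function.Bijective e := ?_
  · exact (Fintype.sum_bijective e he (fun p => f (p.1 :: p.2.1)) (fun K => f K.1)
      fun _ => rfl).symm
  constructor
  · rintro ⟨a, K, hK⟩ ⟨a', K', hK'⟩ h
    simp only [e, Subtype.mk.injEq, List.cons.injEq] at h
    obtain ⟨rfl, rfl⟩ := h
    rfl
  · rintro ⟨_ | ⟨a, K⟩, hK⟩
    · simp at hK
    · exact ⟨(a, ⟨K, by simpa using hK⟩), rfl⟩

theorem sum_coloring_zero {M : Type} [AddCommMonoid M] [Fintype α] (f : List α → M) :
    ∑ K : Coloring α 0, f K.1 = f [] := by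
  rw [Fintype.sum_eq_single (⟨[], rfl⟩ : Coloring α 0)]
  intro J hJ
  exact absurd (Subtype.ext (List.length_eq_zero_iff.mp J.2)) hJ

variable [Fintype α] [Algebra ℂ B]

/-- The coaction on the vector `f` of a tensor product: its coordinate at `I`. -/
def coeffSum (x : β → Matrix α α B) (w : List β) (I : List α) (f : List α → ℂ) : B :=
  ∑ K : Coloring α w.length, f K.1 • tensorCoeff x w I K.1

theorem coeffSum_nil (x : β → Matrix α α B) (f : List α → ℂ) : coeffSum x [] [] f = f [] • 1 :=
  sum_coloring_zero fun K => f K • tensorCoeff x [] [] K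

theorem coeffSum_cons (x : β → Matrix α α B) (b : β) (w : List β) (i : α) (I : List α)
    (f : List α → ℂ) : coeffSum x (b :: w) (i :: I) f =
      ∑ k, x b i k * coeffSum x w I (fun K => f (k :: K)) := by
  refine (sum_coloring_cons w.length
    fun K => f K • tensorCoeff x (b :: w) (i :: I) K).trans ?_
  simp only [tensorCoeff, coeffSum, Finset.mul_sum, mul_smul_comm]

theorem coeffSum_map_word (x : β → Matrix α α B) (g : γ → β) (w : List γ) (I : List α)
    (f : List α → ℂ) :
    coeffSum x (w.map g) I f = coeffSum (fun c => x (g c)) w I f := by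
  unfold coeffSum
  simp only [tensorCoeff_map_word]
  rw [List.length_map]

theorem coeffSum_congr (x : β → Matrix α α B) {w : List β} (I : List α) {f g : List α → ℂ}
    (h : ∀ K, K.length = w.length → f K = g K) : coeffSum x w I f = coeffSum x w I g :=
  Finset.sum_congr rfl fun K _ => by rw [h K.1 K.2]

theorem coeffSum_add (x : β → Matrix α α B) (w : List β) (I : List α) (f g : List α → ℂ) :
    coeffSum x w I (f + g) = coeffSum x w I f + coeffSum x w I g := by
  simp [coeffSum, add_smul, Finset.sum_add_distrib]

theorem coeffSum_smul (x : β → Matrix α α B) (w : List β) (I : List α) (c : ℂ) (f : List α → ℂ) :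
    coeffSum x w I (c • f) = c • coeffSum x w I f := by
  simp [coeffSum, mul_smul, Finset.smul_sum]

theorem coeffSum_zero (x : β → Matrix α α B) (w : List β) (I : List α) :
    coeffSum x w I 0 = 0 := by
  simp [coeffSum]

/-! ### Noncrossing partitions give fixed vectors -/

/-- A singleton contributes a row sum of `x 0` to the coaction. -/
theorem coeffSum_insert [AddGroup γ] {x : γ → Matrix α α B} (hx : ∀ i, ∑ j, x 0 i j = 1)
    (w₁ w₂ : List γ) (I₁ : List α) (i : α) (I₂ : List α) {f g : List α → ℂ}
    (hI₁ : I₁.length = w₁.length)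
    (h : ∀ (J₁ : List α) (j : α) (J₂ : List α), J₁.length = w₁.length →
      f (J₁ ++ j :: J₂) = g (J₁ ++ J₂)) :
    coeffSum x (w₁ ++ 0 :: w₂) (I₁ ++ i :: I₂) f = coeffSum x (w₁ ++ w₂) (I₁ ++ I₂) g := by
  induction w₁ generalizing I₁ f g with
  | nil =>
    obtain rfl : I₁ = [] := by simpa using hI₁
    have h' : ∀ k, (fun K => f (k :: K)) = g := fun k => funext fun K => h [] k K rfl
    simp only [List.nil_append, coeffSum_cons, h', ← Finset.sum_mul, hx, one_mul]
  | cons a w₁ ih =>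
    cases I₁ with
    | nil => simp at hI₁
    | cons i₁ I₁ =>
      simp only [List.cons_append, coeffSum_cons]
      refine Finset.sum_congr rfl fun k _ => ?_
      rw [ih I₁ (g := fun K => g (k :: K)) (by simpa using hI₁) fun J₁ j J₂ hJ =>
        h (k :: J₁) j J₂ (by simpa using hJ)]

/-- For two adjacent points in a block, the orthogonality in the columns merges the two factors. -/
theorem coeffSum_split [AddGroup γ] [DecidableEq α] {x : γ → Matrix α α B}
    (hx : ∀ a b i j k, x a i k * x b j k = if i = j then x (a + b) i k else 0)
    (w₁ w₂ : List γ) (a b : γ) (I₁ : List α) (i j : α) (I₂ : List α) {f g : List α → ℂ}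
    (hI₁ : I₁.length = w₁.length)
    (h : ∀ (J₁ : List α) (k l : α) (J₂ : List α), J₁.length = w₁.length →
      f (J₁ ++ k :: l :: J₂) = if k = l then g (J₁ ++ k :: J₂) else 0) :
    coeffSum x (w₁ ++ a :: b :: w₂) (I₁ ++ i :: j :: I₂) f =
      if i = j then coeffSum x (w₁ ++ (a + b) :: w₂) (I₁ ++ i :: I₂) g else 0 := by
  induction w₁ generalizing I₁ f g with
  | nil =>
    obtain rfl : I₁ = [] := by simpa using hI₁
    have h' : ∀ k l, (fun K => f (k :: l :: K)) = if k = l then (fun K => g (k :: K)) else 0 := by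
      intro k l
      funext K
      rw [show f (k :: l :: K) = _ from h [] k l K rfl]
      split_ifs <;> rfl
    have h0 : ∀ k, ∑ l, x b j l *
        coeffSum x w₂ I₂ (if k = l then (fun K => g (k :: K)) else 0) =
          x b j k * coeffSum x w₂ I₂ (fun K => g (k :: K)) := by
      intro k
      rw [Finset.sum_eq_single k (fun l _ hl => by rw [if_neg hl.symm, coeffSum_zero, mul_zero])
        (by simp), if_pos rfl]
    simp only [List.nil_append, coeffSum_cons, h', h0, ← mul_assoc, hx]
    split_ifs <;> simp
  | cons c w₁ ih =>
    cases I₁ with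
    | nil => simp at hI₁
    | cons i₁ I₁ =>
      simp only [List.cons_append, coeffSum_cons]
      have h' := fun k => ih I₁ (f := fun K => f (k :: K)) (g := fun K => g (k :: K))
        (by simpa using hI₁) fun J₁ j l J₂ hJ => h (k :: J₁) j l J₂ (by simpa using hJ)
      simp only [h']
      split_ifs <;> simp

/-- If the entries of the matrices `x a` multiply as the powers of the entries of a
quantum reflection, then the vectors of noncrossing partitions are fixed. -/
theorem coeffSum_of_mem_ncSpan [AddGroup γ] [DecidableEq α] {x : γ → Matrix α α B}
    (hx : ∀ i, ∑ j, x 0 i j = 1)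
    (hx' : ∀ a b i j k, x a i k * x b j k = if i = j then x (a + b) i k else 0)
    {w : List γ} {f : List α → ℂ} (hf : f ∈ ncSpan α w) {I : List α}
    (hI : I.length = w.length) : coeffSum x w I f = f I • 1 := by
  induction hf using Submodule.span_induction with
  | mem f hf =>
    obtain ⟨c, hc, rfl⟩ := hf
    change IsNC w c at hc
    change coeffSum x w I (partVec c []) = partVec c [] I • 1
    induction hc generalizing I with
    | nil =>
      obtain rfl : I = [] := by simpa using hI
      exact coeffSum_nil x _
    | @insert w₁ w₂ c₁ c₂ hl h ih =>
      obtain ⟨I₁, i, I₂, rfl, h1, h2⟩ := exists_append_cons_of_length (k := w₁.length)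
        (m := w₂.length) (by rw [hI]; simp)
      rw [coeffSum_insert hx w₁ w₂ I₁ i I₂ h1
        fun J₁ j J₂ hJ => partVec_singleton c₁ c₂ [] J₁ j J₂ (hJ.trans hl.symm),
        ih (by simp [h1, h2]), partVec_singleton _ _ _ _ _ _ (h1.trans hl.symm)]
    | @split w₁ w₂ c₁ c₂ a b r hl h ih =>
      obtain ⟨I₁, i, I', rfl, h1, h2⟩ := exists_append_cons_of_length (k := w₁.length)
        (m := w₂.length + 1) (by rw [hI]; simp)
      obtain ⟨j, I₂, rfl⟩ := List.exists_cons_of_length_eq_add_one h2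
      have h3 : I₂.length = w₂.length := by simpa using h2
      rw [coeffSum_split hx' w₁ w₂ a b I₁ i j I₂ h1
        fun J₁ k l J₂ hJ => partVec_split c₁ c₂ r [] J₁ k l J₂ (hJ.trans hl.symm),
        ih (by simp [h1, h3]), partVec_split _ _ _ _ _ _ _ _ (h1.trans hl.symm)]
      split_ifs <;> simp
  | zero => simp [coeffSum_zero]
  | add f g _ _ h1 h2 => rw [coeffSum_add, h1, h2, Pi.add_apply, add_smul]
  | smul c f _ h => rw [coeffSum_smul, h, Pi.smul_apply, smul_eq_mul, mul_smul]

end tensorCoeff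

/-! ### Powers of the entries of a quantum reflection -/

namespace IsQuantumReflection

variable {B : Type} [Ring B] [StarRing B] {N : ℕ} {s : ℕ∞} {v : Matrix (Fin N) (Fin N) B}

/-- The unit `v i j + (1 - v i j * star (v i j))`. -/
def entryUnit (hv : IsQuantumReflection s v) (i j : Fin N) : Bˣ where
  val := v i j + (1 - v i j * star (v i j))
  inv := star (v i j) + (1 - v i j * star (v i j))
  val_inv := by
    have h1 := hv.mul_proj i j
    have h2 := hv.proj_mul_star i j
    have h3 : v i j * star (v i j) * (v i j * star (v i j)) = v i j * star (v i j) := by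
      rw [← mul_assoc, hv.proj_mul]
    simp only [mul_add, add_mul, mul_sub, sub_mul, h1, h2, h3, mul_one, one_mul]
    abel
  inv_val := by
    have h1 := hv.star_mul_proj i j
    have h2 := hv.proj_mul i j
    have h3 : v i j * star (v i j) * (v i j * star (v i j)) = v i j * star (v i j) := by
      rw [← mul_assoc, hv.proj_mul]
    simp only [mul_add, add_mul, mul_sub, sub_mul, h1, h2, h3, hv.comm, mul_one, one_mul]
    abel

theorem entryUnit_pow (hv : IsQuantumReflection s v) (i j : Fin N) :
    (entryUnit hv i j) ^ s.toNat = 1 := by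
  rcases Nat.eq_zero_or_pos s.toNat with h | h
  · rw [h, pow_zero]
  · have hs : s = (s.toNat : ℕ∞) := (ENat.natCast_toNat (by rintro rfl; simp at h)).symm
    have key : ∀ m : ℕ, ((entryUnit hv i j : Bˣ) : B) ^ (m + 1) =
        v i j ^ (m + 1) + (1 - v i j * star (v i j)) := by
      intro m
      induction m with
      | zero => simp [entryUnit]
      | succ m ih =>
        have h1 : v i j ^ (m + 1) * (v i j * star (v i j)) = v i j ^ (m + 1) := by
          rw [pow_succ, mul_assoc, hv.mul_proj]
        have h3 : v i j * star (v i j) * (v i j * star (v i j)) = v i j * star (v i j) := by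
          rw [← mul_assoc, hv.proj_mul]
        rw [pow_succ, ih, pow_succ (v i j) (m + 1)]
        simp only [entryUnit, mul_add, add_mul, mul_sub, sub_mul, h1, h3, mul_one, one_mul,
          hv.proj_mul]
        abel
    obtain ⟨m, hm⟩ : ∃ m, s.toNat = m + 1 := ⟨s.toNat - 1, by omega⟩
    ext
    rw [Units.val_pow_eq_pow_val, hm, key, ← hm, hv.pow_eq _ h hs]
    simp

/-- The powers of `entryUnit`, with exponents in `ℤ/s`. -/
def entryZPow (hv : IsQuantumReflection s v) (i j : Fin N) :
    ZMod s.toNat →+ Additive Bˣ :=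
  ZMod.lift s.toNat ⟨zmultiplesHom _ (Additive.ofMul (entryUnit hv i j)), by
    rw [zmultiplesHom_apply, natCast_zsmul, ← ofMul_pow, entryUnit_pow, ofMul_one]⟩

theorem entryZPow_one (hv : IsQuantumReflection s v) (i j : Fin N) :
    entryZPow hv i j 1 = Additive.ofMul (entryUnit hv i j) := by
  have h := ZMod.lift_castAddHom s.toNat ⟨zmultiplesHom _ (Additive.ofMul (entryUnit hv i j)), by
    rw [zmultiplesHom_apply, natCast_zsmul, ← ofMul_pow, entryUnit_pow, ofMul_one]⟩ 1
  simpa [entryZPow] using h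

/-- The power of `v i j` with exponent `a` in `ℤ/s`: the unitary part of `v i j` raised to the
power `a` on the support of `v i j`, and `0` off the support. -/
def entryPow (hv : IsQuantumReflection s v) (a : ZMod s.toNat) : Matrix (Fin N) (Fin N) B :=
  fun i j => v i j * star (v i j) * ((entryZPow hv i j a).toMul : Bˣ)

theorem entryPow_zero (hv : IsQuantumReflection s v) (i j : Fin N) :
    entryPow hv 0 i j = v i j * star (v i j) := by
  simp [entryPow]

theorem entryPow_one (hv : IsQuantumReflection s v) : entryPow hv 1 = v := by
  ext i j
  have h3 : v i j * star (v i j) * (v i j * star (v i j)) = v i j * star (v i j) := by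
    rw [← mul_assoc, hv.proj_mul]
  rw [entryPow, entryZPow_one, toMul_ofMul]
  change v i j * star (v i j) * (v i j + (1 - v i j * star (v i j))) = v i j
  rw [mul_add, mul_sub, h3, hv.proj_mul, mul_one, sub_self, add_zero]

theorem entryPow_neg_one (hv : IsQuantumReflection s v) : entryPow hv (-1) = v.map star := by
  ext i j
  have h3 : v i j * star (v i j) * (v i j * star (v i j)) = v i j * star (v i j) := by
    rw [← mul_assoc, hv.proj_mul]
  rw [entryPow, map_neg, entryZPow_one, toMul_neg, toMul_ofMul]
  change v i j * star (v i j) * (star (v i j) + (1 - v i j * star (v i j))) = star (v i j)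
  rw [mul_add, mul_sub, h3, hv.proj_mul_star, mul_one, sub_self, add_zero]

theorem commute_entryZPow (hv : IsQuantumReflection s v) (i j : Fin N) (a : ZMod s.toNat) :
    Commute (v i j * star (v i j)) ((entryZPow hv i j a).toMul : Bˣ) := by
  obtain ⟨m, rfl⟩ := ZMod.intCast_surjective a
  have h : entryZPow hv i j (m : ZMod s.toNat) =
      Additive.ofMul (entryUnit hv i j ^ m) := by
    rw [← zsmul_one, map_zsmul, entryZPow_one, ofMul_zpow]
  rw [h, toMul_ofMul]
  refine Commute.units_zpow_right ?_ m
  change Commute (v i j * star (v i j)) (v i j + (1 - v i j * star (v i j)))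
  refine Commute.add_right ?_ ((Commute.one_right _).sub_right (Commute.refl _))
  rw [Commute, SemiconjBy, hv.proj_mul, hv.mul_proj]

theorem entryPow_mul_entryPow (hv : IsQuantumReflection s v) (a b : ZMod s.toNat)
    (i j k : Fin N) : entryPow hv a i k * entryPow hv b j k =
      if i = j then entryPow hv (a + b) i k else 0 := by
  have h := (commute_entryZPow hv i k a).eq
  have h3 : v i k * star (v i k) * (v i k * star (v i k)) = v i k * star (v i k) := by
    rw [← mul_assoc, hv.proj_mul]
  split_ifs with hij
  · subst hij
    simp only [entryPow, map_add, toMul_add, Units.val_mul]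
    generalize v i k * star (v i k) = p at h h3
    rw [h, mul_assoc, ← mul_assoc p, h3, ← mul_assoc, ← h, mul_assoc]
  · simp only [entryPow]
    rw [h, mul_assoc, ← mul_assoc (v i k * star (v i k)), hv.col_orthogonal k i j hij, zero_mul,
      mul_zero]

theorem sum_entryPow_zero (hv : IsQuantumReflection s v) (i : Fin N) :
    ∑ j, entryPow hv 0 i j = 1 := by
  simp only [entryPow_zero]
  simpa using hv.sum2 i i

end IsQuantumReflection

/-- The matrix `v` for `false`, and its entrywise adjoint for `true`. -/
def starMatrix {α B : Type} [Star B] (v : Matrix α α B) (b : Bool) : Matrix α α B :=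
  if b then v.map star else v

theorem IsQuantumReflection.entryPow_weight {B : Type} [Ring B] [StarRing B] {N : ℕ} {s : ℕ∞}
    {v : Matrix (Fin N) (Fin N) B} (hv : IsQuantumReflection s v) (b : Bool) :
    hv.entryPow (ReflAlg.weight s b) = starMatrix v b := by
  cases b
  · exact hv.entryPow_one
  · exact hv.entryPow_neg_one

/-- The vectors of noncrossing partitions are fixed by quantum reflections. -/
theorem IsQuantumReflection.coeffSum_eq {B : Type} [Ring B] [StarRing B] [Algebra ℂ B] {N : ℕ}
    {s : ℕ∞} {v : Matrix (Fin N) (Fin N) B} (hv : IsQuantumReflection s v) {w : List Bool}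
    {f : List (Fin N) → ℂ} (hf : f ∈ ncSpan (Fin N) (w.map (ReflAlg.weight s)))
    {I : List (Fin N)} (hI : I.length = w.length) :
    coeffSum (starMatrix v) w I f = f I • 1 := by
  have h := coeffSum_of_mem_ncSpan hv.sum_entryPow_zero hv.entryPow_mul_entryPow hf
    (hI.trans (by simp))
  rw [coeffSum_map_word] at h
  simpa only [hv.entryPow_weight] using h

namespace ReflAlg

variable {N : ℕ} {s : ℕ∞}

/-- The coefficients of the tensor powers of the fundamental corepresentation and its
conjugate. -/
def coeff (N : ℕ) (s : ℕ∞) (w : List Bool) (I J : List (Fin N)) : ReflAlg N s :=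
  tensorCoeff (starMatrix (u N s)) w I J

theorem starMatrix_u (b : Bool) (i j : Fin N) :
    starMatrix (u N s) b i j = mk N s (FreeStarAlgebra.gen (i, j) b) := by
  cases b
  · rfl
  · simp [starMatrix, u, ← mk_star, freeMatrix]

/-- The Haar functional integrates the coefficients of a tensor power to the projection onto the
combinations of noncrossing partitions. -/
theorem haar_coeff (w : List Bool) (I J : List (Fin N)) :
    haar N s (coeff N s w I J) = ncKernel (w.map (weight s)) I J := by
  by_cases h : I.length = w.length ∧ J.length = w.length
  · have key : ∃ L : List ((Fin N × Fin N) × Bool),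
        coeff N s w I J = mk N s (FreeStarAlgebra.word L) ∧
          L.map (fun x => x.1.1) = I ∧ L.map (fun x => x.1.2) = J ∧ L.map (fun x => x.2) = w := by
      obtain ⟨hI, hJ⟩ := h
      induction w generalizing I J with
      | nil =>
        obtain rfl : I = [] := by simpa using hI
        obtain rfl : J = [] := by simpa using hJ
        exact ⟨[], by simp [coeff, tensorCoeff, FreeStarAlgebra.word]⟩
      | cons b w ih =>
        obtain ⟨i, I, rfl⟩ := List.exists_cons_of_length_eq_add_one hI
        obtain ⟨j, J, rfl⟩ := List.exists_cons_of_length_eq_add_one hJ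
        obtain ⟨L, h0, rfl, rfl, rfl⟩ := ih I J (by simpa using hI) (by simpa using hJ)
        refine ⟨((i, j), b) :: L, ?_, rfl, rfl, rfl⟩
        change starMatrix (u N s) b i j * coeff N s _ _ _ = _
        rw [h0, starMatrix_u, ← map_mul, FreeStarAlgebra.gen_eq_word,
          ← FreeStarAlgebra.word_append]
        rfl
    obtain ⟨L, h0, rfl, rfl, rfl⟩ := key
    rw [h0, haar_mk, freeHaar, FreeStarAlgebra.ofWords_word, weightedKernel]
    simp only [List.map_map]
    rfl
  · have h0 : coeff N s w I J = 0 := by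
      unfold coeff
      induction w generalizing I J with
      | nil => cases I <;> cases J <;> simp [tensorCoeff] at h ⊢
      | cons b w ih =>
        cases I <;> cases J <;> simp only [tensorCoeff]
        rw [ih _ _ (by simpa using h), mul_zero]
    rw [h0, map_zero, ncKernel, dif_neg (by simpa using h)]

theorem haar_one : haar N s 1 = 1 := by
  have h := haar_coeff (s := s) [] ([] : List (Fin N)) []
  rwa [List.map_nil, ncKernel_nil] at h

theorem comul_coeff (w : List Bool) (I J : List (Fin N)) :
    Coalgebra.comul (R := ℂ) (coeff N s w I J) =
      ∑ K : Coloring (Fin N) w.length, coeff N s w I K.1 ⊗ₜ[ℂ] coeff N s w K.1 J := by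
  have hb : ∀ b i j, comulHom N s (starMatrix (u N s) b i j) =
      ∑ k, starMatrix (u N s) b i k ⊗ₜ[ℂ] starMatrix (u N s) b k j := by
    intro b i j
    cases b
    · exact comulHom_u i j
    · exact comulHom_star_u i j
  rw [comul_eq]
  unfold coeff
  induction w generalizing I J with
  | nil =>
    rw [List.length_nil, sum_coloring_zero
      fun K => tensorCoeff (starMatrix (u N s)) [] I K ⊗ₜ[ℂ]
        tensorCoeff (starMatrix (u N s)) [] K J]
    cases I <;> cases J <;> simp [tensorCoeff, Algebra.TensorProduct.one_def]
  | cons b w ih =>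
    rw [List.length_cons, sum_coloring_cons _ fun K =>
      tensorCoeff (starMatrix (u N s)) (b :: w) I K ⊗ₜ[ℂ]
        tensorCoeff (starMatrix (u N s)) (b :: w) K J]
    cases I <;> cases J <;> simp only [tensorCoeff, map_zero, TensorProduct.zero_tmul,
      TensorProduct.tmul_zero, Finset.sum_const_zero]
    rw [map_mul, hb, ih, Finset.sum_mul_sum]
    simp

theorem mem_span_coeff (a : ReflAlg N s) :
    a ∈ Submodule.span ℂ {a | ∃ w I J, I.length = w.length ∧ J.length = w.length ∧
      a = coeff N s w I J} := by
  obtain ⟨a, rfl⟩ := mk_surjective a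
  have ha := FreeStarAlgebra.mem_span_word a
  induction ha using Submodule.span_induction with
  | mem a ha =>
    obtain ⟨L, rfl⟩ := ha
    refine Submodule.subset_span ⟨L.map (fun x => x.2), L.map (fun x => x.1.1),
      L.map (fun x => x.1.2), by simp, by simp, ?_⟩
    induction L with
    | nil => simp [FreeStarAlgebra.word, coeff, tensorCoeff]
    | cons x L ih =>
      change _ = starMatrix (u N s) x.2 x.1.1 x.1.2 * coeff N s _ _ _
      rw [← ih, starMatrix_u, ← map_mul]
      simp [FreeStarAlgebra.word]
  | zero => simp
  | add a b _ _ h1 h2 => rw [map_add]; exact add_mem h1 h2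
  | smul c a _ h => rw [map_smul]; exact Submodule.smul_mem _ _ h

/-- The Haar functional is invariant. -/
theorem haar_invariant (a : ReflAlg N s) :
    TensorProduct.lift ((LinearMap.lsmul ℂ (ReflAlg N s)).flip.compl₂ (haar N s))
      (Coalgebra.comul (R := ℂ) a) = haar N s a • 1 := by
  have ha := mem_span_coeff a
  induction ha using Submodule.span_induction with
  | mem a ha =>
    obtain ⟨w, I, J, hI, hJ, rfl⟩ := ha
    rw [comul_coeff, map_sum]
    simp only [TensorProduct.lift.tmul, LinearMap.compl₂_apply, LinearMap.flip_apply,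
      LinearMap.lsmul_apply, haar_coeff]
    obtain ⟨f, hf, h⟩ := exists_ncKernel_eq (w.map (weight s)) J
    rw [h I (by simpa using hI), ← (isQuantumReflection_u N s).coeffSum_eq hf hI]
    exact Finset.sum_congr rfl fun K _ => by rw [h K.1 (by simp [K.2])]; rfl
  | zero => simp
  | add a b _ _ h1 h2 => simp only [map_add, h1, h2, add_smul]
  | smul c a _ h => simp only [map_smul, h, smul_assoc]

end ReflAlg

/-! ### Vectors fixed by the corner and by a transposition -/

/-- Insert the letter `Fin.last n` into a word, at the positions where `P` is `true`. -/
def fill {n : ℕ} : List Bool → List (Fin n) → List (Fin (n + 1))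
  | true :: P, I => Fin.last n :: fill P I
  | false :: P, i :: I => i.castSucc :: fill P I
  | _, _ => []

/-- The entries of a list at the positions where `P` is `false`. -/
def unmarked {β : Type} : List Bool → List β → List β
  | true :: P, _ :: w => unmarked P w
  | false :: P, b :: w => b :: unmarked P w
  | _, _ => []

section fill

variable {n : ℕ} {β : Type}

theorem length_fill {P : List Bool} {w : List β} {I : List (Fin n)} (hP : P.length = w.length)
    (hI : I.length = (unmarked P w).length) : (fill P I).length = w.length := by
  induction P generalizing w I with
  | nil => cases w <;> simp_all [fill]
  | cons p P ih =>
    cases w with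
    | nil => simp at hP
    | cons b w =>
      cases p
      · obtain ⟨i, I, rfl⟩ := List.exists_cons_of_length_eq_add_one hI
        simpa [fill] using ih (by simpa using hP) (by simpa [unmarked] using hI)
      · simpa [fill] using ih (by simpa using hP) (by simpa [unmarked] using hI)

theorem exists_eq_fill (w : List β) {I : List (Fin (n + 1))} (hI : I.length = w.length) :
    ∃ (P : List Bool) (I' : List (Fin n)), P.length = w.length ∧
      I'.length = (unmarked P w).length ∧ I = fill P I' := by
  induction w generalizing I with
  | nil => exact ⟨[], [], rfl, rfl, by simpa [fill] using hI⟩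
  | cons b w ih =>
    obtain ⟨i, I, rfl⟩ := List.exists_cons_of_length_eq_add_one hI
    obtain ⟨P, I', h1, h2, rfl⟩ := ih (by simpa using hI)
    induction i using Fin.lastCases with
    | last => exact ⟨true :: P, I', by simp [h1], by simp [unmarked, h2], rfl⟩
    | cast i => exact ⟨false :: P, i :: I', by simp [h1], by simp [unmarked, h2], rfl⟩

theorem fill_replicate_false (I : List (Fin n)) :
    fill (List.replicate I.length false) I = I.map Fin.castSucc := by
  induction I with
  | nil => rfl
  | cons i I ih => simp [List.replicate_succ, fill, ih]

theorem unmarked_replicate_false (w : List β) :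
    unmarked (List.replicate w.length false) w = w := by
  induction w with
  | nil => rfl
  | cons b w ih => simp [List.replicate_succ, unmarked, ih]

theorem fill_map (P : List Bool) (I : List (Fin n)) (τ : Fin (n + 1) → Fin (n + 1))
    (σ : Fin (n + 1) → Fin n) (h1 : (σ (Fin.last n)).castSucc = τ (Fin.last n))
    (h2 : ∀ i ∈ I, (σ i.castSucc).castSucc = τ i.castSucc) :
    (fill P I).map τ = ((fill P I).map σ).map Fin.castSucc := by
  induction P generalizing I with
  | nil => simp [fill]
  | cons p P ih =>
    cases p
    · cases I with
      | nil => simp [fill]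
      | cons i I =>
        simp only [fill, List.map_cons, ih I fun i hi => h2 i (by simp [hi]), h2 i (by simp)]
    · simp only [fill, List.map_cons, ih I h2, h1]

variable {B : Type} [Ring B]

/-- The coefficients of the restriction to the corner: the positions of the last letter have to
agree, and the other positions give a coefficient over the smaller set of letters. -/
theorem tensorCoeff_corner (x : β → Matrix (Fin n) (Fin n) B) {w : List β} {P P' : List Bool}
    {I J : List (Fin n)} (hP : P.length = w.length) (hP' : P'.length = w.length)
    (hI : I.length = (unmarked P w).length) (hJ : J.length = (unmarked P' w).length) :
    tensorCoeff (fun b => cornerMatrix (n + 1) (x b)) w (fill P I) (fill P' J) =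
      if P = P' then tensorCoeff x (unmarked P w) I J else 0 := by
  induction w generalizing P P' I J with
  | nil =>
    obtain rfl : P = [] := by simpa using hP
    obtain rfl : P' = [] := by simpa using hP'
    obtain rfl : I = [] := by simpa [unmarked] using hI
    obtain rfl : J = [] := by simpa [unmarked] using hJ
    simp [fill, unmarked, tensorCoeff]
  | cons b w ih =>
    obtain ⟨p, P, rfl⟩ := List.exists_cons_of_length_eq_add_one hP
    obtain ⟨p', P', rfl⟩ := List.exists_cons_of_length_eq_add_one hP'
    have hP1 : P.length = w.length := by simpa using hP
    have hP2 : P'.length = w.length := by simpa using hP'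
    cases p <;> cases p'
    · obtain ⟨i, I, rfl⟩ := List.exists_cons_of_length_eq_add_one hI
      obtain ⟨j, J, rfl⟩ := List.exists_cons_of_length_eq_add_one hJ
      simp only [fill, tensorCoeff, cornerMatrix_castSucc_castSucc, unmarked,
        ih hP1 hP2 (by simpa [unmarked] using hI) (by simpa [unmarked] using hJ)]
      simp
    · obtain ⟨i, I, rfl⟩ := List.exists_cons_of_length_eq_add_one hI
      simp [fill, tensorCoeff, cornerMatrix_castSucc_last]
    · obtain ⟨j, J, rfl⟩ := List.exists_cons_of_length_eq_add_one hJ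
      simp [fill, tensorCoeff, cornerMatrix_last_castSucc]
    · simp only [fill, tensorCoeff, cornerMatrix_last_last, unmarked,
        ih hP1 hP2 (by simpa [unmarked] using hI) (by simpa [unmarked] using hJ)]
      simp

theorem coeffSum_corner [Algebra ℂ B] (x : β → Matrix (Fin n) (Fin n) B) {w : List β}
    {P : List Bool} {I : List (Fin n)} (f : List (Fin (n + 1)) → ℂ) (hP : P.length = w.length)
    (hI : I.length = (unmarked P w).length) :
    coeffSum (fun b => cornerMatrix (n + 1) (x b)) w (fill P I) f =
      coeffSum x (unmarked P w) I (fun K => f (fill P K)) := by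
  induction w generalizing P I f with
  | nil =>
    obtain rfl : P = [] := by simpa using hP
    obtain rfl : I = [] := by simpa [unmarked] using hI
    simp [fill, unmarked, coeffSum_nil]
  | cons b w ih =>
    obtain ⟨p, P, rfl⟩ := List.exists_cons_of_length_eq_add_one hP
    have hP1 : P.length = w.length := by simpa using hP
    cases p
    · obtain ⟨i, I, rfl⟩ := List.exists_cons_of_length_eq_add_one hI
      simp only [fill, coeffSum_cons, unmarked, Fin.sum_univ_castSucc,
        cornerMatrix_castSucc_castSucc, cornerMatrix_castSucc_last, zero_mul, add_zero,
        ih _ hP1 (by simpa [unmarked] using hI)]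
    · simp only [fill, coeffSum_cons, unmarked, Fin.sum_univ_castSucc,
        cornerMatrix_last_castSucc, cornerMatrix_last_last, zero_mul, Finset.sum_const_zero,
        one_mul, zero_add, ih _ hP1 (by simpa [unmarked] using hI)]

end fill

theorem starMatrix_cornerMatrix {B : Type} [Ring B] [StarRing B] {n : ℕ}
    (v : Matrix (Fin n) (Fin n) B) (b : Bool) :
    starMatrix (cornerMatrix (n + 1) v) b = cornerMatrix (n + 1) (starMatrix v b) := by
  cases b
  · rfl
  · ext i j
    induction i using Fin.lastCases <;> induction j using Fin.lastCases <;>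
      simp [starMatrix, cornerMatrix_castSucc_castSucc, cornerMatrix_castSucc_last,
        cornerMatrix_last_castSucc, cornerMatrix_last_last]

theorem eq_zero_of_mem_ncSpan_of_length_ne {Γ α : Type} [AddGroup Γ] [DecidableEq α] {w : List Γ}
    {f : List α → ℂ} (hf : f ∈ ncSpan α w) {I : List α} (hI : I.length ≠ w.length) : f I = 0 := by
  induction hf using Submodule.span_induction with
  | mem f hf =>
    obtain ⟨c, hc, rfl⟩ := hf
    exact partVec_eq_zero_of_length_ne c [] I (by rwa [IsNC.length_eq hc])
  | zero => rfl
  | add f g _ _ h1 h2 => rw [Pi.add_apply, h1, h2, add_zero]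
  | smul c f _ h => rw [Pi.smul_apply, h, smul_zero]

theorem apply_map_of_mem_ncSpan {Γ α : Type} [AddGroup Γ] [DecidableEq α] {w : List Γ}
    {f : List α → ℂ} (hf : f ∈ ncSpan α w) {g : α → α} (hg : Function.Injective g) (I : List α) :
    f (I.map g) = f I := by
  induction hf using Submodule.span_induction with
  | mem f hf =>
    obtain ⟨c, hc, rfl⟩ := hf
    exact partVec_map g hg c [] I
  | zero => rfl
  | add f g _ _ h1 h2 => rw [Pi.add_apply, h1, h2, Pi.add_apply]
  | smul c f _ h => rw [Pi.smul_apply, h, Pi.smul_apply]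

theorem exists_mem_ncSpan_map {Γ α α' : Type} [AddGroup Γ] [DecidableEq α] [DecidableEq α']
    {w : List Γ} {f : List α → ℂ} (hf : f ∈ ncSpan α w) {g : α → α'}
    (hg : Function.Injective g) : ∃ F ∈ ncSpan α' w, ∀ I, F (I.map g) = f I := by
  induction hf using Submodule.span_induction with
  | mem f hf =>
    obtain ⟨c, hc, rfl⟩ := hf
    exact ⟨_, partVec_mem_ncSpan hc, partVec_map g hg c []⟩
  | zero => exact ⟨0, zero_mem _, fun I => rfl⟩
  | add f g _ _ h1 h2 =>
    obtain ⟨F, hF, h1⟩ := h1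
    obtain ⟨G, hG, h2⟩ := h2
    exact ⟨F + G, add_mem hF hG, fun I => by rw [Pi.add_apply, h1, h2, Pi.add_apply]⟩
  | smul c f _ h =>
    obtain ⟨F, hF, h⟩ := h
    exact ⟨c • F, Submodule.smul_mem _ c hF, fun I => by rw [Pi.smul_apply, h, Pi.smul_apply]⟩

namespace ReflAlg

variable {n : ℕ} {s : ℕ∞}

/-- The vector `f` is fixed by `H_n^{s+}`, in the tensor power of the fundamental representation
of `H_{n+1}^{s+}` with exponents `w`. The condition is stated with the Haar functional of
`H_n^{s+}`. -/
def IsCornerFixed (s : ℕ∞) (w : List Bool) (f : List (Fin (n + 1)) → ℂ) : Prop :=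
  ∀ I : List (Fin (n + 1)), I.length = w.length →
    haar n s (coeffSum (starMatrix (cornerMatrix (n + 1) (u n s))) w I f) = f I

theorem haar_coeffSum (w : List Bool) (I : List (Fin n)) (f : List (Fin n) → ℂ) :
    haar n s (coeffSum (starMatrix (u n s)) w I f) =
      ∑ K : Coloring (Fin n) (w.map (weight s)).length,
        ncKernel (w.map (weight s)) I K.1 * f K.1 := by
  have h : haar n s (coeffSum (starMatrix (u n s)) w I f) =
      ∑ K : Coloring (Fin n) w.length, ncKernel (w.map (weight s)) I K.1 * f K.1 := by
    simp only [coeffSum, map_sum, map_smul, smul_eq_mul, mul_comm (f _)]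
    exact Finset.sum_congr rfl fun K _ => congrArg (· * _) (haar_coeff w I K.1)
  rw [h, List.length_map]

theorem IsCornerFixed.exists_mem_ncSpan {w : List Bool} {f : List (Fin (n + 1)) → ℂ}
    (hf : IsCornerFixed s w f) {P : List Bool} (hP : P.length = w.length) :
    ∃ g ∈ ncSpan (Fin n) ((unmarked P w).map (weight s)),
      ∀ I, I.length = (unmarked P w).length → g I = f (fill P I) := by
  obtain ⟨g, hg, h⟩ := mem_of_sum_ncKernel_mul (w := (unmarked P w).map (weight s))
    (f := fun I : List (Fin n) => f (fill P I)) (by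
      intro I hI
      have hI' : I.length = (unmarked P w).length := by simpa using hI
      refine (haar_coeffSum _ I fun K => f (fill P K)).symm.trans ?_
      have hx : starMatrix (cornerMatrix (n + 1) (u n s)) =
          fun b => cornerMatrix (n + 1) (starMatrix (u n s) b) :=
        funext (starMatrix_cornerMatrix (u n s))
      rw [← coeffSum_corner _ _ hP hI', ← hf _ (length_fill hP hI'), hx])
  exact ⟨g, hg, fun I hI => h I (by simpa using hI)⟩

theorem isCornerFixed_of_mem_ncSpan {w : List Bool} {f : List (Fin (n + 1)) → ℂ}
    (hf : f ∈ ncSpan (Fin (n + 1)) (w.map (weight s))) : IsCornerFixed s w f := by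
  intro I hI
  have hv : IsQuantumReflection s (cornerMatrix (n + 1) (u n s)) :=
    IsQuantumReflection.corner (N := n + 1) (isQuantumReflection_u n s)
  rw [hv.coeffSum_eq hf hI, map_smul, haar_one, smul_eq_mul, mul_one]

theorem IsCornerFixed.sub {w : List Bool} {f g : List (Fin (n + 1)) → ℂ}
    (hf : IsCornerFixed s w f) (hg : IsCornerFixed s w g) : IsCornerFixed s w (f - g) := by
  intro I hI
  rw [sub_eq_add_neg, ← neg_one_smul ℂ g, coeffSum_add, coeffSum_smul, map_add, map_smul, hf I hI,
    hg I hI]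
  rfl

/-- The transposition of the last two letters. -/
def lastSwap (m : ℕ) : Equiv.Perm (Fin (m + 2)) :=
  Equiv.swap (Fin.last m).castSucc (Fin.last (m + 1))

/-- A vector which is fixed by `H_{N-1}^{s+}` and by a transposition which moves the last letter is
a combination of noncrossing partitions. After subtraction of such a combination, the vector
vanishes on the words without the last letter, and then, by the transposition, on the words
without the last but one letter. Since noncrossing partitions are independent on the remaining
letters, it vanishes. -/
theorem IsCornerFixed.exists_mem_ncSpan_of_lastSwap {m : ℕ} (hm : 4 ≤ m) {w : List Bool}
    {f : List (Fin (m + 2)) → ℂ} (hf : IsCornerFixed s w f)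
    (hτ : ∀ I : List (Fin (m + 2)), I.length = w.length → f (I.map (lastSwap m)) = f I) :
    ∃ F ∈ ncSpan (Fin (m + 2)) (w.map (weight s)),
      ∀ I, I.length = w.length → F I = f I := by
  obtain ⟨g, hg, hgf⟩ := hf.exists_mem_ncSpan (P := List.replicate w.length false) (by simp)
  rw [unmarked_replicate_false] at hg hgf
  obtain ⟨F, hF, hFg⟩ := exists_mem_ncSpan_map hg (Fin.castSucc_injective (m + 1))
  refine ⟨F, hF, fun I hI => ?_⟩
  have hd := hf.sub (isCornerFixed_of_mem_ncSpan hF)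
  have hd0 : ∀ I : List (Fin (m + 1)), I.length = w.length →
      (f - F) (I.map Fin.castSucc) = 0 := by
    intro I hI
    rw [Pi.sub_apply, hFg, hgf I hI, ← hI, fill_replicate_false, sub_self]
  have hdτ : ∀ I : List (Fin (m + 2)), I.length = w.length →
      (f - F) (I.map (lastSwap m)) = (f - F) I := by
    intro I hI
    rw [Pi.sub_apply, hτ I hI, apply_map_of_mem_ncSpan hF (lastSwap m).injective, Pi.sub_apply]
  obtain ⟨P, I', hP, hI', rfl⟩ := exists_eq_fill w hI
  obtain ⟨h, hh, hhd⟩ := hd.exists_mem_ncSpan hP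
  have h0 : h = 0 := by
    -- The letters other than the last two of the `m + 2` letters.
    let ι : Fin 4 → Fin (m + 1) := fun i => (i.castLE hm).castSucc
    refine eq_zero_of_vanish hh ι
      ((Fin.castSucc_injective m).comp (Fin.castLE_injective hm)) fun J => ?_
    by_cases hJ : (J.map ι).length = (unmarked P w).length
    · rw [hhd _ hJ, ← hdτ _ (length_fill hP hJ)]
      -- On the letters which occur, the transposition takes values without the last letter.
      let σ : Fin (m + 2) → Fin (m + 1) := Fin.lastCases (Fin.last m) id
      rw [fill_map P _ (lastSwap m) σ]
      · exact hd0 _ (by rw [List.length_map, length_fill hP hJ])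
      · simp [σ, lastSwap]
      · intro i hi
        obtain ⟨k, -, rfl⟩ := List.mem_map.mp hi
        have h1 : (ι k).castSucc ≠ Fin.last (m + 1) := (Fin.castSucc_lt_last _).ne
        have h2 : (ι k).castSucc ≠ (Fin.last m).castSucc := by
          intro h
          exact (Fin.castSucc_lt_last _).ne (Fin.castSucc_injective _ h)
        rw [lastSwap, Equiv.swap_apply_of_ne_of_ne h2 h1]
        simp [σ]
    · exact eq_zero_of_mem_ncSpan_of_length_ne hh (by simpa using hJ)
  have := hhd I' hI'
  rw [h0] at this
  exact (sub_eq_zero.mp this.symm).symm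

end ReflAlg

/-! ### The ergodic theorem -/

section ergodic

variable {ι : Type} [Fintype ι] [DecidableEq ι]

open Filter Topology in
/-- The averages of the powers of the mean of a projection and a unitary converge to the projection
onto the vectors fixed by both. -/
theorem tendsto_average_pow {K : Submodule ℂ (ι → ℂ)} {P A U : Matrix ι ι ℂ}
    (hP : IsOrthProj K P) (hA : IsStarProjection A)
    (hU : U ∈ unitary (Matrix ι ι ℂ)) (hK : ∀ f, f ∈ K ↔ A *ᵥ f = f ∧ U *ᵥ f = f) (i j : ι) :
    Tendsto (fun m : ℕ => (m : ℂ)⁻¹ * ∑ k ∈ Finset.range m, (((2 : ℂ)⁻¹ • (A + U)) ^ k) i j) atTop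
      (𝓝 (P i j)) := by
  have : Nonempty ι := ⟨i⟩
  have : Nontrivial (EuclideanSpace ℂ ι →L[ℂ] EuclideanSpace ℂ ι) := inferInstance
  let Φ := Matrix.toEuclideanCLM (n := ι) (𝕜 := ℂ)
  let Q : Matrix ι ι ℂ := (2 : ℂ)⁻¹ • (A + U)
  have hΦ : ∀ M f, Φ M f = WithLp.toLp 2 (M *ᵥ f.ofLp) := fun M f => rfl
  have hA1 : ‖Φ A‖ ≤ 1 := IsStarProjection.norm_le _ (hA.map Φ)
  have hU1 : Φ U ∈ unitary (EuclideanSpace ℂ ι →L[ℂ] EuclideanSpace ℂ ι) := by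
    rw [Unitary.mem_iff] at hU ⊢
    rw [← map_star, ← map_mul, ← map_mul, hU.1, hU.2, map_one]
    exact ⟨rfl, rfl⟩
  have hU2 : ‖Φ U‖ = 1 := CStarRing.norm_of_mem_unitary hU1
  have hQ : Φ Q = (2 : ℂ)⁻¹ • (Φ A + Φ U) := by rw [map_smul, map_add]
  have hQ1 : ‖Φ Q‖ ≤ 1 := by
    rw [hQ, norm_smul]
    have := norm_add_le (Φ A) (Φ U)
    norm_num
    linarith
  have hfix : ∀ f, Φ Q f = f ↔ f.ofLp ∈ K := by
    intro f
    rw [hK]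
    constructor
    · intro h
      -- A fixed vector of the mean of two contractions is fixed by both, by strict convexity.
      have h2 : Φ A f + Φ U f = (2 : ℂ) • f := by
        rw [hQ] at h
        nth_rw 3 [← h]
        simp
      have ha : ‖Φ A f‖ ≤ ‖f‖ := by simpa using (Φ A).le_of_opNorm_le hA1 f
      have hu : ‖Φ U f‖ ≤ ‖f‖ := by simpa using (Φ U).le_of_opNorm_le hU2.le f
      have h3 : ‖Φ A f + Φ U f‖ = 2 * ‖f‖ := by rw [h2, norm_smul]; norm_num
      have h4 := norm_add_le (Φ A f) (Φ U f)
      have h5 : Φ A f = Φ U f :=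
        eq_of_norm_eq_of_norm_add_eq (by linarith) (by linarith)
      have h6 : Φ U f = f := by
        rw [h5, ← two_smul ℂ] at h2
        exact smul_right_injective _ two_ne_zero h2
      exact ⟨congrArg WithLp.ofLp (h5.trans h6), congrArg WithLp.ofLp h6⟩
    · rintro ⟨h1, h2⟩
      have h1' : Φ A f = f := by rw [hΦ, h1]
      have h2' : Φ U f = f := by rw [hΦ, h2]
      rw [hQ, _root_.smul_apply, _root_.add_apply, h1', h2',
        ← two_smul ℂ, smul_smul]
      norm_num
  have hlim := (Φ Q).tendsto_birkhoffAverage_orthogonalProjection hQ1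
    (WithLp.toLp 2 (Pi.single j 1))
  have hproj : ((Φ Q).eqLocus
      (1 : EuclideanSpace ℂ ι →L[ℂ] EuclideanSpace ℂ ι)).starProjection
        (WithLp.toLp 2 (Pi.single j 1)) = WithLp.toLp 2 (P *ᵥ Pi.single j 1) := by
    refine Submodule.eq_starProjection_of_mem_of_inner_eq_zero ?_ fun g hg => ?_
    · change Φ Q _ = _
      exact (hfix _).mpr (hP.mulVec_mem _)
    · have hg' : P *ᵥ g.ofLp = g.ofLp := hP.mulVec_eq _ ((hfix g).mp hg)
      rw [EuclideanSpace.inner_eq_star_dotProduct]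
      simp only [WithLp.ofLp_sub, star_sub, dotProduct_sub]
      rw [star_mulVec, hP.conjTranspose_eq]
      rw [dotProduct_comm _ (star (Pi.single j (1 : ℂ)) ᵥ* P), ← dotProduct_mulVec, hg',
        dotProduct_comm, sub_self]
  have hcoord := ((EuclideanSpace.proj i : EuclideanSpace ℂ ι →L[ℂ] ℂ).continuous.tendsto _).comp
    hlim
  have hlim' : (EuclideanSpace.proj i : EuclideanSpace ℂ ι →L[ℂ] ℂ)
      ((((Φ Q).eqLocus (1 : EuclideanSpace ℂ ι →L[ℂ] EuclideanSpace ℂ ι)).orthogonalProjectionOnto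
        (WithLp.toLp 2 (Pi.single j 1)) : _) : EuclideanSpace ℂ ι) = P i j := by
    change (((Φ Q).eqLocus
      (1 : EuclideanSpace ℂ ι →L[ℂ] EuclideanSpace ℂ ι)).starProjection
        (WithLp.toLp 2 (Pi.single j 1))).ofLp i = _
    rw [hproj]
    simp
  rw [hlim'] at hcoord
  refine hcoord.congr fun m => ?_
  have hpow : ∀ k, (Φ Q)^[k] (WithLp.toLp 2 (Pi.single j 1)) =
      WithLp.toLp 2 (Q ^ k *ᵥ Pi.single j 1) := by
    intro k
    induction k with
    | zero => rw [pow_zero, Matrix.one_mulVec]; rfl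
    | succ k ih => rw [Function.iterate_succ_apply', ih, hΦ, mulVec_mulVec, ← pow_succ']
  simp only [Function.comp, birkhoffAverage, birkhoffSum, hpow, id, map_smul, map_sum, smul_eq_mul]
  congr 1
  refine Finset.sum_congr rfl fun k _ => ?_
  simp [Q]

end ergodic

/-- The convolution powers of a functional on a coalgebra. -/
def convPow {A : Type} [Ring A] [HopfAlgebra ℂ A] (φ : A →ₗ[ℂ] ℂ) : ℕ → A →ₗ[ℂ] ℂ
  | 0 => Coalgebra.counit
  | k + 1 => LinearMap.mul' ℂ ℂ ∘ₗ TensorProduct.map φ (convPow φ k) ∘ₗ Coalgebra.comul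

/-- The coefficients of tensor powers of the matrix of a map `σ` of the letters. -/
theorem tensorCoeff_perm {β α B : Type} [DecidableEq α] [Ring B] (σ : α → α) (w : List β)
    {I J : List α} (hI : I.length = w.length) (hJ : J.length = w.length) :
    tensorCoeff (fun _ => Matrix.of fun i j => if σ j = i then (1 : B) else 0) w I J =
      if J.map σ = I then 1 else 0 := by
  induction w generalizing I J with
  | nil =>
    obtain rfl : I = [] := by simpa using hI
    obtain rfl : J = [] := by simpa using hJ
    simp [tensorCoeff]
  | cons b w ih =>
    obtain ⟨i, I, rfl⟩ := List.exists_cons_of_length_eq_add_one hI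
    obtain ⟨j, J, rfl⟩ := List.exists_cons_of_length_eq_add_one hJ
    simp only [tensorCoeff, ih (by simpa using hI) (by simpa using hJ), Matrix.of_apply,
      List.map_cons, List.cons.injEq, ite_and, ite_mul, one_mul, zero_mul]

namespace ReflAlg

variable {N : ℕ} {s : ℕ∞}

theorem counit_coeff (w : List Bool) {I J : List (Fin N)} (hI : I.length = w.length)
    (hJ : J.length = w.length) :
    Coalgebra.counit (R := ℂ) (coeff N s w I J) = if I = J then 1 else 0 := by
  have h : (fun b => (starMatrix (u N s) b).map (counitHom N s)) =
      fun _ => Matrix.of fun i j => if id j = i then (1 : ℂ) else 0 := by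
    funext b
    ext i j
    cases b
    · exact (counitHom_u i j).trans (by simp [eq_comm])
    · exact (counitHom_star_u i j).trans (by simp [eq_comm])
  rw [counit_eq, coeff, map_tensorCoeff, h, tensorCoeff_perm id w hI hJ]
  simp [eq_comm]

/-- The matrix with entries `φ (coeff N s w I J)`. -/
def coeffMatrix (φ : ReflAlg N s →ₗ[ℂ] ℂ) (w : List Bool) :
    Matrix (Coloring (Fin N) w.length) (Coloring (Fin N) w.length) ℂ :=
  Matrix.of fun I J => φ (coeff N s w I.1 J.1)

/-- On the coefficients of a corepresentation, convolution is the multiplication of matrices. -/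
theorem convPow_coeff (φ : ReflAlg N s →ₗ[ℂ] ℂ) (w : List Bool) (k : ℕ)
    (I J : Coloring (Fin N) w.length) :
    convPow φ k (coeff N s w I.1 J.1) = (coeffMatrix φ w ^ k) I J := by
  induction k generalizing I J with
  | zero =>
    rw [convPow, counit_coeff w I.2 J.2, pow_zero, Matrix.one_apply]
    simp only [Subtype.ext_iff]
  | succ k ih =>
    rw [pow_succ', Matrix.mul_apply]
    simp only [convPow, LinearMap.comp_apply, comul_coeff, map_sum, TensorProduct.map_tmul,
      LinearMap.mul'_apply, ih]
    rfl

/-- If the convolution powers of `φ` are, on the coefficients, powers of means of a projection and a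
unitary whose common fixed vectors are the combinations of noncrossing partitions, then an
element on which the convolution powers take a constant value has that value as its Haar
integral. -/
theorem haar_eq_of_convPow_eq {φ : ReflAlg N s →ₗ[ℂ] ℂ}
    (hφ : ∀ w : List Bool, ∃ A U : Matrix (Coloring (Fin N) w.length) (Coloring (Fin N) w.length) ℂ,
      IsStarProjection A ∧ U ∈ unitary (Matrix _ _ ℂ) ∧ coeffMatrix φ w = (2 : ℂ)⁻¹ • (A + U) ∧
      ∀ f, f ∈ (ncSpan (Fin N) (w.map (weight s))).map (restrictLength (Fin N) w.length) ↔
        A *ᵥ f = f ∧ U *ᵥ f = f)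
    {z : ReflAlg N s} {c : ℂ} (hz : ∀ k, convPow φ k z = c) : haar N s z = c := by
  have hlim : ∀ a : ReflAlg N s, Filter.Tendsto
      (fun m : ℕ => (m : ℂ)⁻¹ * ∑ k ∈ Finset.range m, convPow φ k a) Filter.atTop
      (nhds (haar N s a)) := by
    intro a
    have ha := mem_span_coeff a
    induction ha using Submodule.span_induction with
    | mem a ha =>
      obtain ⟨w, I, J, hI, hJ, rfl⟩ := ha
      obtain ⟨A, U, hA, hU, hQ, hK⟩ := hφ w
      have hl : (w.map (weight s)).length = w.length := List.length_map _
      have hP : IsOrthProj ((ncSpan (Fin N) (w.map (weight s))).map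
          (restrictLength (Fin N) w.length))
          (Matrix.of fun I J => ncKernel (w.map (weight s)) I.1 J.1) := by
        have h := isOrthProj_ncProj (α := Fin N) (w.map (weight s))
        have h' : ncProj (Fin N) (w.map (weight s)) =
            Matrix.of fun I J => ncKernel (w.map (weight s)) I.1 J.1 := by
          ext I J
          exact (ncKernel_of_length I.2 J.2).symm
        rw [h'] at h
        rw [← hl]
        exact h
      have h := tendsto_average_pow hP hA hU hK ⟨I, hI⟩ ⟨J, hJ⟩
      rw [haar_coeff]
      refine h.congr fun m => ?_
      rw [← hQ]
      congr 1
      exact Finset.sum_congr rfl fun k _ => (convPow_coeff φ w k ⟨I, hI⟩ ⟨J, hJ⟩).symm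
    | zero => simp
    | add a b _ _ h1 h2 =>
      rw [map_add]
      refine (h1.add h2).congr fun m => ?_
      rw [← mul_add, ← Finset.sum_add_distrib]
      simp only [map_add]
    | smul c a _ h =>
      rw [map_smul]
      refine (h.const_mul c).congr fun m => ?_
      simp only [map_smul, smul_eq_mul, ← Finset.mul_sum]
      ring
  refine tendsto_nhds_unique (hlim z) (tendsto_const_nhds.congr' ?_)
  filter_upwards [Filter.eventually_gt_atTop 0] with m hm
  have : (m : ℂ) ≠ 0 := Nat.cast_ne_zero.mpr hm.ne'
  simp [hz, this]

section corner

variable {n : ℕ}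

theorem cornerHom_coeff (w : List Bool) (I J : List (Fin (n + 1))) :
    cornerHom (n + 1) s (coeff (n + 1) s w I J) =
      tensorCoeff (starMatrix (cornerMatrix (n + 1) (u n s))) w I J := by
  have h : (fun b => (starMatrix (u (n + 1) s) b).map (cornerHom (n + 1) s)) =
      starMatrix (cornerMatrix (n + 1) (u n s)) := by
    funext b
    ext i j
    cases b
    · exact cornerHom_u i j
    · exact (cornerHom_star _).trans (congrArg star (cornerHom_u i j))
  rw [coeff, map_tensorCoeff, h]

/-- The projection onto the vectors fixed by `H_n^{s+}`. -/
def cornerProj (n : ℕ) (s : ℕ∞) (w : List Bool) :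
    Matrix (Coloring (Fin (n + 1)) w.length) (Coloring (Fin (n + 1)) w.length) ℂ :=
  Matrix.of fun I J =>
    haar n s (tensorCoeff (starMatrix (cornerMatrix (n + 1) (u n s))) w I.1 J.1)

theorem haar_tensorCoeff_corner {w : List Bool} {P P' : List Bool} {I J : List (Fin n)}
    (hP : P.length = w.length) (hP' : P'.length = w.length)
    (hI : I.length = (unmarked P w).length) (hJ : J.length = (unmarked P' w).length) :
    haar n s (tensorCoeff (starMatrix (cornerMatrix (n + 1) (u n s))) w (fill P I) (fill P' J)) =
      if P = P' then ncKernel ((unmarked P w).map (weight s)) I J else 0 := by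
  have hx : starMatrix (cornerMatrix (n + 1) (u n s)) =
      fun b => cornerMatrix (n + 1) (starMatrix (u n s) b) :=
    funext (starMatrix_cornerMatrix (u n s))
  rw [hx, tensorCoeff_corner _ hP hP' hI hJ, ← haar_coeff]
  split_ifs
  · rfl
  · exact map_zero _

theorem cornerProj_mulVec (w : List Bool) (f : List (Fin (n + 1)) → ℂ)
    (I : Coloring (Fin (n + 1)) w.length) :
    (cornerProj n s w *ᵥ fun K => f K.1) I =
      haar n s (coeffSum (starMatrix (cornerMatrix (n + 1) (u n s))) w I.1 f) := by
  simp only [coeffSum, map_sum, map_smul, smul_eq_mul, mul_comm (f _)]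
  rfl

theorem isStarProjection_cornerProj (w : List Bool) : IsStarProjection (cornerProj n s w) := by
  constructor
  · ext I J
    obtain ⟨P', J', hP', hJ', hJ⟩ := exists_eq_fill w J.2
    have key : ∀ I, I.length = w.length →
        haar n s (coeffSum (starMatrix (cornerMatrix (n + 1) (u n s))) w I fun K =>
          haar n s (tensorCoeff (starMatrix (cornerMatrix (n + 1) (u n s))) w K (fill P' J'))) =
        haar n s (tensorCoeff (starMatrix (cornerMatrix (n + 1) (u n s))) w I (fill P' J')) := by
      intro I hI
      obtain ⟨P, I', hP, hI', rfl⟩ := exists_eq_fill w hI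
      have hx : starMatrix (cornerMatrix (n + 1) (u n s)) =
          fun b => cornerMatrix (n + 1) (starMatrix (u n s) b) :=
        funext (starMatrix_cornerMatrix (u n s))
      rw [haar_tensorCoeff_corner hP hP' hI' hJ']
      conv_lhs => rw [hx, coeffSum_corner _ _ hP hI', ← hx]
      by_cases hPP : P = P'
      · subst hPP
        obtain ⟨g, hg, h⟩ := exists_ncKernel_eq (α := Fin n) ((unmarked P w).map (weight s)) J'
        rw [if_pos rfl, h I' (by simpa using hI'), ← sum_ncKernel_mul hg (by simpa using hI'),
          ← haar_coeffSum]
        refine congrArg _ (coeffSum_congr _ _ fun K hK => ?_)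
        rw [haar_tensorCoeff_corner hP hP' hK hJ', if_pos rfl, h K (by simpa using hK)]
      · rw [if_neg hPP, coeffSum_congr (g := 0) _ _ fun K hK => ?_, coeffSum_zero, map_zero]
        rw [haar_tensorCoeff_corner hP hP' hK hJ', if_neg hPP]
        rfl
    refine Eq.trans ?_ (key I.1 I.2) |>.trans ?_
    · rw [← cornerProj_mulVec, ← hJ]
      rfl
    · rw [← hJ]
      rfl
  · rw [IsSelfAdjoint, star_eq_conjTranspose]
    ext I J
    obtain ⟨P, I', hP, hI', hI⟩ := exists_eq_fill w I.2
    obtain ⟨P', J', hP', hJ', hJ⟩ := exists_eq_fill w J.2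
    change star (haar n s (tensorCoeff _ w J.1 I.1)) = haar n s (tensorCoeff _ w I.1 J.1)
    rw [hI, hJ, haar_tensorCoeff_corner hP hP' hI' hJ', haar_tensorCoeff_corner hP' hP hJ' hI',
      apply_ite star, ncKernel_star, star_zero]
    by_cases hPP : P = P'
    · subst hPP
      rfl
    · rw [if_neg hPP, if_neg (Ne.symm hPP)]

end corner

section mean

variable {m : ℕ}

/-- The mean of the Haar functional of `H_{N-1}^{s+}` and of the evaluation at a transposition which
moves the last letter, as a functional on `𝒜(H_N^{s+})`, where `N = m + 2`. -/
def meanFunctional (m : ℕ) (s : ℕ∞) : ReflAlg (m + 2) s →ₗ[ℂ] ℂ :=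
  (2 : ℂ)⁻¹ • (haar (m + 2 - 1) s ∘ₗ
      (cornerHom (m + 2) s : ReflAlg (m + 2) s →ₗ[ℂ] ReflAlg (m + 2 - 1) s) +
    (FunAlg.eval (lastSwap m)).toLinearMap ∘ₗ
      (symHom (m + 2) s : ReflAlg (m + 2) s →ₗ[ℂ] FunAlg (Equiv.Perm (Fin (m + 2)))))

theorem meanFunctional_apply (a : ReflAlg (m + 2) s) : meanFunctional m s a =
    2⁻¹ * (haar (m + 1) s (cornerHom (m + 2) s a) +
      FunAlg.eval (lastSwap m) (symHom (m + 2) s a)) := rfl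

theorem eval_symHom_coeff (σ : Equiv.Perm (Fin N)) (w : List Bool) {I J : List (Fin N)}
    (hI : I.length = w.length) (hJ : J.length = w.length) :
    FunAlg.eval σ (symHom N s (coeff N s w I J)) = if J.map σ = I then 1 else 0 := by
  have h : (fun b => ((starMatrix (u N s) b).map (symHom N s)).map (FunAlg.eval σ)) =
      fun _ => Matrix.of fun i j => if σ j = i then (1 : ℂ) else 0 := by
    funext b
    ext i j
    cases b
    · exact congrArg (FunAlg.eval σ) (symHom_u i j)
    · change FunAlg.eval σ (symHom N s (star (u N s i j))) = _
      rw [symHom_star, symHom_u, FunAlg.eval_star, eval_permMatrix, Matrix.of_apply,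
        apply_ite star, star_one, star_zero]
  rw [coeff, map_tensorCoeff, map_tensorCoeff, h, tensorCoeff_perm σ w hI hJ]

theorem coeffMatrix_meanFunctional (hm : 4 ≤ m) (w : List Bool) :
    ∃ A U : Matrix (Coloring (Fin (m + 2)) w.length) (Coloring (Fin (m + 2)) w.length) ℂ,
      IsStarProjection A ∧ U ∈ unitary (Matrix _ _ ℂ) ∧
      coeffMatrix (meanFunctional m s) w = (2 : ℂ)⁻¹ • (A + U) ∧
      ∀ f, f ∈ (ncSpan (Fin (m + 2)) (w.map (weight s))).map
          (restrictLength (Fin (m + 2)) w.length) ↔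
        A *ᵥ f = f ∧ U *ᵥ f = f := by
  have hinv : ∀ I : List (Fin (m + 2)), (I.map (lastSwap m)).map (lastSwap m) = I := by
    intro I
    rw [List.map_map]
    have : lastSwap m ∘ lastSwap m = id := by
      funext i
      exact Equiv.swap_apply_self _ _ i
    rw [this, List.map_id]
  let t : Coloring (Fin (m + 2)) w.length → Coloring (Fin (m + 2)) w.length :=
    fun I => ⟨I.1.map (lastSwap m), by simp [I.2]⟩
  have ht : ∀ I, t (t I) = I := fun I => Subtype.ext (hinv I.1)
  let U : Matrix (Coloring (Fin (m + 2)) w.length) (Coloring (Fin (m + 2)) w.length) ℂ :=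
    Matrix.of fun I J => if t I = J then 1 else 0
  have hU : ∀ f, U *ᵥ f = f ∘ t := by
    intro f
    funext I
    simp [U, Matrix.mulVec, dotProduct]
  have hUU : U * U = 1 := by
    ext I J
    rw [Matrix.mul_apply, Finset.sum_eq_single (t I)]
    · simp [U, ht, Matrix.one_apply]
    · intro K _ hK
      simp [U, hK.symm]
    · simp
  have hUs : star U = U := by
    ext I J
    have : t J = I ↔ t I = J := ⟨fun h => by rw [← h, ht], fun h => by rw [← h, ht]⟩
    simp [U, Matrix.star_apply, this]
  refine ⟨cornerProj (m + 1) s w, U, isStarProjection_cornerProj w, ?_, ?_, fun f => ?_⟩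
  · rw [Unitary.mem_iff, hUs]
    exact ⟨hUU, hUU⟩
  · ext I J
    change meanFunctional m s (coeff (m + 2) s w I.1 J.1) = 2⁻¹ * (_ + _)
    rw [meanFunctional_apply, eval_symHom_coeff _ _ I.2 J.2, cornerHom_coeff]
    congr 2
    refine if_congr ?_ rfl rfl
    rw [Subtype.ext_iff]
    constructor
    · intro h
      change I.1.map (lastSwap m) = J.1
      rw [← h, hinv]
    · intro h
      rw [← h]
      exact hinv I.1
  · constructor
    · rintro ⟨g, hg, rfl⟩
      constructor
      · funext I
        exact (cornerProj_mulVec w g I).trans (isCornerFixed_of_mem_ncSpan hg I.1 I.2)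
      · rw [hU]
        funext I
        exact apply_map_of_mem_ncSpan hg (lastSwap m).injective I.1
    · rintro ⟨h1, h2⟩
      let f' : List (Fin (m + 2)) → ℂ := fun I => if h : I.length = w.length then f ⟨I, h⟩ else 0
      have hf' : ∀ I : Coloring (Fin (m + 2)) w.length, f' I.1 = f I := fun I => dif_pos I.2
      have hf : (fun K : Coloring (Fin (m + 2)) w.length => f' K.1) = f := funext hf'
      have hc : IsCornerFixed s w f' := by
        intro I hI
        rw [← cornerProj_mulVec w f' ⟨I, hI⟩, hf, h1, ← hf']
      obtain ⟨F, hF, h⟩ := hc.exists_mem_ncSpan_of_lastSwap hm fun I hI => by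
        have := congrFun h2 ⟨I, hI⟩
        rw [hU, ← hf', Function.comp_apply, ← hf'] at this
        exact this
      exact ⟨F, hF, funext fun I => (h I.1 I.2).trans (hf' I)⟩

/-- An element on which the convolution powers of `meanFunctional` take a constant value has that
value as its Haar integral. -/
theorem haar_eq_of_convPow_meanFunctional (hm : 4 ≤ m) {z : ReflAlg (m + 2) s} {c : ℂ}
    (hz : ∀ k, convPow (meanFunctional m s) k z = c) : haar (m + 2) s z = c :=
  haar_eq_of_convPow_eq (coeffMatrix_meanFunctional hm) hz

end mean

end ReflAlg

/-! ### Matrices of comodules -/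

section basis

variable {ι V M : Type} [AddCommGroup V] [Module ℂ V] [AddCommGroup M] [Module ℂ M]
  (b : Module.Basis ι ℂ V)

/-- The coordinate of an element of `V ⊗ M` with respect to a basis of `V`. -/
def tensorCoord (i : ι) : V ⊗[ℂ] M →ₗ[ℂ] M :=
  (TensorProduct.lid ℂ M).toLinearMap ∘ₗ (b.coord i).rTensor M

theorem tensorCoord_tmul (i : ι) (v : V) (x : M) :
    tensorCoord b i (v ⊗ₜ[ℂ] x) = b.repr v i • x := by
  simp [tensorCoord]

theorem sum_tmul_tensorCoord [Fintype ι] (x : V ⊗[ℂ] M) : ∑ i, b i ⊗ₜ[ℂ] tensorCoord b i x = x := by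
  induction x with
  | zero => simp
  | add x y hx hy => simp only [map_add, TensorProduct.tmul_add, Finset.sum_add_distrib, hx, hy]
  | tmul v x =>
    simp only [tensorCoord_tmul, ← TensorProduct.smul_tmul]
    rw [← TensorProduct.sum_tmul, b.sum_repr]

theorem tensorCoord_sum_tmul [Fintype ι] [DecidableEq ι] (i : ι) (x : ι → M) :
    tensorCoord b i (∑ k, b k ⊗ₜ[ℂ] x k) = x i := by
  simp [tensorCoord_tmul, Finsupp.single_apply]

end basis

namespace ComoduleStr

variable {A V W ι κ : Type} [Ring A] [HopfAlgebra ℂ A] [AddCommGroup V] [Module ℂ V]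
  [AddCommGroup W] [Module ℂ W] [Fintype ι] [Fintype κ]

/-- The matrix of a coaction with respect to a basis. -/
def toMatrix (ρ : ComoduleStr A V) (b : Module.Basis ι ℂ V) : Matrix ι ι A :=
  Matrix.of fun i j => tensorCoord b i (ρ.coact (b j))

theorem coact_basis (ρ : ComoduleStr A V) (b : Module.Basis ι ℂ V) (j : ι) :
    ρ.coact (b j) = ∑ i, b i ⊗ₜ[ℂ] ρ.toMatrix b i j :=
  (sum_tmul_tensorCoord b _).symm

theorem comul_toMatrix [DecidableEq ι] (ρ : ComoduleStr A V) (b : Module.Basis ι ℂ V) (i j : ι) :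
    Coalgebra.comul (R := ℂ) (ρ.toMatrix b i j) =
      ∑ k, ρ.toMatrix b i k ⊗ₜ[ℂ] ρ.toMatrix b k j := by
  have h := LinearMap.congr_fun ρ.coassoc (b j)
  simp only [LinearMap.comp_apply, coact_basis, map_sum, LinearMap.rTensor_tmul,
    LinearMap.lTensor_tmul, TensorProduct.sum_tmul, LinearEquiv.coe_coe,
    TensorProduct.assoc_tmul] at h
  rw [Finset.sum_comm] at h
  simp only [← TensorProduct.tmul_sum] at h
  have h' := congrArg (tensorCoord b i) h
  rw [tensorCoord_sum_tmul, tensorCoord_sum_tmul] at h'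
  exact h'.symm

theorem counit_toMatrix [DecidableEq ι] (ρ : ComoduleStr A V) (b : Module.Basis ι ℂ V) (i j : ι) :
    Coalgebra.counit (R := ℂ) (ρ.toMatrix b i j) = if i = j then 1 else 0 := by
  have h := LinearMap.congr_fun ρ.counit (b j)
  simp only [LinearMap.comp_apply, coact_basis, map_sum, LinearMap.lTensor_tmul,
    LinearEquiv.coe_coe, TensorProduct.rid_tmul, LinearMap.id_apply] at h
  have h' := congrArg (fun v => b.repr v i) h
  simpa [Finsupp.single_apply, eq_comm] using h'

theorem toMatrix_restrict [DecidableEq ι] {B : Type} [Ring B] [HopfAlgebra ℂ B]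
    (ρ : ComoduleStr A V) (b : Module.Basis ι ℂ V) (π : A →ₐc[ℂ] B) :
    (ρ.restrict π).toMatrix b = (ρ.toMatrix b).map π := by
  ext i j
  change tensorCoord b i ((π : A →ₗ[ℂ] B).lTensor V (ρ.coact (b j))) = π (ρ.toMatrix b i j)
  rw [coact_basis, map_sum]
  simp only [LinearMap.lTensor_tmul]
  exact tensorCoord_sum_tmul b i _

theorem mem_hom_iff [DecidableEq ι] [DecidableEq κ] (ρ : ComoduleStr A V) (σ : ComoduleStr A W)
    (b : Module.Basis ι ℂ V) (c : Module.Basis κ ℂ W) (T : V →ₗ[ℂ] W) :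
    T ∈ ρ.hom σ ↔ σ.toMatrix c * (LinearMap.toMatrix b c T).map (algebraMap ℂ A) =
      (LinearMap.toMatrix b c T).map (algebraMap ℂ A) * ρ.toMatrix b := by
  have hT : ∀ j, T (b j) = ∑ i, LinearMap.toMatrix b c T i j • c i := by
    intro j
    simp only [LinearMap.toMatrix_apply]
    exact (c.sum_repr _).symm
  have h1 : ∀ j, σ.coact (T (b j)) = ∑ k, c k ⊗ₜ[ℂ]
      (σ.toMatrix c * (LinearMap.toMatrix b c T).map (algebraMap ℂ A)) k j := by
    intro j
    simp only [hT, map_sum, map_smul, coact_basis, Matrix.mul_apply, Matrix.map_apply,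
      TensorProduct.tmul_sum, Finset.smul_sum]
    rw [Finset.sum_comm]
    refine Finset.sum_congr rfl fun k _ => Finset.sum_congr rfl fun i _ => ?_
    rw [← Algebra.commutes, ← Algebra.smul_def, TensorProduct.tmul_smul]
  have h2 : ∀ j, T.rTensor A (ρ.coact (b j)) = ∑ k, c k ⊗ₜ[ℂ]
      ((LinearMap.toMatrix b c T).map (algebraMap ℂ A) * ρ.toMatrix b) k j := by
    intro j
    simp only [hT, map_sum, coact_basis, Matrix.mul_apply, Matrix.map_apply,
      TensorProduct.tmul_sum, LinearMap.rTensor_tmul, TensorProduct.sum_tmul]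
    rw [Finset.sum_comm]
    refine Finset.sum_congr rfl fun k _ => Finset.sum_congr rfl fun i _ => ?_
    rw [← Algebra.smul_def, TensorProduct.tmul_smul, TensorProduct.smul_tmul']
  change σ.coact ∘ₗ T = T.rTensor A ∘ₗ ρ.coact ↔ _
  constructor
  · intro h
    ext k j
    have h' := LinearMap.congr_fun h (b j)
    rw [LinearMap.comp_apply, LinearMap.comp_apply, h1, h2] at h'
    have h'' := congrArg (tensorCoord c k) h'
    rwa [tensorCoord_sum_tmul, tensorCoord_sum_tmul] at h''
  · intro h
    refine b.ext fun j => ?_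
    rw [LinearMap.comp_apply, LinearMap.comp_apply, h1, h2, h]

end ComoduleStr

/-! ### Conjugation by a pair of corepresentations -/

/-- The matrix `r` defines a corepresentation. -/
structure IsCorep {A ι : Type} [Ring A] [HopfAlgebra ℂ A] [Fintype ι] [DecidableEq ι]
    (r : Matrix ι ι A) : Prop where
  comul_eq : ∀ i j, Coalgebra.comul (R := ℂ) (r i j) = ∑ k, r i k ⊗ₜ[ℂ] r k j
  counit_eq : ∀ i j, Coalgebra.counit (R := ℂ) (r i j) = if i = j then 1 else 0

section conj

theorem map_map_algebraMap {B C ι κ : Type} [Ring B] [Algebra ℂ B] [Ring C] [Algebra ℂ C]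
    (T : Matrix κ ι ℂ) (π : B →ₐ[ℂ] C) :
    (T.map (algebraMap ℂ B)).map π = T.map (algebraMap ℂ C) := by
  ext i j
  exact π.commutes _

variable {A ι κ : Type} [Ring A] [HopfAlgebra ℂ A] [Fintype ι] [DecidableEq ι] [Fintype κ]
  {r : Matrix ι ι A} {t : Matrix κ κ A}

theorem IsCorep.antipode_mul (hr : IsCorep r) : r.map (HopfAlgebra.antipode ℂ) * r = 1 := by
  ext i j
  have h := LinearMap.congr_fun (HopfAlgebra.mul_antipode_rTensor_comul (R := ℂ) (A := A)) (r i j)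
  simp only [LinearMap.comp_apply, hr.comul_eq, hr.counit_eq, map_sum, LinearMap.rTensor_tmul,
    LinearMap.mul'_apply, Algebra.linearMap_apply] at h
  rw [Matrix.mul_apply, Matrix.one_apply]
  refine Eq.trans h ?_
  split_ifs <;> simp

theorem IsCorep.mul_antipode (hr : IsCorep r) : r * r.map (HopfAlgebra.antipode ℂ) = 1 := by
  ext i j
  have h := LinearMap.congr_fun (HopfAlgebra.mul_antipode_lTensor_comul (R := ℂ) (A := A)) (r i j)
  simp only [LinearMap.comp_apply, hr.comul_eq, hr.counit_eq, map_sum, LinearMap.lTensor_tmul,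
    LinearMap.mul'_apply, Algebra.linearMap_apply] at h
  rw [Matrix.mul_apply, Matrix.one_apply]
  refine Eq.trans h ?_
  split_ifs <;> simp

/-- The matrix `t * T * r⁻¹`, where the antipode gives the inverse of `r`. The entries of `T` are
the coordinates of a morphism from `r` to `t` if and only if this matrix is `T`. -/
def conjMatrix (t : Matrix κ κ A) (T : Matrix κ ι ℂ) (r : Matrix ι ι A) : Matrix κ ι A :=
  t * T.map (algebraMap ℂ A) * r.map (HopfAlgebra.antipode ℂ)

theorem map_conjMatrix_eq {B : Type} [Ring B] [Algebra ℂ B] (hr : IsCorep r) (T : Matrix κ ι ℂ)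
    (π : A →ₐ[ℂ] B)
    (h : t.map π * T.map (algebraMap ℂ B) = T.map (algebraMap ℂ B) * r.map π) :
    (conjMatrix t T r).map π = T.map (algebraMap ℂ B) := by
  rw [conjMatrix, Matrix.map_mul, Matrix.map_mul, map_map_algebraMap, h, Matrix.mul_assoc,
    ← Matrix.map_mul, hr.mul_antipode, Matrix.map_one _ (map_zero π) (map_one π), Matrix.mul_one]

/-- With `r₁ = r ⊗ 1` and `z₂ = 1 ⊗ z`, this is the identity `Δ(z) = t₁ * z₂ * r₁⁻¹` for
`z = t * T * r⁻¹`. -/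
theorem comul_conjMatrix [DecidableEq κ] (hr : IsCorep r) (ht : IsCorep t) (T : Matrix κ ι ℂ)
    (a : κ) (d : ι) :
    Coalgebra.comul (R := ℂ) (conjMatrix t T r a d) =
      ∑ e, ∑ c, (t a e * HopfAlgebra.antipode ℂ (r c d)) ⊗ₜ[ℂ] conjMatrix t T r e c := by
  let Δ : A →ₐ[ℂ] A ⊗[ℂ] A := Bialgebra.comulAlgHom ℂ A
  let l : A →ₐ[ℂ] A ⊗[ℂ] A := Algebra.TensorProduct.includeLeft
  let ρ : A →ₐ[ℂ] A ⊗[ℂ] A := Algebra.TensorProduct.includeRight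
  have hone : ∀ π : A →ₐ[ℂ] A ⊗[ℂ] A, (1 : Matrix ι ι A).map π = 1 :=
    fun π => Matrix.map_one _ (map_zero π) (map_one π)
  have h1 : r.map Δ = r.map l * r.map ρ := by
    ext i j
    refine (hr.comul_eq i j).trans ?_
    simp [Matrix.mul_apply, l, ρ]
  have h2 : t.map Δ = t.map l * t.map ρ := by
    ext i j
    refine (ht.comul_eq i j).trans ?_
    simp [Matrix.mul_apply, l, ρ]
  let s : Matrix ι ι A := r.map (HopfAlgebra.antipode ℂ)
  -- The inverse of `r.map Δ = r.map l * r.map ρ` is unique.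
  have h3 : s.map Δ = s.map ρ * s.map l := by
    have e1 : s.map Δ * r.map Δ = 1 := by rw [← Matrix.map_mul, hr.antipode_mul, hone]
    have e2 : r.map Δ * (s.map ρ * s.map l) = 1 := by
      rw [h1, Matrix.mul_assoc, ← Matrix.mul_assoc (r.map ρ), ← Matrix.map_mul, hr.mul_antipode,
        hone, Matrix.one_mul, ← Matrix.map_mul, hr.mul_antipode, hone]
    exact left_inv_eq_right_inv e1 e2
  have h4 : (conjMatrix t T r).map Δ = t.map l * (conjMatrix t T r).map ρ * s.map l := by
    simp only [conjMatrix, Matrix.map_mul, map_map_algebraMap]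
    change t.map Δ * _ * s.map Δ = _ * (_ * _ * s.map ρ) * s.map l
    rw [h2, h3]
    simp only [Matrix.mul_assoc]
  refine (congrFun (congrFun h4 a) d).trans ?_
  simp only [Matrix.mul_apply, Matrix.map_apply, Finset.sum_mul]
  rw [Finset.sum_comm]
  refine Finset.sum_congr rfl fun e _ => Finset.sum_congr rfl fun c _ => ?_
  simp [l, ρ, s]

theorem counit_conjMatrix [DecidableEq κ] (hr : IsCorep r) (ht : IsCorep t) (T : Matrix κ ι ℂ) :
    (conjMatrix t T r).map (Coalgebra.counit (R := ℂ)) = T := by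
  have h := map_conjMatrix_eq (t := t) hr T (Bialgebra.counitAlgHom ℂ A) (by
    have h1 : r.map (Bialgebra.counitAlgHom ℂ A) = 1 := by
      ext i j
      exact (hr.counit_eq i j).trans (Matrix.one_apply).symm
    have h2 : t.map (Bialgebra.counitAlgHom ℂ A) = 1 := by
      ext i j
      exact (ht.counit_eq i j).trans (Matrix.one_apply).symm
    rw [h1, h2, Matrix.one_mul, Matrix.mul_one])
  exact h

/-- If a functional maps `t * T * r⁻¹` to `T`, then so do its convolution powers. -/
theorem convPow_conjMatrix [DecidableEq κ] (hr : IsCorep r) (ht : IsCorep t) {T : Matrix κ ι ℂ}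
    {φ : A →ₗ[ℂ] ℂ} (hφ : ∀ a d, φ (conjMatrix t T r a d) = T a d) (k : ℕ) (a : κ) (d : ι) :
    convPow φ k (conjMatrix t T r a d) = T a d := by
  induction k generalizing a d with
  | zero => exact congrFun (congrFun (counit_conjMatrix hr ht T) a) d
  | succ k ih =>
    simp only [convPow, LinearMap.comp_apply, comul_conjMatrix hr ht, map_sum,
      TensorProduct.map_tmul, LinearMap.mul'_apply, ih]
    rw [← hφ a d, conjMatrix]
    simp only [Matrix.mul_apply, Matrix.map_apply, Finset.sum_mul, map_sum]
    rw [Finset.sum_comm]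
    refine Finset.sum_congr rfl fun e _ => Finset.sum_congr rfl fun c _ => ?_
    rw [← Algebra.commutes, mul_assoc, ← Algebra.smul_def, map_smul, smul_eq_mul, mul_comm]

end conj

namespace ReflAlg

variable {ι κ : Type} [Fintype ι] [DecidableEq ι] [Fintype κ] [DecidableEq κ] {s : ℕ∞}

/-- If the Haar functional maps `z = t * T * r⁻¹` to `T`, then `T` intertwines `r` and `t`: by
invariance, `T = t * T * r⁻¹`. -/
theorem intertwines_of_haar_conjMatrix {N : ℕ} {r : Matrix ι ι (ReflAlg N s)}
    {t : Matrix κ κ (ReflAlg N s)} (hr : IsCorep r) (ht : IsCorep t) {T : Matrix κ ι ℂ}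
    (h : ∀ a d, haar N s (conjMatrix t T r a d) = T a d) :
    t * T.map (algebraMap ℂ (ReflAlg N s)) = T.map (algebraMap ℂ (ReflAlg N s)) * r := by
  have h1 : conjMatrix t T r = T.map (algebraMap ℂ (ReflAlg N s)) := by
    ext a d
    have h2 := haar_invariant (conjMatrix t T r a d)
    rw [comul_conjMatrix hr ht, h, ← Algebra.algebraMap_eq_smul_one] at h2
    refine Eq.trans ?_ h2
    simp only [map_sum, TensorProduct.lift.tmul, LinearMap.compl₂_apply, LinearMap.flip_apply,
      LinearMap.lsmul_apply, h]
    rw [conjMatrix]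
    simp only [Matrix.mul_apply, Matrix.map_apply, Finset.sum_mul]
    rw [Finset.sum_comm]
    refine Finset.sum_congr rfl fun e _ => Finset.sum_congr rfl fun c _ => ?_
    rw [← Algebra.commutes, mul_assoc, ← Algebra.smul_def]
  calc t * T.map (algebraMap ℂ (ReflAlg N s)) = conjMatrix t T r * r := by
        rw [conjMatrix, Matrix.mul_assoc _ _ r, hr.antipode_mul, Matrix.mul_one]
    _ = T.map (algebraMap ℂ (ReflAlg N s)) * r := by rw [h1]

/-- An intertwiner for `H_{N-1}^{s+}` and for `S_N` is an intertwiner for `H_N^{s+}`, in terms of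
matrices. -/
theorem intertwines_of_corner_of_sym {m : ℕ} (hm : 4 ≤ m) {r : Matrix ι ι (ReflAlg (m + 2) s)}
    {t : Matrix κ κ (ReflAlg (m + 2) s)} (hr : IsCorep r) (ht : IsCorep t) {T : Matrix κ ι ℂ}
    (h1 : t.map (cornerHom (m + 2) s) * T.map (algebraMap ℂ (ReflAlg (m + 2 - 1) s)) =
      T.map (algebraMap ℂ (ReflAlg (m + 2 - 1) s)) * r.map (cornerHom (m + 2) s))
    (h2 : t.map (symHom (m + 2) s) * T.map (algebraMap ℂ (FunAlg (Equiv.Perm (Fin (m + 2))))) =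
      T.map (algebraMap ℂ (FunAlg (Equiv.Perm (Fin (m + 2))))) * r.map (symHom (m + 2) s)) :
    t * T.map (algebraMap ℂ (ReflAlg (m + 2) s)) =
      T.map (algebraMap ℂ (ReflAlg (m + 2) s)) * r := by
  refine intertwines_of_haar_conjMatrix hr ht fun a d =>
    haar_eq_of_convPow_meanFunctional hm fun k => convPow_conjMatrix hr ht (fun a d => ?_) k a d
  have e1 : cornerHom (m + 2) s (conjMatrix t T r a d) = algebraMap ℂ _ (T a d) :=
    congrFun (congrFun (map_conjMatrix_eq hr T
      (cornerHom (m + 2) s : ReflAlg (m + 2) s →ₐ[ℂ] ReflAlg (m + 2 - 1) s) h1) a) d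
  have e2 : symHom (m + 2) s (conjMatrix t T r a d) = algebraMap ℂ _ (T a d) :=
    congrFun (congrFun (map_conjMatrix_eq hr T
      (symHom (m + 2) s : ReflAlg (m + 2) s →ₐ[ℂ] FunAlg (Equiv.Perm (Fin (m + 2)))) h2) a) d
  rw [meanFunctional_apply, e1, e2, AlgHom.commutes]
  change 2⁻¹ * (haar (m + 1) s (algebraMap ℂ (ReflAlg (m + 1) s) (T a d)) + T a d) = T a d
  rw [Algebra.algebraMap_eq_smul_one, map_smul, haar_one, smul_eq_mul, mul_one]
  ring

end ReflAlg

end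

/-- For `N ≥ 6` and `1 ≤ s ≤ ∞`, the quantum reflection group `H_N^{s+}` is topologically
generated by its quantum subgroups `H_{N-1}^{s+}` and `S_N`. -/
theorem theorem3p10 (N : ℕ) (hN : 6 ≤ N) (s : ℕ∞) (hs : 1 ≤ s) :
    TopologicallyGenerates ![cornerSubgroup N s, symmetricSubgroup N s] := by
  intro V W _ _ _ _ _ _ ρ σ
  refine le_antisymm (le_iInf fun i => ComoduleStr.hom_le_hom_restrict ρ σ _) fun T hT => ?_
  obtain ⟨m, rfl⟩ : ∃ m, N = m + 2 := ⟨N - 2, by omega⟩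
  rw [Submodule.mem_iInf] at hT
  have h1 : T ∈ (ρ.restrict (cornerHom (m + 2) s)).hom (σ.restrict (cornerHom (m + 2) s)) := hT 0
  have h2 : T ∈ (ρ.restrict (symHom (m + 2) s)).hom (σ.restrict (symHom (m + 2) s)) := hT 1
  let b := Module.finBasis ℂ V
  let c := Module.finBasis ℂ W
  rw [ComoduleStr.mem_hom_iff _ _ b c, ComoduleStr.toMatrix_restrict,
    ComoduleStr.toMatrix_restrict] at h1 h2
  rw [ComoduleStr.mem_hom_iff _ _ b c]
  exact ReflAlg.intertwines_of_corner_of_sym (by omega)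
    ⟨ρ.comul_toMatrix b, ρ.counit_toMatrix b⟩ ⟨σ.comul_toMatrix c, σ.counit_toMatrix c⟩ h1 h2
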